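/- **Proposition.** There is a constant $C>0$ such that the following holds for every $g$ and every convex lattice polygon $\Delta\subset\mathbb{R}^2$ with exactly $g$ interior lattice points. Suppose that $\Delta$ is nonhyperelliptic (the convex hull $\Delta^{(1)}$ of its interior lattice points is two-dimensional) and that $\Delta$ has lattice width $3$ (the least width of a horizontal strip containing $A\Delta$ for some $A\in \mathrm{SL}_2(\mathbb{Z})$ is $3$). Then the number of troplanar graphs, counted up to isomorphism, to which $\Delta$ gives rise is finite and at most $$C\cdot\frac{8^g}{\sqrt{g}} .$$ Here a graph may have loops and multiple edges. A triangulation of $\Delta$ by lattice triangles is *unimodular* if each of its triangles has area $\tfrac12$, and *regular* if it is the projection of the lower faces of the convex hull of the points $(p,\omega(p))$, $p\in\Delta\cap\mathbb{Z}^2$, for some height function $\omega\colon\Delta\cap\mathbb{Z}^2\to\mathbb{R}$. The polygon $\Delta$ *gives rise to* the skeletons of the smooth tropical plane curves dual to its regular unimodular triangulations $\mathcal{T}$. Such a curve, with its rays removed, is the graph with one vertex for each triangle of $\mathcal{T}$ and one edge for each pair of triangles sharing an edge. Its *skeleton* is obtained by iteratively deleting leaves together with their edges, and then smoothing over all $2$-valent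 vertices. -/

import Mathlib

/-! ### Convex lattice polygons -/

/-- The lattice point `p` as a point of the real plane. -/
def toPlane (p : ℤ × ℤ) : ℝ × ℝ := ((p.1 : ℝ), (p.2 : ℝ))

/-- The convex hull in the plane of a set of lattice points. -/
def latticeHull (S : Set (ℤ × ℤ)) : Set (ℝ × ℝ) := convexHull ℝ (toPlane '' S)

/-- A (two-dimensional, convex) lattice polygon. -/
def IsLatticePolygon (P : Set (ℝ × ℝ)) : Prop :=
  (∃ S : Finset (ℤ × ℤ), P = latticeHull (S : Set (ℤ × ℤ))) ∧ (interior P).Nonempty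

/-- All lattice points of `P`, on the boundary or in the interior. -/
def latticePoints (P : Set (ℝ × ℝ)) : Set (ℤ × ℤ) := {p | toPlane p ∈ P}

/-- The interior lattice points of `P`. -/
def interiorLatticePoints (P : Set (ℝ × ℝ)) : Set (ℤ × ℤ) := {p | toPlane p ∈ interior P}

/-- The genus of a lattice polygon: its number of interior lattice points. -/
noncomputable def latticeGenus (P : Set (ℝ × ℝ)) : ℕ := (interiorLatticePoints P).ncard

/-- The interior polygon: the convex hull of the interior lattice points. -/
def interiorPolygon (P : Set (ℝ × ℝ)) : Set (ℝ × ℝ) := latticeHull (interiorLatticePoints P)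

/-- A polygon is nonhyperelliptic if its interior polygon is two-dimensional. -/
def IsNonhyperelliptic (P : Set (ℝ × ℝ)) : Prop := (interior (interiorPolygon P)).Nonempty

/-- The linear action of an integer matrix of determinant one on the plane. -/
def matrixAct (A : Matrix.SpecialLinearGroup (Fin 2) ℤ) (x : ℝ × ℝ) : ℝ × ℝ :=
  ((A.1 0 0 : ℝ) * x.1 + (A.1 0 1 : ℝ) * x.2, (A.1 1 0 : ℝ) * x.1 + (A.1 1 1 : ℝ) * x.2)

/-- `w` is the lattice width of `P`: the least width of a horizontal strip `c ≤ y ≤ c + w`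
that contains a polygon `A P` equivalent to `P`. -/
def HasLatticeWidth (P : Set (ℝ × ℝ)) (w : ℝ) : Prop :=
  IsLeast {h : ℝ | ∃ (A : Matrix.SpecialLinearGroup (Fin 2) ℤ) (c : ℝ),
    ∀ x ∈ P, c ≤ (matrixAct A x).2 ∧ (matrixAct A x).2 ≤ c + h} w

/-! ### Regular unimodular triangulations -/

/-- The determinant of `q - p` and `r - p`: twice the signed area of the triangle `p q r`. -/
def latticeDet (p q r : ℤ × ℤ) : ℤ :=
  (q.1 - p.1) * (r.2 - p.2) - (q.2 - p.2) * (r.1 - p.1)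

/-- `t` is the vertex set of a lattice triangle of area `1 / 2`. -/
def IsUnimodularTriangle (t : Finset (ℤ × ℤ)) : Prop :=
  ∃ p q r : ℤ × ℤ, t = {p, q, r} ∧ |latticeDet p q r| = 1

/-- `T` is (the set of vertex sets of the triangles of) a unimodular triangulation of `P`:
the triangles have area `1 / 2`, cover `P`, and any two of them meet in a mutual face, which for
triangles means in the convex hull of their common vertices. -/
structure IsUnimodularTriangulation (P : Set (ℝ × ℝ)) (T : Finset (Finset (ℤ × ℤ))) : Prop where
  unimodular : ∀ t ∈ T, IsUnimodularTriangle t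
  cover : (⋃ t ∈ T, latticeHull (t : Set (ℤ × ℤ))) = P
  face_to_face : ∀ s ∈ T, ∀ t ∈ T,
    latticeHull (s : Set (ℤ × ℤ)) ∩ latticeHull (t : Set (ℤ × ℤ)) =
      latticeHull ((s : Set (ℤ × ℤ)) ∩ (t : Set (ℤ × ℤ)))

/-- `t` is the set of lattice points of `P` lying under a two-dimensional lower face of the convex
hull of the points `(p, ω p)`, where `p` runs over the lattice points of `P`: some affine function
is at most `ω` at all these `p`, with equality exactly on `t`, and `t` is not contained in a
line. -/
def IsLowerFace (P : Set (ℝ × ℝ)) (ω : ℤ × ℤ → ℝ) (t : Finset (ℤ × ℤ)) : Prop :=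
  (∃ a b c : ℝ,
    (∀ p ∈ latticePoints P, a * (p.1 : ℝ) + b * (p.2 : ℝ) + c ≤ ω p) ∧
    ∀ p, p ∈ t ↔ p ∈ latticePoints P ∧ ω p = a * (p.1 : ℝ) + b * (p.2 : ℝ) + c) ∧
  ∃ p ∈ t, ∃ q ∈ t, ∃ r ∈ t, latticeDet p q r ≠ 0

/-- `T` is a unimodular triangulation of `P` that is regular, that is, induced by some height
function `ω` on the lattice points of `P`. -/
def IsRegularUnimodularTriangulation (P : Set (ℝ × ℝ)) (T : Finset (Finset (ℤ × ℤ))) : Prop :=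
  IsUnimodularTriangulation P T ∧ ∃ ω : ℤ × ℤ → ℝ, ∀ t, t ∈ T ↔ IsLowerFace P ω t

/-- The smooth tropical plane curve dual to the triangulation `T`, as an abstract graph and with
its rays removed: one vertex for each triangle, and one edge for each pair of distinct triangles
that share an edge (that is, two vertices). -/
def dualGraph (T : Finset (Finset (ℤ × ℤ))) :
    Graph (Finset (ℤ × ℤ)) (Sym2 (Finset (ℤ × ℤ))) where
  vertexSet := (T : Set (Finset (ℤ × ℤ)))
  IsLink e s t := s ∈ T ∧ t ∈ T ∧ s ≠ t ∧ (s ∩ t).card = 2 ∧ e = s(s, t)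
  isLink_symm e _ := ⟨fun s t h =>
    ⟨h.2.1, h.1, h.2.2.1.symm, by rw [Finset.inter_comm]; exact h.2.2.2.1,
      by rw [Sym2.eq_swap]; exact h.2.2.2.2⟩⟩
  eq_or_eq_of_isLink_of_isLink := by
    rintro e x y v w ⟨-, -, -, -, h⟩ ⟨-, -, -, -, h'⟩
    rw [h, Sym2.eq_iff] at h'
    rcases h' with h' | h'
    · exact Or.inl h'.1
    · exact Or.inr h'.1
  left_mem_of_isLink := fun _ _ _ h => h.1

/-! ### Skeletons of graphs

Mathlib's `Graph` allows loops and multiple edges. -/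

/-- `G'` is obtained from `G` by deleting a leaf (a vertex whose only incident edge is a non-loop)
together with its edge. -/
def RetractsLeaf {α β : Type*} (G G' : Graph α β) : Prop :=
  ∃ (v : α) (e : β), G.IsNonloopAt e v ∧ (∀ f, G.Inc f v → f = e) ∧ G' = G.deleteVerts {v}

/-- `G'` is obtained from `G` by smoothing over a `2`-valent vertex `v` that is incident to two
distinct edges `e₁`, `e₂`, with other ends `u ≠ v` and `w ≠ v`: the vertex `v` is removed and the
two edges are merged into a single edge (labelled `e₁`) between `u` and `w`. Here `u = w` is
possible, and then the new edge is a loop. -/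
def SmoothsVertex {α β : Type*} (G G' : Graph α β) : Prop :=
  ∃ (v u w : α) (e₁ e₂ : β), e₁ ≠ e₂ ∧ u ≠ v ∧ w ≠ v ∧ G.IsLink e₁ v u ∧ G.IsLink e₂ v w ∧
    (∀ f, G.Inc f v → f = e₁ ∨ f = e₂) ∧
    G'.vertexSet = G.vertexSet \ {v} ∧
    ∀ f x y, G'.IsLink f x y ↔
      (f ≠ e₁ ∧ f ≠ e₂ ∧ G.IsLink f x y) ∨ (f = e₁ ∧ s(x, y) = s(u, w))

/-- `K` is a skeleton of `G`: starting with `G`, retract leaves for as long as there are any, then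
smooth over `2`-valent vertices for as long as there are any; the result is `K`. -/
def IsSkeleton {α β : Type*} (G K : Graph α β) : Prop :=
  ∃ H : Graph α β,
    Relation.ReflTransGen RetractsLeaf G H ∧ (¬ ∃ H', RetractsLeaf H H') ∧
    Relation.ReflTransGen SmoothsVertex H K ∧ (¬ ∃ K', SmoothsVertex K K')

/-- Isomorphism of graphs: a bijection of the vertex sets that preserves, for all `v` and `w`, the
number of edges between `v` and `w`. -/
def GraphIsomorphic {α β : Type*} (G H : Graph α β) : Prop :=
  ∃ f : G.vertexSet ≃ H.vertexSet, ∀ v w : G.vertexSet,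
    {e | G.IsLink e v w}.encard = {e | H.IsLink e (f v) (f w)}.encard

/-- Isomorphism as an equivalence relation. -/
def graphIsoSetoid (α β : Type*) : Setoid (Graph α β) where
  r := GraphIsomorphic
  iseqv :=
    { refl := fun _ => ⟨Equiv.refl _, fun _ _ => rfl⟩
      symm := by
        rintro G H ⟨f, hf⟩
        refine ⟨f.symm, fun v w => ?_⟩
        rw [hf, Equiv.apply_symm_apply, Equiv.apply_symm_apply]
      trans := by
        rintro G H K ⟨f, hf⟩ ⟨g, hg⟩
        exact ⟨f.trans g, fun v w => (hf v w).trans (hg (f v) (f w))⟩ }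

/-! ### Troplanar graphs arising from a polygon -/

/-- The skeletons of the smooth tropical plane curves that are dual to the regular unimodular
triangulations of `P`. -/
def troplanarGraphs (P : Set (ℝ × ℝ)) :
    Set (Graph (Finset (ℤ × ℤ)) (Sym2 (Finset (ℤ × ℤ)))) :=
  {K | ∃ T, IsRegularUnimodularTriangulation P T ∧ IsSkeleton (dualGraph T) K}

/-- The troplanar graphs that `P` gives rise to, up to isomorphism. -/
def troplanarClasses (P : Set (ℝ × ℝ)) :
    Set (Quotient (graphIsoSetoid (Finset (ℤ × ℤ)) (Sym2 (Finset (ℤ × ℤ))))) :=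
  Quotient.mk _ '' troplanarGraphs P

/-! The idea is to encode the skeleton by a word read off along a line that cuts the polygon
lengthwise, and to count words.

An affine unimodular map moves Δ into the strip 0 ≤ y ≤ 3, touching both boundary rows. On each of
the rows y = 1 and y = 2 all lattice points of Δ but at most two are interior, so these rows carry
at most g + 4 points. Along the line y = 3/2 a unimodular triangulation is a sequence of triangles.
Each has a left and a right edge crossing the line, and passing through it moves either the lower or
the upper end of the crossing edge. A letter records which end moves and whether its old and its new
position lie on the adjacent interior row (y = 1 for the lower end, y = 2 for the upper one).

The word determines the skeleton. A triangle below y = 1 has either an edge on y = 1, across which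
there is a triangle meeting y = 3/2, or an edge on y = 0 and an apex on y = 1. In the second case
the edge on y = 0 is not shared, so the triangle has at most two neighbours and can be removed from
the dual graph. A chain of such triangles around an apex p collapses to one link between the
triangles that meet the row y = 1 from below just left and just right of p. These are found from the
steps at which the lower end enters and leaves p. The part above y = 2 is symmetric. What remains is
`wordGraph`, which depends on the word alone up to renaming the vertices
(`CombTriangulation.reduction_wordGraph`, `exists_wordGraph_perm`).

That a partial reduction suffices is confluence: removing leaves and 2-valent vertices in any order
leads to the same terminal multigraph up to renaming (`Step.diamond`, `Terminal.class_eq`), and a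
skeleton is such a terminal multigraph.

For the count, each point of an interior row is entered at most once, so at most g + 4 letters
arrive on an interior row; and unimodularity forbids an end to move from boundary row to boundary
row. A linear recursion bounds the number of such words by a constant times 7 ^ g
(`exists_finset_words`), and 7 ^ g * √g ≤ 2 * 8 ^ g by Bernoulli's inequality. -/

/-! ### Rewriting finite multigraphs -/

section Rewriting

/-- A finite multigraph, given by its vertices and the multiset of its edges. -/
@[ext] structure MGraph (α : Type*) where
  verts : Finset α
  edges : Multiset (Sym2 α)

namespace MGraph

variable {α β : Type*}

/-- The edges `A` are all the edges at the vertex `v`, which is a leaf or `2`-valent, and `B` are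
the edges that replace them when `v` is removed. -/
inductive Star (v : α) : Multiset (Sym2 α) → Multiset (Sym2 α) → Prop
  | leaf (u : α) : u ≠ v → Star v {s(v, u)} 0
  | pass (u w : α) : u ≠ v → w ≠ v → Star v {s(v, u), s(v, w)} {s(u, w)}

open Classical in
/-- Removal of a leaf or of a `2`-valent vertex. -/
def Step (G H : MGraph α) : Prop :=
  ∃ v ∈ G.verts, ∃ A B R, Star v A B ∧ G.edges = A + R ∧ (∀ e ∈ R, v ∉ e) ∧
    H = ⟨G.verts.erase v, B + R⟩

/-- The action of a permutation of the vertices. -/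
def perm (σ : Equiv.Perm α) (G : MGraph α) : MGraph α :=
  ⟨G.verts.map σ.toEmbedding, G.edges.map (Sym2.map σ)⟩

lemma perm_one (G : MGraph α) : G.perm 1 = G := by
  ext x
  · simp only [perm, Finset.mem_map_equiv]; rfl
  · simp [perm]

lemma perm_perm (σ τ : Equiv.Perm α) (G : MGraph α) : (G.perm σ).perm τ = G.perm (τ * σ) := by
  have : (Sym2.map (τ * σ) : Sym2 α → Sym2 α) = Sym2.map τ ∘ Sym2.map σ := by
    rw [Equiv.Perm.coe_mul, Sym2.map_comp]
  simp only [perm, this, Multiset.map_map, Finset.map_map]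
  congr 1

/-- Equality of multigraphs up to a permutation of the vertices. -/
def permSetoid (α : Type*) : Setoid (MGraph α) where
  r G H := ∃ σ : Equiv.Perm α, G.perm σ = H
  iseqv :=
    { refl := fun G => ⟨1, perm_one G⟩
      symm := by
        rintro G H ⟨σ, rfl⟩
        exact ⟨σ⁻¹, by rw [perm_perm, inv_mul_cancel, perm_one]⟩
      trans := by
        rintro G H K ⟨σ, rfl⟩ ⟨τ, rfl⟩
        exact ⟨τ * σ, (perm_perm σ τ G).symm⟩ }

lemma Star.mem_left {v : α} {A B : Multiset (Sym2 α)} (h : Star v A B) : ∀ e ∈ A, v ∈ e := by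
  cases h <;> simp

lemma Star.map {v : α} {A B : Multiset (Sym2 α)} (h : Star v A B) (σ : Equiv.Perm α) :
    Star (σ v) (A.map (Sym2.map σ)) (B.map (Sym2.map σ)) := by
  cases h with
  | leaf u h => simpa using Star.leaf (σ u) (by simpa using h)
  | pass u w h h' =>
    simpa using Star.pass (σ u) (σ w) (by simpa using h) (by simpa using h')

lemma Star.unique {v : α} {A B B' : Multiset (Sym2 α)} (h : Star v A B) (h' : Star v A B') :
    B = B' := by
  have inj : ∀ x y : α, s(v, x) = s(v, y) → x = y := fun x y hxy => Sym2.congr_right.mp hxy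
  generalize hA : A = A' at h'
  cases h with
  | leaf u h =>
    cases h' with
    | leaf u' h' => rfl
    | pass u' w' h1 h2 => simpa using congrArg Multiset.card hA
  | pass u w h h2 =>
    cases h' with
    | leaf u' h' => simpa using congrArg Multiset.card hA
    | pass u' w' h1 h2 =>
      simp only [Multiset.insert_eq_cons] at hA
      rcases Multiset.cons_eq_cons.mp hA with ⟨h3, h4⟩ | ⟨_, C, h4, h5⟩
      · rw [inj _ _ h3, inj _ _ (Multiset.singleton_inj.mp h4)]
      -- Here the two edges at `v` are listed in opposite orders; the replacing edge is an unordered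
      -- pair, so it is the same.
      · have hC : C = 0 := by simpa using congrArg Multiset.card h4
        subst hC
        simp only [Multiset.cons_zero, Multiset.singleton_inj] at h4 h5
        rw [inj _ _ h4, inj _ _ h5, Sym2.eq_swap]

open Classical in
/-- The map that moves `v` onto `u`. -/
noncomputable def moveTo (v u x : α) : α := if x = v then u else x

lemma map_moveTo_of_not_mem {v u : α} {R : Multiset (Sym2 α)} (h : ∀ e ∈ R, v ∉ e) :
    R.map (Sym2.map (moveTo v u)) = R := by
  conv_rhs => rw [← Multiset.map_id R]
  refine Multiset.map_congr rfl fun e he => ?_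
  have := h e he
  induction e with
  | h x y =>
    simp only [Sym2.mem_iff, not_or] at this
    simp [moveTo, Ne.symm this.1, Ne.symm this.2]

/-- Removing a leaf and smoothing a 2-valent vertex are both the contraction of an edge at `v`. This
common form avoids a case distinction when two removable vertices are adjacent. -/
lemma Star.contract {v u : α} {A B : Multiset (Sym2 α)} (h : Star v A B) (hu : s(v, u) ∈ A) :
    ∃ F, A = s(v, u) ::ₘ F ∧ B = F.map (Sym2.map (moveTo v u)) := by
  cases h with
  | leaf u' h =>
    obtain rfl : u = u' := Sym2.congr_right.mp (Multiset.mem_singleton.mp hu)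
    exact ⟨0, rfl, rfl⟩
  | pass u' w h h' =>
    have : u = u' ∨ u = w := by
      simpa only [Multiset.insert_eq_cons, Multiset.mem_cons, Multiset.mem_singleton,
        Sym2.congr_right] using hu
    rcases this with rfl | rfl
    · exact ⟨{s(v, w)}, rfl, by simp [moveTo, h']⟩
    · exact ⟨{s(v, u')}, Multiset.pair_comm _ _, by simp [moveTo, h, Sym2.eq_swap]⟩

lemma Step.perm {G H : MGraph α} (h : Step G H) (σ : Equiv.Perm α) :
    Step (G.perm σ) (H.perm σ) := by
  obtain ⟨v, hv, A, B, R, hS, hG, hR, rfl⟩ := h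
  refine ⟨σ v, by simpa [MGraph.perm] using hv, _, _, R.map (Sym2.map σ), hS.map σ, ?_, ?_, ?_⟩
  · simp [MGraph.perm, hG]
  · intro e he
    obtain ⟨e', he', rfl⟩ := Multiset.mem_map.mp he
    intro hve
    obtain ⟨x, hx, hxv⟩ := Sym2.mem_map.mp hve
    exact hR e' he' (σ.injective hxv ▸ hx)
  · ext x
    · simp only [MGraph.perm, Finset.mem_map_equiv, Finset.mem_erase, ne_eq, Equiv.symm_apply_eq]
    · simp [MGraph.perm]

open Classical in
lemma star_eq_filter {v : α} {E A B R : Multiset (Sym2 α)} (hS : Star v A B) (hE : E = A + R)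
    (hR : ∀ e ∈ R, v ∉ e) : E.filter (v ∈ ·) = A ∧ E.filter (v ∉ ·) = R := by
  subst hE
  rw [Multiset.filter_add, Multiset.filter_add, Multiset.filter_eq_self.mpr hS.mem_left,
    Multiset.filter_eq_nil.mpr hR, Multiset.filter_eq_self.mpr hR,
    Multiset.filter_eq_nil.mpr (by simpa using hS.mem_left)]
  simp

/-- Two removable vertices either span an edge, and then both removals contract it, or they are not
adjacent, and then the removals commute. Closing the diamond only up to a permutation is
unavoidable, since the two contractions keep different names for the merged vertex. -/
lemma Step.diamond {G H K : MGraph α} (h₁ : Step G H) (h₂ : Step G K) :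
    (∃ σ : Equiv.Perm α, H.perm σ = K) ∨ ∃ L, Step H L ∧ Step K L := by
  classical
  obtain ⟨v₁, hv₁, A₁, B₁, R₁, hS₁, hG₁, hR₁, rfl⟩ := h₁
  obtain ⟨v₂, hv₂, A₂, B₂, R₂, hS₂, hG₂, hR₂, rfl⟩ := h₂
  obtain ⟨f₁, g₁⟩ := star_eq_filter hS₁ hG₁ hR₁
  obtain ⟨f₂, g₂⟩ := star_eq_filter hS₂ hG₂ hR₂
  by_cases hv : v₁ = v₂
  · subst hv
    obtain rfl : A₁ = A₂ := f₁.symm.trans f₂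
    obtain rfl : R₁ = R₂ := g₁.symm.trans g₂
    rw [hS₁.unique hS₂]
    exact Or.inl ⟨1, perm_one _⟩
  by_cases hadj : s(v₁, v₂) ∈ G.edges
  · left
    have m₁ : s(v₁, v₂) ∈ A₁ := by rw [← f₁, Multiset.mem_filter]; simp [hadj]
    have m₂ : s(v₂, v₁) ∈ A₂ := by
      rw [← f₂, Multiset.mem_filter, Sym2.eq_swap]; simp [hadj]
    obtain ⟨F₁, e₁, rfl⟩ := hS₁.contract m₁
    obtain ⟨F₂, e₂, rfl⟩ := hS₂.contract m₂
    -- Both sides are the edges of `G` with one copy of the contracted edge taken out.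
    have hF : F₁ + R₁ = F₂ + R₂ := by
      have := hG₁.symm.trans hG₂
      rw [e₁, e₂, Sym2.eq_swap, Multiset.cons_add, Multiset.cons_add] at this
      simpa using this
    have t₁ : F₁.map (Sym2.map (moveTo v₁ v₂)) + R₁ =
        (F₁ + R₁).map (Sym2.map (moveTo v₁ v₂)) := by
      rw [Multiset.map_add, map_moveTo_of_not_mem hR₁]
    have t₂ : F₂.map (Sym2.map (moveTo v₂ v₁)) + R₂ =
        (F₂ + R₂).map (Sym2.map (moveTo v₂ v₁)) := by
      rw [Multiset.map_add, map_moveTo_of_not_mem hR₂]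
    refine ⟨Equiv.swap v₁ v₂, ?_⟩
    rw [t₁, t₂, hF]
    ext x
    · simp only [MGraph.perm, Finset.mem_map_equiv, Finset.mem_erase, Equiv.symm_swap]
      by_cases h1 : x = v₁
      · subst h1; simp [hv, hv₁, hv₂, Ne.symm hv]
      by_cases h2 : x = v₂
      · subst h2; simp
      rw [Equiv.swap_apply_of_ne_of_ne h1 h2]
      simp [h1, h2]
    · simp only [MGraph.perm, Multiset.map_map]
      congr 1
      refine Multiset.map_congr rfl fun e _ => ?_
      rw [Function.comp, Sym2.map_map]
      congr 1
      funext y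
      simp only [Function.comp, moveTo]
      by_cases h1 : y = v₁
      · subst h1; simp [hv]
      by_cases h2 : y = v₂
      · subst h2; simp [Ne.symm hv]
      simp [h1, h2, Equiv.swap_apply_of_ne_of_ne h1 h2]
  · right
    -- A vertex not adjacent to `v` lies neither on the edges removed with `v` nor on their
    -- replacement, so its own edges survive the other step.
    have aux : ∀ {v x : α} {A B R : Multiset (Sym2 α)}, Star v A B → G.edges = A + R → x ≠ v →
        s(v, x) ∉ G.edges → (∀ e ∈ A, x ∉ e) ∧ ∀ e ∈ B, x ∉ e := by
      intro v x A B R hS hG hx hm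
      have : s(v, x) ∉ A := fun h => hm (by rw [hG]; exact Multiset.mem_add.mpr (Or.inl h))
      cases hS with
      | leaf u h =>
        have : x ≠ u := fun h => this (by rw [h]; simp)
        simp [this, hx]
      | pass u w h h' =>
        have : x ≠ u ∧ x ≠ w :=
          ⟨fun h => this (by rw [h]; simp), fun h => this (by rw [h]; simp)⟩
        simp [this, hx]
    obtain ⟨a₁, b₁⟩ := aux hS₁ hG₁ (Ne.symm hv) hadj
    obtain ⟨a₂, b₂⟩ := aux hS₂ hG₂ hv (by rwa [Sym2.eq_swap])
    set R := (G.edges.filter (v₁ ∉ ·)).filter (v₂ ∉ ·) with hRdef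
    have r₁ : R₁ = A₂ + R := by
      rw [hRdef, g₁, ← Multiset.filter_eq_self.mpr a₂, ← f₂, Multiset.filter_comm, g₁]
      exact (Multiset.filter_add_not _ _).symm
    have r₂ : R₂ = A₁ + R := by
      rw [hRdef, Multiset.filter_comm, g₂, ← Multiset.filter_eq_self.mpr a₁, ← f₁,
        Multiset.filter_comm, g₂]
      exact (Multiset.filter_add_not _ _).symm
    have hR1 : ∀ e ∈ R, v₁ ∉ e := fun e he =>
      (Multiset.mem_filter.mp (Multiset.mem_filter.mp he).1).2
    have hR2 : ∀ e ∈ R, v₂ ∉ e := fun e he => (Multiset.mem_filter.mp he).2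
    refine ⟨⟨(G.verts.erase v₁).erase v₂, B₂ + (B₁ + R)⟩, ?_, ?_⟩
    · refine ⟨v₂, by simp [hv₂, Ne.symm hv], A₂, B₂, B₁ + R, hS₂, ?_, ?_, rfl⟩
      · simp only [r₁]; abel
      · intro e he
        rcases Multiset.mem_add.mp he with h | h
        exacts [b₁ e h, hR2 e h]
    · refine ⟨v₁, by simp [hv₁, hv], A₁, B₁, B₂ + R, hS₁, ?_, ?_, ?_⟩
      · simp only [r₂]; abel
      · intro e he
        rcases Multiset.mem_add.mp he with h | h
        exacts [b₂ e h, hR1 e h]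
      · rw [Finset.erase_right_comm]
        congr 1
        abel

/-- Multigraphs up to permutations of the vertices. -/
abbrev PermClass (α : Type*) := Quotient (permSetoid α)

/-- The steps on multigraphs up to permutations of the vertices. -/
def ClassStep (a b : PermClass α) : Prop :=
  ∃ G H : MGraph α, a = Quotient.mk _ G ∧ b = Quotient.mk _ H ∧ Step G H

lemma ClassStep.exists_rep {G : MGraph α} {b : PermClass α}
    (h : ClassStep (Quotient.mk _ G) b) : ∃ H, b = Quotient.mk _ H ∧ Step G H := by
  obtain ⟨G', H', h1, h2, h3⟩ := h
  obtain ⟨σ, hσ⟩ : ∃ σ : Equiv.Perm α, G'.perm σ = G := Quotient.exact h1.symm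
  refine ⟨H'.perm σ, ?_, hσ ▸ h3.perm σ⟩
  rw [h2]
  exact Quotient.sound ⟨σ, rfl⟩

/-- Passing to classes turns the permutation in `Step.diamond` into an equality, which gives the
hypothesis of `Relation.church_rosser`. -/
lemma ClassStep.diamond (a b c : PermClass α) (h₁ : ClassStep a b) (h₂ : ClassStep a c) :
    ∃ d, Relation.ReflGen ClassStep b d ∧ Relation.ReflTransGen ClassStep c d := by
  induction a using Quotient.inductionOn with
  | h G =>
  obtain ⟨H, rfl, hH⟩ := h₁.exists_rep
  obtain ⟨K, rfl, hK⟩ := h₂.exists_rep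
  rcases hH.diamond hK with h | ⟨L, h, h'⟩
  · exact ⟨_, Relation.ReflGen.refl, by
      rw [Quotient.sound (s := permSetoid α) h]⟩
  · exact ⟨Quotient.mk _ L, .single ⟨_, _, rfl, rfl, h⟩, .single ⟨_, _, rfl, rfl, h'⟩⟩

lemma classSteps_of_steps {G H : MGraph α} (h : Relation.ReflTransGen Step G H) :
    Relation.ReflTransGen ClassStep (Quotient.mk (permSetoid α) G) (Quotient.mk _ H) :=
  h.lift (fun G => Quotient.mk (permSetoid α) G) (fun a b h => ⟨a, b, rfl, rfl, h⟩)

/-- A multigraph is terminal if no vertex can be removed from it. -/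
def Terminal (G : MGraph α) : Prop := ∀ H, ¬ Step G H

lemma Terminal.eq_of_steps {K : MGraph α} (hK : Terminal K) {b : PermClass α}
    (h : Relation.ReflTransGen ClassStep (Quotient.mk _ K) b) : b = Quotient.mk _ K := by
  rcases h.cases_head with h | ⟨c, h, -⟩
  · exact h.symm
  · obtain ⟨H, -, h⟩ := h.exists_rep
    exact absurd h (hK H)

/-- Terminal multigraphs obtained from multigraphs with a common reduction agree. -/
lemma Terminal.class_eq {G G' R R' K K' : MGraph α} (hK : Terminal K) (hK' : Terminal K')
    (hGK : Relation.ReflTransGen Step G K) (hGK' : Relation.ReflTransGen Step G' K')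
    (hGR : Relation.ReflTransGen Step G R) (hGR' : Relation.ReflTransGen Step G' R')
    (hR : ∃ σ : Equiv.Perm α, R.perm σ = R') : ∃ σ : Equiv.Perm α, K.perm σ = K' := by
  have hR' : (Quotient.mk (permSetoid α) R) = Quotient.mk _ R' := Quotient.sound hR
  -- A terminal class reduces only to itself, so by confluence every reduct of `G` still reduces to
  -- `K`.
  have key : ∀ {G R K : MGraph α}, Terminal K → Relation.ReflTransGen Step G K →
      Relation.ReflTransGen Step G R →
      Relation.ReflTransGen ClassStep (Quotient.mk (permSetoid α) R) (Quotient.mk _ K) := by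
    intro G R K hK h h'
    obtain ⟨d, h1, h2⟩ := Relation.church_rosser ClassStep.diamond (classSteps_of_steps h)
      (classSteps_of_steps h')
    rwa [hK.eq_of_steps h1] at h2
  obtain ⟨d, h1, h2⟩ := Relation.church_rosser ClassStep.diamond (key hK hGK hGR)
    (hR' ▸ key hK' hGK' hGR')
  rw [hK.eq_of_steps h1] at h2
  exact Quotient.exact (hK'.eq_of_steps h2)

/-! ### Graphs and multigraphs -/

/-- The multigraph `M` describes the graph `G`. -/
def Models (G : Graph α β) (M : MGraph α) : Prop :=
  (∀ v, v ∈ G.vertexSet ↔ v ∈ M.verts) ∧ ∃ (F : Finset β) (ends : β → Sym2 α),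
    (∀ f x y, G.IsLink f x y ↔ f ∈ F ∧ ends f = s(x, y)) ∧ M.edges = F.val.map ends

open Classical in
lemma Models.encard_eq {G : Graph α β} {M : MGraph α} (h : Models G M) (v w : α) :
    {e | G.IsLink e v w}.encard = (M.edges.count s(v, w) : ℕ∞) := by
  obtain ⟨-, F, ends, h1, h2⟩ := h
  have : {e | G.IsLink e v w} = ((F.filter fun f => s(v, w) = ends f : Finset β) : Set β) := by
    ext f; simp [h1, eq_comm]
  rw [this, Set.encard_coe_eq_coe_finsetCard, h2, Multiset.count_map]
  rfl

lemma Models.graphIsomorphic {G H : Graph α β} {M N : MGraph α} (hG : Models G M)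
    (hH : Models H N) (h : ∃ σ : Equiv.Perm α, M.perm σ = N) : GraphIsomorphic G H := by
  classical
  obtain ⟨σ, rfl⟩ := h
  refine ⟨σ.subtypeEquiv fun a => ?_, fun v w => ?_⟩
  · rw [hG.1, hH.1]; simp [MGraph.perm]
  · rw [hG.encard_eq, hH.encard_eq]
    simp only [Equiv.subtypeEquiv_apply, MGraph.perm]
    rw [show s(σ v, σ w) = Sym2.map σ s(v.1, w.1) from rfl,
      Multiset.count_map_eq_count' _ _ (Sym2.map.injective σ.injective)]

lemma Models.not_mem_of_inc {G : Graph α β} {F : Finset β} {ends : β → Sym2 α}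
    (h1 : ∀ f x y, G.IsLink f x y ↔ f ∈ F ∧ ends f = s(x, y)) {v : α} {f : β} (hf : f ∈ F) :
    v ∈ ends f ↔ G.Inc f v := by
  constructor
  · rintro ⟨y, hy⟩
    exact ⟨y, (h1 f v y).mpr ⟨hf, hy⟩⟩
  · rintro ⟨y, hy⟩
    rw [((h1 f v y).mp hy).2]; simp

lemma Models.retractsLeaf {G G' : Graph α β} {M : MGraph α} (hG : Models G M)
    (h : RetractsLeaf G G') : ∃ M', Step M M' ∧ Models G' M' := by
  classical
  obtain ⟨hV, F, ends, h1, h2⟩ := hG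
  obtain ⟨v, e, he, hv, rfl⟩ := h
  obtain ⟨u, hu, hl⟩ := he
  obtain ⟨heF, hee⟩ := (h1 _ _ _).mp hl
  have key : ∀ f ∈ F.erase e, v ∉ ends f := by
    intro f hf hvf
    exact (Finset.mem_erase.mp hf).1
      (hv f ((Models.not_mem_of_inc h1 (Finset.mem_erase.mp hf).2).mp hvf))
  refine ⟨⟨M.verts.erase v, 0 + (F.erase e).val.map ends⟩, ?_, ?_⟩
  · refine ⟨v, (hV v).mp hl.left_mem, {s(v, u)}, 0, (F.erase e).val.map ends, .leaf u hu, ?_, ?_,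
      rfl⟩
    · rw [h2, ← hee, ← Finset.insert_erase heF, Finset.insert_val_of_notMem (by simp)]
      simp
    · intro e' he'
      obtain ⟨f, hf, rfl⟩ := Multiset.mem_map.mp he'
      exact key f hf
  · refine ⟨fun x => ?_, F.erase e, ends, fun f x y => ?_, by simp⟩
    · simp [hV, and_comm]
    · rw [Graph.deleteVerts_isLink, h1]
      constructor
      · rintro ⟨⟨hf, hxy⟩, hx, hy⟩
        refine ⟨Finset.mem_erase.mpr ⟨?_, hf⟩, hxy⟩
        rintro rfl
        have : v ∈ s(x, y) := by rw [← hxy, hee]; simp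
        simp only [Sym2.mem_iff] at this
        simp only [Set.mem_singleton_iff] at hx hy
        rcases this with h | h
        exacts [hx h.symm, hy h.symm]
      · rintro ⟨hf, hxy⟩
        have := key f hf
        rw [hxy] at this
        simp only [Sym2.mem_iff, not_or] at this
        exact ⟨⟨(Finset.mem_erase.mp hf).2, hxy⟩, Ne.symm this.1, Ne.symm this.2⟩

open Classical in
lemma Models.smoothsVertex {G G' : Graph α β} {M : MGraph α} (hG : Models G M)
    (h : SmoothsVertex G G') : ∃ v u w R, v ∈ M.verts ∧ u ≠ v ∧ w ≠ v ∧ (∀ e ∈ R, v ∉ e) ∧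
      M.edges = {s(v, u), s(v, w)} + R ∧ Models G' ⟨M.verts.erase v, {s(u, w)} + R⟩ := by
  obtain ⟨hV, F, ends, h1, h2⟩ := hG
  obtain ⟨v, u, w, e₁, e₂, he, hu, hw, hl₁, hl₂, hv, hV', hL⟩ := h
  obtain ⟨f₁, d₁⟩ := (h1 _ _ _).mp hl₁
  obtain ⟨f₂, d₂⟩ := (h1 _ _ _).mp hl₂
  set F' := (F.erase e₁).erase e₂ with hF'
  have hFF : F.val = e₁ ::ₘ e₂ ::ₘ F'.val := by
    rw [hF', ← Finset.insert_val_of_notMem (by simp),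
      Finset.insert_erase (by simp [f₂, he.symm]), ← Finset.insert_val_of_notMem (by simp),
      Finset.insert_erase f₁]
  have hm : ∀ f, f ∈ F' ↔ f ≠ e₁ ∧ f ≠ e₂ ∧ f ∈ F := by intro f; simp [hF']; tauto
  refine ⟨v, u, w, F'.val.map ends, (hV v).mp hl₁.left_mem, hu, hw, ?_, ?_, ?_⟩
  · intro e' he'
    obtain ⟨f, hf, rfl⟩ := Multiset.mem_map.mp he'
    intro hvf
    obtain ⟨n1, n2, hf⟩ := (hm f).mp hf
    rcases hv f ((Models.not_mem_of_inc h1 hf).mp hvf) with h | h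
    exacts [n1 h, n2 h]
  · rw [h2, hFF]; simp [d₁, d₂]
  · refine ⟨fun x => ?_, insert e₁ F', Function.update ends e₁ s(u, w), fun f x y => ?_, ?_⟩
    · rw [hV']; simp [hV, and_comm]
    · rw [hL, Finset.mem_insert, hm, h1]
      by_cases hf : f = e₁
      · subst hf; simp [eq_comm]
      · simp [hf, and_assoc]
    · have : e₁ ∉ F' := by simp [hF']
      rw [Finset.insert_val_of_notMem this, Multiset.map_cons, Function.update_self]
      rw [Multiset.singleton_add]
      refine congrArg (s(u, w) ::ₘ ·) ?_
      refine Multiset.map_congr rfl fun f hf => ?_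
      rw [Function.update_of_ne (((hm f).mp hf).1)]

/-- A multigraph without leaves. -/
def Leafless (M : MGraph α) : Prop :=
  ∀ v ∈ M.verts, ∀ u R, u ≠ v → M.edges = {s(v, u)} + R → ∃ e ∈ R, v ∈ e

lemma Models.leafless {G : Graph α β} {M : MGraph α} (hG : Models G M)
    (h : ¬ ∃ H, RetractsLeaf G H) : Leafless M := by
  classical
  obtain ⟨hV, F, ends, h1, h2⟩ := hG
  intro v hv u R hu hM
  by_contra! hR
  apply h
  have : s(v, u) ∈ F.val.map ends := by rw [← h2, hM]; simp
  obtain ⟨e, he, hee⟩ := Multiset.mem_map.mp this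
  have he' : e ∈ F := he
  have hR' : R = (F.erase e).val.map ends := by
    rw [h2, ← Finset.insert_erase he', Finset.insert_val_of_notMem (by simp), Multiset.map_cons,
      hee, Multiset.singleton_add] at hM
    simpa using hM.symm
  refine ⟨_, v, e, ⟨u, hu, (h1 _ _ _).mpr ⟨he, hee⟩⟩, fun f hf => ?_, rfl⟩
  by_contra hne
  obtain ⟨y, hy⟩ := hf
  obtain ⟨hfF, hfy⟩ := (h1 _ _ _).mp hy
  refine hR (ends f) ?_ (by rw [hfy]; simp)
  rw [hR']
  exact Multiset.mem_map_of_mem _ (Finset.mem_erase.mpr ⟨hne, hfF⟩)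

open Classical in
-- Smoothing does not change the valency of the remaining vertices: an edge to `v` is traded for the
-- new edge. If the new edge were the only one at an end, this end would have been a leaf attached
-- to `v`. Hence smoothing after the retraction of all leaves never creates a leaf, and a skeleton
-- is terminal for both kinds of removal.
lemma Leafless.smooth {M : MGraph α} (hM : Leafless M) {v u w : α}
    {R : Multiset (Sym2 α)} (hu : u ≠ v) (hw : w ≠ v)
    (hE : M.edges = {s(v, u), s(v, w)} + R) :
    Leafless ⟨M.verts.erase v, {s(u, w)} + R⟩ := by
  have main : ∀ u w : α, u ≠ v → w ≠ v → u ≠ w → M.edges = {s(v, u), s(v, w)} + R → u ∈ M.verts →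
      ∃ e ∈ R, u ∈ e := by
    intro u w hu hw huw hE hm
    obtain ⟨e, he, hue⟩ := hM u hm v ({s(v, w)} + R) hu.symm (by
      rw [hE, Sym2.eq_swap, Multiset.insert_eq_cons, Multiset.cons_add, Multiset.singleton_add,
        Multiset.singleton_add])
    rcases Multiset.mem_add.mp he with h | h
    · rw [Multiset.mem_singleton.mp h] at hue
      simp [hu, huw] at hue
    · exact ⟨e, h, hue⟩
  intro x hx y R' hy hE'
  simp only [Finset.mem_erase] at hx
  simp only [Multiset.singleton_add] at hE'
  rcases Multiset.cons_eq_cons.mp hE' with ⟨h3, rfl⟩ | ⟨_, C, h4, h5⟩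
  · rcases Sym2.eq_iff.mp h3 with ⟨rfl, rfl⟩ | ⟨rfl, rfl⟩
    · exact main u w hu hw hy.symm hE hx.2
    · exact main w u hw hu hy.symm (by rw [hE, Multiset.pair_comm]) hx.2
  · obtain ⟨e, he, hxe⟩ := hM x hx.2 y ({s(v, u), s(v, w)} + C) hy (by
      rw [hE, h4, ← Multiset.singleton_add]; abel)
    rcases Multiset.mem_add.mp he with h | h
    · refine ⟨s(u, w), by rw [h5]; simp, ?_⟩
      have : e = s(v, u) ∨ e = s(v, w) := by simpa using h
      rcases this with rfl | rfl
      · have : x = u := by simpa [hx.1] using hxe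
        simp [this]
      · have : x = w := by simpa [hx.1] using hxe
        simp [this]
    · exact ⟨e, by rw [h5]; exact Multiset.mem_cons_of_mem h, hxe⟩

lemma Models.terminal {G : Graph α β} {M : MGraph α} (hG : Models G M) (hl : Leafless M)
    (h : ¬ ∃ H, SmoothsVertex G H) : Terminal M := by
  classical
  rintro N ⟨v, hv, A, B, R, hS, hE, hR, -⟩
  cases hS with
  | leaf u hu =>
    obtain ⟨e, he, hve⟩ := hl v hv u R hu hE
    exact hR e he hve
  | pass u w hu hw =>
    apply h
    obtain ⟨hV, F, ends, h1, h2⟩ := hG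
    rw [hE, Multiset.insert_eq_cons, Multiset.cons_add, Multiset.singleton_add] at h2
    obtain ⟨e₁, he₁, d₁, h2⟩ := (Multiset.map_eq_cons _ _ _ _).mpr h2.symm
    obtain ⟨e₂, he₂, d₂, h2⟩ := (Multiset.map_eq_cons _ _ _ _).mpr h2
    have hne : e₁ ≠ e₂ := by
      rintro rfl
      exact (Multiset.Nodup.notMem_erase F.nodup) he₂
    have he₂' : e₂ ∈ F := Multiset.mem_of_mem_erase he₂
    have hl₁ := (h1 e₁ v u).mpr ⟨he₁, d₁⟩
    have hl₂ := (h1 e₂ v w).mpr ⟨he₂', d₂⟩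
    have hlast : ∀ f, G.Inc f v → f = e₁ ∨ f = e₂ := by
      intro f hf
      by_contra! hne'
      obtain ⟨y, hy⟩ := hf
      obtain ⟨hfF, hfy⟩ := (h1 _ _ _).mp hy
      refine hR (ends f) ?_ (by rw [hfy]; simp)
      rw [← h2]
      refine Multiset.mem_map_of_mem _ ?_
      rw [Multiset.mem_erase_of_ne hne'.2, Multiset.mem_erase_of_ne hne'.1]
      exact hfF
    refine ⟨{
      vertexSet := G.vertexSet \ {v}
      IsLink := fun f x y => (f ≠ e₁ ∧ f ≠ e₂ ∧ G.IsLink f x y) ∨ (f = e₁ ∧ s(x, y) = s(u, w))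
      isLink_symm := ?_
      eq_or_eq_of_isLink_of_isLink := ?_
      left_mem_of_isLink := ?_ }, v, u, w, e₁, e₂, hne, hu, hw, hl₁, hl₂, hlast, rfl,
      fun f x y => Iff.rfl⟩
    · rintro f -
      constructor
      rintro x y (⟨n1, n2, h⟩ | ⟨rfl, h⟩)
      · exact Or.inl ⟨n1, n2, h.symm⟩
      · exact Or.inr ⟨rfl, by rw [Sym2.eq_swap, h]⟩
    · rintro f x y a b (⟨n1, n2, h⟩ | ⟨rfl, h⟩) (⟨n1', n2', h'⟩ | ⟨h1', h'⟩)
      · exact G.eq_or_eq_of_isLink_of_isLink h h'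
      · exact absurd h1' n1
      · exact absurd rfl n1'
      · rw [← h', Sym2.eq_iff] at h
        rcases h with h | h
        exacts [Or.inl h.1, Or.inr h.1]
    · rintro f x y (⟨n1, n2, h⟩ | ⟨rfl, h⟩)
      · refine ⟨h.left_mem, ?_⟩
        rintro rfl
        rcases hlast f ⟨y, h⟩ with h | h
        exacts [n1 h, n2 h]
      · rcases Sym2.eq_iff.mp h with ⟨rfl, rfl⟩ | ⟨rfl, rfl⟩
        · exact ⟨hl₁.right_mem, hu⟩
        · exact ⟨hl₂.right_mem, hw⟩

/-- A skeleton of a graph is modelled by a terminal reduction of its multigraph. -/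
lemma IsSkeleton.models {G K : Graph α β} {M : MGraph α} (h : IsSkeleton G K) (hG : Models G M) :
    ∃ N, Relation.ReflTransGen Step M N ∧ Terminal N ∧ Models K N := by
  obtain ⟨H, h1, h2, h3, h4⟩ := h
  have a : ∃ N, Relation.ReflTransGen Step M N ∧ Models H N := by
    clear h2 h3
    induction h1 with
    | refl => exact ⟨M, .refl, hG⟩
    | tail _ h ih =>
      obtain ⟨N, hN, hN'⟩ := ih
      obtain ⟨N', h5, h6⟩ := hN'.retractsLeaf h
      exact ⟨N', hN.tail h5, h6⟩
  obtain ⟨N, hN, hHN⟩ := a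
  have b : ∃ N', Relation.ReflTransGen Step M N' ∧ Leafless N' ∧ Models K N' := by
    clear h4
    induction h3 with
    | refl => exact ⟨N, hN, hHN.leafless h2, hHN⟩
    | tail _ h ih =>
      obtain ⟨N', h5, h6, h7⟩ := ih
      obtain ⟨v, u, w, R, hv, hu, hw, hR, hE, h8⟩ := h7.smoothsVertex h
      exact ⟨_, h5.tail ⟨v, hv, _, _, R, .pass u w hu hw, hE, hR, rfl⟩,
        h6.smooth hu hw hE, h8⟩
  obtain ⟨N', h5, h6, h7⟩ := b
  exact ⟨N', h5, h7.terminal h6 h4, h7⟩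

/-- If the multigraphs of two graphs have a common reduction up to permutations, then the graphs
have isomorphic skeletons. -/
lemma IsSkeleton.graphIsomorphic {G G' K K' : Graph α β} {M M' R R' : MGraph α}
    (h : IsSkeleton G K) (h' : IsSkeleton G' K') (hG : Models G M) (hG' : Models G' M')
    (hR : Relation.ReflTransGen Step M R) (hR' : Relation.ReflTransGen Step M' R')
    (hRR' : ∃ σ : Equiv.Perm α, R.perm σ = R') : GraphIsomorphic K K' := by
  obtain ⟨N, h1, h2, h3⟩ := IsSkeleton.models h hG
  obtain ⟨N', h1', h2', h3'⟩ := IsSkeleton.models h' hG'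
  exact h3.graphIsomorphic h3' (h2.class_eq h2' h1 h1' hR hR' hRR')

end MGraph

end Rewriting


/-! ### Combinatorics of unimodular triangulations -/

/-- The combinatorial properties of a unimodular triangulation `T` of a polygon with lattice points
`L`: the interiors of distinct triangles do not meet other triangles, and every edge with lattice
points beyond it has a triangle on its other side. -/
structure CombTriangulation (L : Set (ℤ × ℤ)) (T : Finset (Finset (ℤ × ℤ))) : Prop where
  vertex_mem : ∀ t ∈ T, ∀ v ∈ t, v ∈ L
  unimodular : ∀ t ∈ T, IsUnimodularTriangle t
  separated : ∀ (p q r p' q' r' : ℤ × ℤ) (a b c a' b' c' : ℝ), {p, q, r} ∈ T → {p', q', r'} ∈ T →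
    0 < a → 0 < b → 0 < c → 0 ≤ a' → 0 ≤ b' → 0 ≤ c' → a + b + c = a' + b' + c' →
    a * p.1 + b * q.1 + c * r.1 = a' * p'.1 + b' * q'.1 + c' * r'.1 →
    a * p.2 + b * q.2 + c * r.2 = a' * p'.2 + b' * q'.2 + c' * r'.2 →
    ({p, q, r} : Finset (ℤ × ℤ)) = {p', q', r'}
  neighbour : ∀ p q r : ℤ × ℤ, {p, q, r} ∈ T → ∀ w ∈ L, latticeDet p q r * latticeDet p q w < 0 →
    ∃ r', {p, q, r'} ∈ T ∧ latticeDet p q r' = - latticeDet p q r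

/-! ### Half-planes and hulls of lattice points -/

section Hull

/-- The determinant of `q - p` and `z - p` for a point `z` of the real plane. -/
def planeDet (p q : ℤ × ℤ) (z : ℝ × ℝ) : ℝ :=
  ((q.1 : ℝ) - p.1) * (z.2 - p.2) - ((q.2 : ℝ) - p.2) * (z.1 - p.1)

lemma planeDet_toPlane (p q r : ℤ × ℤ) : planeDet p q (toPlane r) = latticeDet p q r := by
  simp [planeDet, toPlane, latticeDet]

lemma planeDet_combination (p q : ℤ × ℤ) (x y : ℝ × ℝ) (a b : ℝ) (h : a + b = 1) :
    planeDet p q (a • x + b • y) = a * planeDet p q x + b * planeDet p q y := by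
  obtain rfl : b = 1 - a := by linarith
  simp only [planeDet, Prod.fst_add, Prod.snd_add, Prod.smul_fst, Prod.smul_snd, smul_eq_mul]
  ring

/-- The factor `ε` covers both sides of the line through `p` and `q`, and also the side on which a
given lattice point lies, with its determinant as `ε`. -/
lemma planeDet_nonneg_of_hull {p q : ℤ × ℤ} {S : Set (ℤ × ℤ)} (ε : ℝ)
    (h : ∀ v ∈ S, 0 ≤ ε * latticeDet p q v) {z : ℝ × ℝ} (hz : z ∈ latticeHull S) :
    0 ≤ ε * planeDet p q z := by
  have hc : Convex ℝ {z : ℝ × ℝ | 0 ≤ ε * planeDet p q z} := by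
    intro x hx y hy a b ha hb hab
    simp only [Set.mem_ofPred_eq] at *
    rw [planeDet_combination p q x y a b hab]
    have h1 := mul_nonneg ha hx
    have h2 := mul_nonneg hb hy
    linarith
  refine convexHull_min ?_ hc hz
  rintro _ ⟨v, hv, rfl⟩
  simpa [planeDet_toPlane] using h v hv

lemma planeDet_eq_zero_of_hull {p q : ℤ × ℤ} {S : Set (ℤ × ℤ)}
    (h : ∀ v ∈ S, latticeDet p q v = 0) {z : ℝ × ℝ} (hz : z ∈ latticeHull S) :
    planeDet p q z = 0 := by
  have h1 := planeDet_nonneg_of_hull (p := p) (q := q) 1 (fun v hv => by simp [h v hv]) hz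
  have h2 := planeDet_nonneg_of_hull (p := p) (q := q) (-1) (fun v hv => by simp [h v hv]) hz
  linarith

lemma combination_mem_latticeHull (p q r : ℤ × ℤ) {a b c : ℝ} (ha : 0 ≤ a) (hb : 0 ≤ b)
    (hc : 0 ≤ c) (h : a + b + c = 1) :
    (a * p.1 + b * q.1 + c * r.1, a * p.2 + b * q.2 + c * r.2) ∈
      latticeHull (({p, q, r} : Finset (ℤ × ℤ)) : Set (ℤ × ℤ)) := by
  have hm : ∀ v ∈ ({p, q, r} : Finset (ℤ × ℤ)), toPlane v ∈
      latticeHull (({p, q, r} : Finset (ℤ × ℤ)) : Set (ℤ × ℤ)) := fun v hv =>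
    subset_convexHull ℝ _ ⟨v, hv, rfl⟩
  have := (convex_convexHull ℝ _).sum_mem (t := Finset.univ) (w := ![a, b, c])
    (z := ![toPlane p, toPlane q, toPlane r])
    (s := latticeHull (({p, q, r} : Finset (ℤ × ℤ)) : Set (ℤ × ℤ)))
    (by intro i _; fin_cases i <;> simp [ha, hb, hc]) (by simp [Fin.sum_univ_three, h])
    (by intro i _; fin_cases i <;> exact hm _ (by simp))
  simpa [Fin.sum_univ_three, toPlane] using this

lemma isClosed_latticeHull (t : Finset (ℤ × ℤ)) : IsClosed (latticeHull (t : Set (ℤ × ℤ))) :=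
  (t.finite_toSet.image _).isClosed_convexHull ℝ

end Hull

/-! ### Lattice triangles and the passage from hulls to combinatorics -/

lemma latticeDet_rotate (p q r : ℤ × ℤ) : latticeDet q r p = latticeDet p q r := by
  simp only [latticeDet]; ring

lemma latticeDet_swap (p q r : ℤ × ℤ) : latticeDet p r q = - latticeDet p q r := by
  simp only [latticeDet]; ring

lemma latticeDet_swap' (p q r : ℤ × ℤ) : latticeDet q p r = - latticeDet p q r := by
  simp only [latticeDet]; ring

lemma abs_latticeDet_of_isUnimodularTriangle {p q r : ℤ × ℤ}
    (h : IsUnimodularTriangle {p, q, r}) : |latticeDet p q r| = 1 := by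
  obtain ⟨a, b, c, he, hd⟩ := h
  have ha : a ∈ ({p, q, r} : Finset (ℤ × ℤ)) := by rw [he]; simp
  have hb : b ∈ ({p, q, r} : Finset (ℤ × ℤ)) := by rw [he]; simp
  have hc : c ∈ ({p, q, r} : Finset (ℤ × ℤ)) := by rw [he]; simp
  have hab : a ≠ b := by rintro rfl; simp [latticeDet] at hd
  have hac : a ≠ c := by rintro rfl; simp [latticeDet] at hd
  have hbc : b ≠ c := by
    rintro rfl
    rw [show latticeDet a b b = 0 by simp only [latticeDet]; ring] at hd
    simp at hd
  simp only [Finset.mem_insert, Finset.mem_singleton] at ha hb hc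
  have e1 := latticeDet_rotate p q r
  have e2 := latticeDet_rotate q r p
  have e3 := latticeDet_swap p q r
  have e4 := latticeDet_swap q r p
  have e5 := latticeDet_swap r p q
  rcases ha with rfl | rfl | rfl <;> rcases hb with rfl | rfl | rfl <;>
    rcases hc with rfl | rfl | rfl <;> first | contradiction | skip
  all_goals
    first
      | exact hd
      | (rw [← abs_neg, ← hd]; congr 1; simp only [latticeDet]; ring1)
      | (rw [← hd]; congr 1; simp only [latticeDet]; ring1)

lemma IsUnimodularTriangle.exists_third {t : Finset (ℤ × ℤ)} (h : IsUnimodularTriangle t)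
    {p q : ℤ × ℤ} (hp : p ∈ t) (hq : q ∈ t) (hpq : p ≠ q) : ∃ r, t = {p, q, r} := by
  obtain ⟨a, b, c, rfl, -⟩ := h
  simp only [Finset.mem_insert, Finset.mem_singleton] at hp hq
  rcases hp with rfl | rfl | rfl <;> rcases hq with rfl | rfl | rfl <;>
    first | contradiction | skip
  · exact ⟨_, rfl⟩
  · exact ⟨b, by ext; simp; tauto⟩
  · exact ⟨c, by ext; simp; tauto⟩
  · exact ⟨a, by ext; simp; tauto⟩
  · exact ⟨b, by ext; simp; tauto⟩
  · exact ⟨a, by ext; simp; tauto⟩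

lemma IsUnimodularTriangle.card {t : Finset (ℤ × ℤ)} (h : IsUnimodularTriangle t) :
    t.card = 3 := by
  obtain ⟨a, b, c, rfl, hd⟩ := h
  have hab : a ≠ b := by rintro rfl; simp [latticeDet] at hd
  have hac : a ≠ c := by rintro rfl; simp [latticeDet] at hd
  have hbc : b ≠ c := by
    rintro rfl
    rw [show latticeDet a b b = 0 by simp only [latticeDet]; ring] at hd
    simp at hd
  simp [hab, hac, hbc]

/-- The basic fact is `key2`: if a point of a triangle has positive weight at the vertex `p`, then
every triangle containing the point has `p` as a vertex, because otherwise the common face would lie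
on the line through the other two vertices. Three positive weights give separation.

For a neighbour across `p q`, move from the midpoint of the edge towards `w`. Finitely many closed
triangles cover the path, so one of them contains points arbitrarily close to the midpoint, hence
the midpoint itself, hence `p` and `q`; its third vertex is on the side of `w`. -/
lemma IsUnimodularTriangulation.combTriangulation {P : Set (ℝ × ℝ)} (hP : Convex ℝ P)
    {T : Finset (Finset (ℤ × ℤ))} (h : IsUnimodularTriangulation P T) :
    CombTriangulation (latticePoints P) T := by
  have hsub : ∀ t ∈ T, latticeHull (t : Set (ℤ × ℤ)) ⊆ P := fun t ht => by
    rw [← h.cover]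
    exact Set.subset_biUnion_of_mem (u := fun t : Finset (ℤ × ℤ) => latticeHull (t : Set (ℤ × ℤ)))
      ht
  -- a point of the hull of `{p, q, r}` and of another triangle that does not contain `p` lies on
  -- the line through `q` and `r`
  have key : ∀ (p q r : ℤ × ℤ) (t : Finset (ℤ × ℤ)) (z : ℝ × ℝ), {p, q, r} ∈ T → t ∈ T → p ∉ t →
      z ∈ latticeHull (({p, q, r} : Finset (ℤ × ℤ)) : Set (ℤ × ℤ)) →
      z ∈ latticeHull (t : Set (ℤ × ℤ)) → planeDet q r z = 0 := by
    intro p q r t z hT ht hp hz hz'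
    have := Set.mem_inter hz hz'
    rw [h.face_to_face _ hT _ ht] at this
    refine planeDet_eq_zero_of_hull (fun v hv => ?_) this
    obtain ⟨hv, hvt⟩ := hv
    simp only [Finset.coe_insert, Finset.coe_singleton, Set.mem_insert_iff,
      Set.mem_singleton_iff] at hv
    rcases hv with rfl | rfl | rfl
    · exact absurd hvt hp
    · simp [latticeDet]
    · simp only [latticeDet]; ring
  have key2 : ∀ (p q r : ℤ × ℤ) (t : Finset (ℤ × ℤ)) (a b c : ℝ), {p, q, r} ∈ T → t ∈ T →
      0 < a → 0 ≤ b → 0 ≤ c → a + b + c = 1 →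
      (a * p.1 + b * q.1 + c * r.1, a * p.2 + b * q.2 + c * r.2) ∈ latticeHull (t : Set (ℤ × ℤ)) →
      p ∈ t := by
    intro p q r t a b c hT ht ha hb hc habc hz
    by_contra hp
    have h0 := key p q r t _ hT ht hp (combination_mem_latticeHull p q r ha.le hb hc habc) hz
    have h1 : planeDet q r (a * p.1 + b * q.1 + c * r.1, a * p.2 + b * q.2 + c * r.2) =
        a * latticeDet p q r := by
      obtain rfl : c = 1 - a - b := by linarith
      simp only [planeDet, latticeDet]
      push_cast
      ring
    have h2 := abs_latticeDet_of_isUnimodularTriangle (h.unimodular _ hT)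
    have h3 : (latticeDet p q r : ℝ) ≠ 0 := by
      intro h3
      have : latticeDet p q r = 0 := by exact_mod_cast h3
      simp [this] at h2
    rw [h1] at h0
    exact (mul_ne_zero ha.ne' h3) h0
  refine ⟨fun t ht v hv => hsub t ht (subset_convexHull ℝ _ ⟨v, hv, rfl⟩), h.unimodular, ?_, ?_⟩
  · intro p q r p' q' r' a b c a' b' c' hT hT' ha hb hc ha' hb' hc' hs h1 h2
    have hs0 : 0 < a + b + c := by positivity
    set s := a + b + c with hsdef
    have hz : (a / s * p.1 + b / s * q.1 + c / s * r.1, a / s * p.2 + b / s * q.2 + c / s * r.2) ∈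
        latticeHull (({p', q', r'} : Finset (ℤ × ℤ)) : Set (ℤ × ℤ)) := by
      have := combination_mem_latticeHull p' q' r' (a := a' / s) (b := b' / s) (c := c' / s)
        (by positivity) (by positivity) (by positivity) (by rw [hs]; field_simp; rw [← hs]; field_simp)
      convert this using 2
      · field_simp; linarith
      · field_simp; linarith
    have hsum : a / s + b / s + c / s = 1 := by field_simp; rw [hsdef]
    have hsubset : ({p, q, r} : Finset (ℤ × ℤ)) ⊆ {p', q', r'} := by
      have e1 := key2 p q r _ (a / s) (b / s) (c / s) hT hT' (by positivity) (by positivity)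
        (by positivity) hsum hz
      have e2 := key2 q r p _ (b / s) (c / s) (a / s)
        (by rwa [show ({q, r, p} : Finset (ℤ × ℤ)) = {p, q, r} by ext; simp; tauto]) hT'
        (by positivity) (by positivity) (by positivity) (by linarith)
        (by convert hz using 2 <;> ring)
      have e3 := key2 r p q _ (c / s) (a / s) (b / s)
        (by rwa [show ({r, p, q} : Finset (ℤ × ℤ)) = {p, q, r} by ext; simp; tauto]) hT'
        (by positivity) (by positivity) (by positivity) (by linarith)
        (by convert hz using 2 <;> ring)
      intro x hx
      simp only [Finset.mem_insert, Finset.mem_singleton] at hx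
      rcases hx with rfl | rfl | rfl <;> assumption
    exact Finset.eq_of_subset_of_card_le hsubset
      (by rw [(h.unimodular _ hT).card, (h.unimodular _ hT').card])
  · intro p q r hT w hw hneg
    have hd := abs_latticeDet_of_isUnimodularTriangle (h.unimodular _ hT)
    have hpq : p ≠ q := by rintro rfl; simp [latticeDet] at hd
    set m : ℝ × ℝ := ((1 / 2 : ℝ) * p.1 + (1 / 2 : ℝ) * q.1 + 0 * r.1,
      (1 / 2 : ℝ) * p.2 + (1 / 2 : ℝ) * q.2 + 0 * r.2) with hm
    have hmT : m ∈ latticeHull (({p, q, r} : Finset (ℤ × ℤ)) : Set (ℤ × ℤ)) :=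
      combination_mem_latticeHull p q r (by norm_num) (by norm_num) le_rfl (by norm_num)
    have hmP : m ∈ P := hsub _ hT hmT
    have hwP : toPlane w ∈ P := hw
    set γ : ℝ → ℝ × ℝ := fun ε => (1 - ε) • m + ε • toPlane w with hγ
    have hγP : ∀ᶠ ε in nhdsWithin (0 : ℝ) (Set.Ioi 0), γ ε ∈ P ∧ 0 < ε := by
      have : Set.Ioo (0 : ℝ) 1 ∈ nhdsWithin (0 : ℝ) (Set.Ioi 0) := Ioo_mem_nhdsGT one_pos
      filter_upwards [this] with ε hε
      exact ⟨hP hmP hwP (by linarith [hε.2]) hε.1.le (by ring), hε.1⟩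
    have hγc : Filter.Tendsto γ (nhdsWithin (0 : ℝ) (Set.Ioi 0)) (nhds m) := by
      have : Continuous γ := by fun_prop
      have h0 : γ 0 = m := by simp [hγ]
      rw [← h0]
      exact this.continuousAt.tendsto.mono_left nhdsWithin_le_nhds
    obtain ⟨t, ht, hfreq⟩ : ∃ t ∈ T, ∃ᶠ ε in nhdsWithin (0 : ℝ) (Set.Ioi 0),
        γ ε ∈ latticeHull (t : Set (ℤ × ℤ)) := by
      by_contra! hno
      have : ∀ᶠ ε in nhdsWithin (0 : ℝ) (Set.Ioi 0),
          ∀ t ∈ T, γ ε ∉ latticeHull (t : Set (ℤ × ℤ)) := by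
        rw [Filter.eventually_all_finset]
        intro t ht
        exact hno t ht
      obtain ⟨ε, h1, h2⟩ := (this.and hγP).exists
      have h3 := h2.1
      rw [← h.cover] at h3
      obtain ⟨t, ht, h4⟩ := Set.mem_iUnion₂.mp h3
      exact h1 t ht h4
    have hmt : m ∈ latticeHull (t : Set (ℤ × ℤ)) :=
      (isClosed_latticeHull t).mem_of_frequently_of_tendsto hfreq hγc
    obtain ⟨ε, hε, hεP⟩ := (hfreq.and_eventually hγP).exists
    have hpt : p ∈ t := key2 p q r t (1 / 2) (1 / 2) 0 hT ht (by norm_num) (by norm_num) le_rfl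
      (by norm_num) hmt
    have hqt : q ∈ t := key2 q p r t (1 / 2) (1 / 2) 0
      (by rwa [show ({q, p, r} : Finset (ℤ × ℤ)) = {p, q, r} by ext; simp; tauto]) ht (by norm_num)
      (by norm_num) le_rfl (by norm_num) (by convert hmt using 2 <;> ring)
    obtain ⟨r', rfl⟩ := (h.unimodular t ht).exists_third hpt hqt hpq
    refine ⟨r', ht, ?_⟩
    have hd' := abs_latticeDet_of_isUnimodularTriangle (h.unimodular _ ht)
    have hval : planeDet p q (γ ε) = ε * latticeDet p q w := by
      rw [hγ, planeDet_combination _ _ _ _ _ _ (by ring), planeDet_toPlane]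
      have : planeDet p q m = 0 := by simp only [planeDet, hm]; ring
      rw [this]; ring
    have hside : 0 < (latticeDet p q r' : ℝ) * latticeDet p q w := by
      by_contra hle
      push Not at hle
      have hw0 : latticeDet p q w ≠ 0 := by rintro h0; simp [h0] at hneg
      have hw0' : (latticeDet p q w : ℝ) ≠ 0 := by exact_mod_cast hw0
      have := planeDet_nonneg_of_hull (p := p) (q := q) (-(latticeDet p q w : ℝ)) (fun v hv => by
        simp only [Finset.coe_insert, Finset.coe_singleton, Set.mem_insert_iff,
          Set.mem_singleton_iff] at hv
        rcases hv with rfl | rfl | rfl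
        · simp [latticeDet]
        · rw [show latticeDet p v v = 0 by simp only [latticeDet]; ring]; simp
        · linarith) hε
      rw [hval] at this
      have h5 : 0 < ε * ((latticeDet p q w : ℝ) * latticeDet p q w) :=
        mul_pos hεP.2 (mul_self_pos.mpr hw0')
      linarith
    have hside' : 0 < latticeDet p q r' * latticeDet p q w := by exact_mod_cast hside
    rcases abs_eq (zero_le_one' ℤ) |>.mp hd with h1 | h1 <;>
      rcases abs_eq (zero_le_one' ℤ) |>.mp hd' with h2 | h2 <;> rw [h1] at hneg <;>
      rw [h2] at hside' <;> rw [h1, h2] <;> linarith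

/-! ### Affine unimodular maps -/

/-- An affine bijection of the lattice with determinant `1` or `-1`. -/
structure IsLatticeIso (φ : Equiv.Perm (ℤ × ℤ)) (ε : ℤ) : Prop where
  exists_coeff : ∃ a b c d e f : ℤ, a * d - b * c = ε ∧
    ∀ p, φ p = (a * p.1 + b * p.2 + e, c * p.1 + d * p.2 + f)
  unit : ε = 1 ∨ ε = -1

lemma IsLatticeIso.latticeDet {φ : Equiv.Perm (ℤ × ℤ)} {ε : ℤ} (h : IsLatticeIso φ ε)
    (p q r : ℤ × ℤ) : latticeDet (φ p) (φ q) (φ r) = ε * latticeDet p q r := by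
  obtain ⟨a, b, c, d, e, f, rfl, hφ⟩ := h.exists_coeff
  simp only [_root_.latticeDet, hφ]
  ring

/-- The image of a triangulation under a bijection of the lattice. -/
def mapTriangulation (φ : Equiv.Perm (ℤ × ℤ)) (T : Finset (Finset (ℤ × ℤ))) :
    Finset (Finset (ℤ × ℤ)) := T.map (φ.finsetCongr).toEmbedding

lemma mem_mapTriangulation {φ : Equiv.Perm (ℤ × ℤ)} {T : Finset (Finset (ℤ × ℤ))}
    {t : Finset (ℤ × ℤ)} :
    t.map φ.toEmbedding ∈ mapTriangulation φ T ↔ t ∈ T := by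
  unfold mapTriangulation
  rw [← Equiv.finsetCongr_apply]
  exact Finset.mem_map' _

lemma map_triple (φ : Equiv.Perm (ℤ × ℤ)) (p q r : ℤ × ℤ) :
    ({p, q, r} : Finset (ℤ × ℤ)).map φ.toEmbedding = {φ p, φ q, φ r} := by
  simp [Finset.map_insert]

lemma triple_mem_mapTriangulation {φ : Equiv.Perm (ℤ × ℤ)} {T : Finset (Finset (ℤ × ℤ))}
    {p q r : ℤ × ℤ} : {φ p, φ q, φ r} ∈ mapTriangulation φ T ↔ {p, q, r} ∈ T := by
  rw [← map_triple, mem_mapTriangulation]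

lemma CombTriangulation.map {L : Set (ℤ × ℤ)} {T : Finset (Finset (ℤ × ℤ))}
    (h : CombTriangulation L T) {φ : Equiv.Perm (ℤ × ℤ)} {ε : ℤ} (hφ : IsLatticeIso φ ε) :
    CombTriangulation (φ '' L) (mapTriangulation φ T) := by
  have hε : ε * ε = 1 := by rcases hφ.unit with rfl | rfl <;> norm_num
  refine ⟨?_, ?_, ?_, ?_⟩
  · intro t ht v hv
    obtain ⟨t, ht', rfl⟩ := Finset.mem_map.mp ht
    obtain ⟨v, hv', rfl⟩ := Finset.mem_map.mp hv
    exact ⟨v, h.vertex_mem t ht' v hv', rfl⟩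
  · intro t ht
    obtain ⟨t, ht', rfl⟩ := Finset.mem_map.mp ht
    obtain ⟨p, q, r, rfl, hd⟩ := h.unimodular t ht'
    refine ⟨φ p, φ q, φ r, map_triple φ p q r, ?_⟩
    rw [hφ.latticeDet, abs_mul, hd]
    rcases hφ.unit with rfl | rfl <;> norm_num
  · intro p q r p' q' r' a b c a' b' c' hT hT' ha hb hc ha' hb' hc' hs h1 h2
    obtain ⟨p, rfl⟩ := φ.surjective p
    obtain ⟨q, rfl⟩ := φ.surjective q
    obtain ⟨r, rfl⟩ := φ.surjective r
    obtain ⟨p', rfl⟩ := φ.surjective p'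
    obtain ⟨q', rfl⟩ := φ.surjective q'
    obtain ⟨r', rfl⟩ := φ.surjective r'
    rw [triple_mem_mapTriangulation] at hT hT'
    rw [← map_triple, ← map_triple]
    congr 1
    obtain ⟨x, y, z, w, e, f, hxy, hφ'⟩ := hφ.exists_coeff
    simp only [hφ'] at h1 h2
    push_cast at h1 h2
    have hxy' : (x : ℝ) * w - y * z ≠ 0 := by
      have : x * w - y * z ≠ 0 := by rcases hφ.unit with h | h <;> rw [hxy, h] <;> norm_num
      exact_mod_cast this
    -- The linear part is inverted by Cramer's rule; the translation cancels because the two systems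
    -- of weights have the same sum.
    refine h.separated p q r p' q' r' a b c a' b' c' hT hT' ha hb hc ha' hb' hc' hs ?_ ?_ <;>
    · apply mul_left_cancel₀ hxy'
      first
        | linear_combination (w : ℝ) * h1 - (y : ℝ) * h2 - (w * e - y * f : ℝ) * hs
        | linear_combination (x : ℝ) * h2 - (z : ℝ) * h1 - (x * f - z * e : ℝ) * hs
  · intro p q r hT w hw hneg
    obtain ⟨p, rfl⟩ := φ.surjective p
    obtain ⟨q, rfl⟩ := φ.surjective q
    obtain ⟨r, rfl⟩ := φ.surjective r
    obtain ⟨w, hw, rfl⟩ := hw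
    rw [triple_mem_mapTriangulation] at hT
    rw [hφ.latticeDet, hφ.latticeDet] at hneg
    obtain ⟨r', h1, h2⟩ := h.neighbour p q r hT w hw (by
      calc _ = ε * ε * (_root_.latticeDet p q r * _root_.latticeDet p q w) := by rw [hε, one_mul]
        _ < 0 := by linarith)
    exact ⟨φ r', triple_mem_mapTriangulation.mpr h1, by rw [hφ.latticeDet, hφ.latticeDet, h2]; ring⟩


/-! ### The triangles along a horizontal line -/

lemma CombTriangulation.abs_det {L : Set (ℤ × ℤ)} {T : Finset (Finset (ℤ × ℤ))}
    (hT : CombTriangulation L T) {p q r : ℤ × ℤ} (h : {p, q, r} ∈ T) :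
    latticeDet p q r = 1 ∨ latticeDet p q r = -1 :=
  abs_eq (zero_le_one' ℤ) |>.mp (abs_latticeDet_of_isUnimodularTriangle (hT.unimodular _ h))

lemma triple_rotate {α : Type*} [DecidableEq α] (p q r : α) :
    ({p, q, r} : Finset α) = {q, r, p} := by ext; simp; tauto

lemma triple_swap {α : Type*} [DecidableEq α] (p q r : α) :
    ({p, q, r} : Finset α) = {p, r, q} := by ext; simp; tauto

lemma triple_swap' {α : Type*} [DecidableEq α] (p q r : α) :
    ({p, q, r} : Finset α) = {q, p, r} := by ext; simp; tauto

lemma triple_swap'' {α : Type*} [DecidableEq α] (p q r : α) :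
    ({p, q, r} : Finset α) = {r, q, p} := by ext; simp; tauto

/-- Equal determinants mean that `r'` is `r` translated by an integer multiple `k` of `q - p`. For k
≥ 0 the point p + (1 + k) q + r equals (1 + k) p + q + r', so the two triangles overlap in an
interior point; k ≤ 0 is symmetric. -/
lemma CombTriangulation.unique_third {L : Set (ℤ × ℤ)} {T : Finset (Finset (ℤ × ℤ))}
    (hT : CombTriangulation L T) {p q r r' : ℤ × ℤ} (h : {p, q, r} ∈ T) (h' : {p, q, r'} ∈ T)
    (hd : latticeDet p q r = latticeDet p q r') : r = r' := by
  have hD := hT.abs_det h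
  obtain ⟨k, h1, h2⟩ : ∃ k : ℤ, r'.1 = r.1 + k * (q.1 - p.1) ∧ r'.2 = r.2 + k * (q.2 - p.2) := by
    have hDD : latticeDet p q r * latticeDet p q r = 1 := by
      rcases hD with h | h <;> rw [h] <;> norm_num
    refine ⟨latticeDet p q r * latticeDet p r' r, ?_, ?_⟩
    · have : latticeDet p q r * (r'.1 - p.1) =
          (q.1 - p.1) * latticeDet p r' r + (r.1 - p.1) * latticeDet p q r' := by
        simp only [latticeDet]; ring
      rw [← hd] at this
      linear_combination latticeDet p q r * this + (r.1 - p.1 - (r'.1 - p.1)) * hDD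
    · have : latticeDet p q r * (r'.2 - p.2) =
          (q.2 - p.2) * latticeDet p r' r + (r.2 - p.2) * latticeDet p q r' := by
        simp only [latticeDet]; ring
      rw [← hd] at this
      linear_combination latticeDet p q r * this + (r.2 - p.2 - (r'.2 - p.2)) * hDD
  have h1' : (r'.1 : ℝ) = r.1 + k * (q.1 - p.1) := by exact_mod_cast h1
  have h2' : (r'.2 : ℝ) = r.2 + k * (q.2 - p.2) := by exact_mod_cast h2
  have heq : ({p, q, r} : Finset (ℤ × ℤ)) = {p, q, r'} := by
    rcases le_total 0 k with hk | hk
    · have hk' : (0 : ℝ) ≤ k := by exact_mod_cast hk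
      refine hT.separated p q r p q r' 1 (1 + k) 1 (1 + k) 1 1 h h' ?_ ?_ ?_ ?_ ?_ ?_ ?_ ?_ ?_ <;>
        first | positivity | (rw [h1']; ring) | (rw [h2']; ring) | ring
    · have hk' : (0 : ℝ) ≤ -k := by have : (k : ℝ) ≤ 0 := by exact_mod_cast hk
                                    linarith
      have hk'' : (0 : ℝ) < 1 - k := by linarith
      refine hT.separated p q r p q r' (1 - k) 1 1 1 (1 - k) 1 h h' hk'' one_pos one_pos
        zero_le_one hk''.le zero_le_one ?_ ?_ ?_ <;>
        first | (rw [h1']; ring1) | (rw [h2']; ring1) | ring1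
  have hr : r ∈ ({p, q, r'} : Finset (ℤ × ℤ)) := by rw [← heq]; simp
  simp only [Finset.mem_insert, Finset.mem_singleton] at hr
  rcases hr with rfl | rfl | rfl
  · simp [latticeDet] at hD
  · rw [show latticeDet p r r = 0 by simp only [latticeDet]; ring] at hD
    simp at hD
  · rfl

/-- Around a vertex `p`, at most one triangle meets both the open upper half-plane and the left
(or right) part of the horizontal line through `p`. -/
lemma CombTriangulation.unique_beside {L : Set (ℤ × ℤ)} {T : Finset (Finset (ℤ × ℤ))}
    (hT : CombTriangulation L T) {p l u l' u' : ℤ × ℤ} (h : {p, l, u} ∈ T) (h' : {p, l', u'} ∈ T)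
    (hd : latticeDet p l u = latticeDet p l' u') (hl : l.2 ≤ p.2) (hu : p.2 < u.2)
    (hl' : l'.2 ≤ p.2) (hu' : p.2 < u'.2) : l = l' ∧ u = u' := by
  have hD := hT.abs_det h
  have finish : ({p, l, u} : Finset (ℤ × ℤ)) = {p, l', u'} → l = l' ∧ u = u' := by
    intro he
    have h1 : u ∈ ({p, l', u'} : Finset (ℤ × ℤ)) := by rw [← he]; simp
    have h2 : l ∈ ({p, l', u'} : Finset (ℤ × ℤ)) := by rw [← he]; simp
    simp only [Finset.mem_insert, Finset.mem_singleton] at h1 h2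
    have hpl : l ≠ p := by rintro rfl; simp [latticeDet] at hD
    refine ⟨?_, ?_⟩
    · rcases h2 with rfl | h2 | rfl
      · exact absurd rfl hpl
      · exact h2
      · omega
    · rcases h1 with rfl | rfl | h1
      · omega
      · omega
      · exact h1
  have hsep : ∀ l u l' u' : ℤ × ℤ, {p, l, u} ∈ T → {p, l', u'} ∈ T →
      latticeDet p l u = latticeDet p l' u' → l.2 < p.2 → p.2 < u.2 → l'.2 ≤ p.2 → p.2 < u'.2 →
      ({p, l, u} : Finset (ℤ × ℤ)) = {p, l', u'} := by
    intro l u l' u' h h' hd hl hu hl' hu'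
    have c1 : (0 : ℝ) < (u.2 : ℝ) - p.2 := by have : (p.2 : ℝ) < u.2 := by exact_mod_cast hu
                                              linarith
    have c2 : (0 : ℝ) < (p.2 : ℝ) - l.2 := by have : (l.2 : ℝ) < p.2 := by exact_mod_cast hl
                                              linarith
    have c3 : (0 : ℝ) < (u'.2 : ℝ) - p.2 := by have : (p.2 : ℝ) < u'.2 := by exact_mod_cast hu'
                                               linarith
    have c4 : (0 : ℝ) ≤ (p.2 : ℝ) - l'.2 := by have : (l'.2 : ℝ) ≤ p.2 := by exact_mod_cast hl'
                                               linarith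
    have hd' : (latticeDet p l u : ℝ) = latticeDet p l' u' := by exact_mod_cast hd
    simp only [latticeDet] at hd'
    push_cast at hd'
    -- The weights of `l` and `u` balance their heights relative to `p`, so the combination lies in
    -- the row of `p`, displaced from `p` by exactly the determinant. The two determinants agree,
    -- hence so do the two points; the weights of `p` only equalise the sums.
    refine hT.separated p l u p l' u' (1 + (u'.2 - p.2) + (p.2 - l'.2)) (u.2 - p.2) (p.2 - l.2)
      (1 + (u.2 - p.2) + (p.2 - l.2)) (u'.2 - p.2) (p.2 - l'.2) h h' (by positivity) c1 c2
      (by positivity) c3.le c4 (by ring) ?_ ?_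
    · linear_combination hd'
    · ring
  rcases hl.lt_or_eq with h1 | h1
  · exact finish (hsep l u l' u' h h' hd h1 hu hl' hu')
  rcases hl'.lt_or_eq with h2 | h2
  · exact finish (hsep l' u' l u h' h hd.symm h2 hu' hl hu).symm
  -- For `l` in the row of `p` the determinant is a product, so `u` lies one row above `p`, and `l`
  -- is the neighbour of `p` on the side given by the sign.
  have hB : ∀ l u : ℤ × ℤ, latticeDet p l u = 1 ∨ latticeDet p l u = -1 → l.2 = p.2 → p.2 < u.2 →
      l.1 - p.1 = latticeDet p l u := by
    intro l u hD hl hu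
    have e : latticeDet p l u = (l.1 - p.1) * (u.2 - p.2) := by
      simp only [latticeDet, hl]; ring
    have hun : IsUnit (u.2 - p.2) := by
      refine isUnit_of_dvd_unit (y := latticeDet p l u) ⟨l.1 - p.1, by rw [e]; ring⟩ ?_
      rcases hD with h | h <;> rw [h] <;> simp
    have : u.2 - p.2 = 1 := by
      rcases Int.isUnit_iff.mp hun with h | h <;> omega
    rw [e, this, mul_one]
  have e1 := hB l u hD h1 hu
  have e2 := hB l' u' (hd ▸ hD) h2 hu'
  have hll : l = l' := Prod.ext (by omega) (by omega)
  subst hll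
  exact ⟨rfl, hT.unique_third h h' hd⟩

/-- A step along the line `y = 3 / 2`: a triangle of `T` that crosses this line, given by its left
and its right edge that cross the line, each of them by its lower and its upper end. -/
inductive IsStep (T : Finset (Finset (ℤ × ℤ))) :
    ((ℤ × ℤ) × (ℤ × ℤ)) × ((ℤ × ℤ) × (ℤ × ℤ)) → Prop
  | lower (l u l' : ℤ × ℤ) : l.2 ≤ 1 → 2 ≤ u.2 → l'.2 ≤ 1 → {l, u, l'} ∈ T →
      latticeDet l u l' = -1 → IsStep T ((l, u), (l', u))
  | upper (l u u' : ℤ × ℤ) : l.2 ≤ 1 → 2 ≤ u.2 → 2 ≤ u'.2 → {l, u, u'} ∈ T →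
      latticeDet l u u' = -1 → IsStep T ((l, u), (l, u'))

/-- The triangle of a step. -/
def stepTriangle (s : ((ℤ × ℤ) × (ℤ × ℤ)) × ((ℤ × ℤ) × (ℤ × ℤ))) : Finset (ℤ × ℤ) :=
  {s.1.1, s.1.2, s.2.1, s.2.2}

lemma stepTriangle_lower (l u l' : ℤ × ℤ) : stepTriangle ((l, u), (l', u)) = {l, u, l'} := by
  ext; simp [stepTriangle]; tauto

lemma stepTriangle_upper (l u u' : ℤ × ℤ) : stepTriangle ((l, u), (l, u')) = {l, u, u'} := by
  ext; simp [stepTriangle]; tauto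

section Steps

variable {L : Set (ℤ × ℤ)} {T : Finset (Finset (ℤ × ℤ))}
  {s s' : ((ℤ × ℤ) × (ℤ × ℤ)) × ((ℤ × ℤ) × (ℤ × ℤ))}

lemma IsStep.stepTriangle_mem (h : IsStep T s) : stepTriangle s ∈ T := by
  cases h with
  | lower l u l' h1 h2 h3 h4 h5 => rwa [stepTriangle_lower]
  | upper l u u' h1 h2 h3 h4 h5 => rwa [stepTriangle_upper]

lemma IsStep.rows (h : IsStep T s) :
    s.1.1.2 ≤ 1 ∧ 2 ≤ s.1.2.2 ∧ s.2.1.2 ≤ 1 ∧ 2 ≤ s.2.2.2 := by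
  cases h <;> simp [*]

/-- A positive determinant puts `c` to the left of the upward edge from `l` to `u`, so this edge is
the right edge of the triangle. -/
lemma exists_step_left {l u c : ℤ × ℤ} (hl : l.2 ≤ 1) (hu : 2 ≤ u.2) (h : {l, u, c} ∈ T)
    (hd : latticeDet l u c = 1) : ∃ s, IsStep T s ∧ s.2 = (l, u) ∧ stepTriangle s = {l, u, c} := by
  rcases le_or_gt c.2 1 with hc | hc
  · refine ⟨((c, u), (l, u)), .lower c u l hc hu hl (by rwa [triple_swap'']) ?_, rfl, ?_⟩
    · rw [← hd]; simp only [latticeDet]; ring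
    · rw [stepTriangle_lower, triple_swap'']
  · refine ⟨((l, c), (l, u)), .upper l c u hl hc hu (by rwa [triple_swap]) ?_, rfl, ?_⟩
    · rw [← hd]; simp only [latticeDet]; ring
    · rw [stepTriangle_upper, triple_swap]

lemma exists_step_right {l u c : ℤ × ℤ} (hl : l.2 ≤ 1) (hu : 2 ≤ u.2) (h : {l, u, c} ∈ T)
    (hd : latticeDet l u c = -1) :
    ∃ s, IsStep T s ∧ s.1 = (l, u) ∧ stepTriangle s = {l, u, c} := by
  rcases le_or_gt c.2 1 with hc | hc
  · exact ⟨((l, u), (c, u)), .lower l u c hl hu hc h hd, rfl, stepTriangle_lower _ _ _⟩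
  · exact ⟨((l, u), (l, c)), .upper l u c hl hu hc h hd, rfl, stepTriangle_upper _ _ _⟩

lemma CombTriangulation.exists_next (hT : CombTriangulation L T) (h : IsStep T s) {w : ℤ × ℤ}
    (hw : w ∈ L) (hd : latticeDet s.2.1 s.2.2 w < 0) : ∃ s', IsStep T s' ∧ s'.1 = s.2 := by
  cases h with
  | lower l u l' h1 h2 h3 h4 h5 =>
    have h6 : latticeDet l' u l = 1 := by rw [← neg_neg (1 : ℤ), ← h5]; simp only [latticeDet]; ring
    rw [triple_swap''] at h4
    obtain ⟨r, h7, h8⟩ := hT.neighbour l' u l h4 w hw (by rw [h6]; simpa using hd)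
    obtain ⟨s', h9, h10, -⟩ := exists_step_right h3 h2 h7 (by rw [h8, h6])
    exact ⟨s', h9, h10⟩
  | upper l u u' h1 h2 h3 h4 h5 =>
    have h6 : latticeDet l u' u = 1 := by rw [← neg_neg (1 : ℤ), ← h5]; simp only [latticeDet]; ring
    rw [triple_swap] at h4
    obtain ⟨r, h7, h8⟩ := hT.neighbour l u' u h4 w hw (by rw [h6]; simpa using hd)
    obtain ⟨s', h9, h10, -⟩ := exists_step_right h1 h3 h7 (by rw [h8, h6])
    exact ⟨s', h9, h10⟩

lemma CombTriangulation.exists_prev (hT : CombTriangulation L T) (h : IsStep T s) {w : ℤ × ℤ}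
    (hw : w ∈ L) (hd : 0 < latticeDet s.1.1 s.1.2 w) : ∃ s', IsStep T s' ∧ s'.2 = s.1 := by
  have aux : ∀ l u c : ℤ × ℤ, l.2 ≤ 1 → 2 ≤ u.2 → {l, u, c} ∈ T → latticeDet l u c = -1 →
      0 < latticeDet l u w → ∃ s', IsStep T s' ∧ s'.2 = (l, u) := by
    intro l u c h1 h2 h3 h4 h5
    obtain ⟨r, h7, h8⟩ := hT.neighbour l u c h3 w hw (by rw [h4]; linarith)
    obtain ⟨s', h9, h10, -⟩ := exists_step_left h1 h2 h7 (by rw [h8, h4]; norm_num)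
    exact ⟨s', h9, h10⟩
  cases h with
  | lower l u l' h1 h2 h3 h4 h5 => exact aux l u l' h1 h2 h4 h5 hd
  | upper l u u' h1 h2 h3 h4 h5 => exact aux l u u' h1 h2 h4 h5 hd

/-- Exactly one side of the line contains two vertices of the triangle, which tells the end that
moves; the sign of the determinant tells in which direction. -/
lemma IsStep.ext (h : IsStep T s) (h' : IsStep T s') (he : stepTriangle s = stepTriangle s') :
    s = s' := by
  have sub : ∀ x ∈ stepTriangle s, x ∈ stepTriangle s' := fun x hx => he ▸ hx
  have sub' : ∀ x ∈ stepTriangle s', x ∈ stepTriangle s := fun x hx => he ▸ hx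
  have e0 : ∀ x y : ℤ × ℤ, latticeDet x y y = 0 := by intro x y; simp only [latticeDet]; ring
  have e1 : ∀ x y : ℤ × ℤ, latticeDet x y x = 0 := by intro x y; simp only [latticeDet]; ring
  cases h with
  | lower l u l' h1 h2 h3 h4 h5 =>
    cases h' with
    | lower m v m' g1 g2 g3 g4 g5 =>
      rw [stepTriangle_lower, stepTriangle_lower] at *
      simp only [Finset.mem_insert, Finset.mem_singleton, forall_eq_or_imp, forall_eq] at sub sub'
      have huv : u = v := by
        rcases sub.2.1 with rfl | h | rfl
        · omega
        · exact h
        · omega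
      subst huv
      have a : l = m ∨ l = m' := by rcases sub.1 with h | rfl | h <;> [simp [h]; omega; simp [h]]
      have b : l' = m ∨ l' = m' := by
        rcases sub.2.2 with h | rfl | h <;> [simp [h]; omega; simp [h]]
      rcases a with rfl | rfl <;> rcases b with rfl | rfl
      · rw [e1] at h5; omega
      · rfl
      · have := latticeDet_rotate l u l'
        have h6 : latticeDet l u l' = - latticeDet l' u l := by simp only [latticeDet]; ring
        omega
      · rw [e1] at h5; omega
    | upper m v v' g1 g2 g3 g4 g5 =>
      rw [stepTriangle_lower, stepTriangle_upper] at *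
      simp only [Finset.mem_insert, Finset.mem_singleton, forall_eq_or_imp, forall_eq] at sub sub'
      have a : v = u := by
        rcases sub'.2.1 with rfl | h | rfl
        · omega
        · exact h
        · omega
      have b : v' = u := by
        rcases sub'.2.2 with rfl | h | rfl
        · omega
        · exact h
        · omega
      rw [a, b, e0] at g5
      omega
  | upper l u u' h1 h2 h3 h4 h5 =>
    cases h' with
    | lower m v m' g1 g2 g3 g4 g5 =>
      rw [stepTriangle_lower, stepTriangle_upper] at *
      simp only [Finset.mem_insert, Finset.mem_singleton, forall_eq_or_imp, forall_eq] at sub sub'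
      have a : u = v := by
        rcases sub.2.1 with rfl | h | rfl
        · omega
        · exact h
        · omega
      have b : u' = v := by
        rcases sub.2.2 with rfl | h | rfl
        · omega
        · exact h
        · omega
      rw [a, b, e0] at h5
      omega
    | upper m v v' g1 g2 g3 g4 g5 =>
      rw [stepTriangle_upper, stepTriangle_upper] at *
      simp only [Finset.mem_insert, Finset.mem_singleton, forall_eq_or_imp, forall_eq] at sub sub'
      have hlm : l = m := by
        rcases sub.1 with h | rfl | rfl
        · exact h
        · omega
        · omega
      subst hlm
      have a : u = v ∨ u = v' := by
        rcases sub.2.1 with rfl | h | h <;> [omega; simp [h]; simp [h]]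
      have b : u' = v ∨ u' = v' := by
        rcases sub.2.2 with rfl | h | h <;> [omega; simp [h]; simp [h]]
      rcases a with rfl | rfl <;> rcases b with rfl | rfl
      · rw [e0] at h5; omega
      · rfl
      · have h6 := latticeDet_swap l u u'
        omega
      · rw [e0] at h5; omega

/-- Every triangle that crosses the line belongs to a step. -/
lemma CombTriangulation.exists_step (hT : CombTriangulation L T) {t : Finset (ℤ × ℤ)}
    (ht : t ∈ T) {l u : ℤ × ℤ} (hl : l ∈ t) (hu : u ∈ t) (hl1 : l.2 ≤ 1) (hu2 : 2 ≤ u.2) :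
    ∃ s, IsStep T s ∧ stepTriangle s = t := by
  obtain ⟨c, rfl⟩ := (hT.unimodular t ht).exists_third hl hu (by rintro rfl; omega)
  rcases hT.abs_det ht with h | h
  · obtain ⟨s, h1, -, h2⟩ := exists_step_left hl1 hu2 ht h
    exact ⟨s, h1, h2⟩
  · obtain ⟨s, h1, -, h2⟩ := exists_step_right hl1 hu2 ht h
    exact ⟨s, h1, h2⟩

/-- Two triangles that share an edge across the line belong to consecutive steps. -/
lemma CombTriangulation.exists_steps (hT : CombTriangulation L T) {t t' : Finset (ℤ × ℤ)}
    (ht : t ∈ T) (ht' : t' ∈ T) (hne : t ≠ t') {l u : ℤ × ℤ} (hl : l ∈ t) (hu : u ∈ t)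
    (hl' : l ∈ t') (hu' : u ∈ t') (hl1 : l.2 ≤ 1) (hu2 : 2 ≤ u.2) :
    ∃ s s', IsStep T s ∧ IsStep T s' ∧ s.2 = (l, u) ∧ s'.1 = (l, u) ∧
      s(t, t') = s(stepTriangle s, stepTriangle s') := by
  have hlu : l ≠ u := by rintro rfl; omega
  obtain ⟨c, rfl⟩ := (hT.unimodular t ht).exists_third hl hu hlu
  obtain ⟨c', rfl⟩ := (hT.unimodular t' ht').exists_third hl' hu' hlu
  have hcc : latticeDet l u c ≠ latticeDet l u c' := fun h => hne (by
    rw [hT.unique_third ht ht' h])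
  rcases hT.abs_det ht with h | h <;> rcases hT.abs_det ht' with h' | h' <;>
    first | exact absurd (h.trans h'.symm) hcc | skip
  · obtain ⟨s, h1, h2, h3⟩ := exists_step_left hl1 hu2 ht h
    obtain ⟨s', h1', h2', h3'⟩ := exists_step_right hl1 hu2 ht' h'
    exact ⟨s, s', h1, h1', h2, h2', by rw [h3, h3']⟩
  · obtain ⟨s, h1, h2, h3⟩ := exists_step_right hl1 hu2 ht h
    obtain ⟨s', h1', h2', h3'⟩ := exists_step_left hl1 hu2 ht' h'
    exact ⟨s', s, h1', h1, h2', h2, by rw [h3, h3', Sym2.eq_swap]⟩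

/-- The weight of the lower end of an edge at its intersection with the line `y = 3 / 2`. -/
noncomputable def lowerWeight (e : (ℤ × ℤ) × (ℤ × ℤ)) : ℝ :=
  ((e.2.2 : ℝ) - 3 / 2) / (e.2.2 - e.1.2)

/-- The abscissa of the intersection of an edge with the line `y = 3 / 2`. -/
noncomputable def crossing (e : (ℤ × ℤ) × (ℤ × ℤ)) : ℝ :=
  lowerWeight e * e.1.1 + (1 - lowerWeight e) * e.2.1

lemma lowerWeight_pos {e : (ℤ × ℤ) × (ℤ × ℤ)} (hl : e.1.2 ≤ 1) (hu : 2 ≤ e.2.2) :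
    0 < lowerWeight e ∧ lowerWeight e < 1 ∧
      lowerWeight e * e.1.2 + (1 - lowerWeight e) * e.2.2 = 3 / 2 := by
  have h1 : (e.1.2 : ℝ) ≤ 1 := by exact_mod_cast hl
  have h2 : (2 : ℝ) ≤ e.2.2 := by exact_mod_cast hu
  have h3 : (0 : ℝ) < e.2.2 - e.1.2 := by linarith
  refine ⟨div_pos (by linarith) h3, (div_lt_one h3).mpr (by linarith), ?_⟩
  unfold lowerWeight
  field_simp
  ring

/-- The determinant with `e` is affine in the third point. At the crossing of `e'`, which has the
same height 3/2 as the crossing of `e`, it is the height of `e` times the difference of the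
abscissas. This translates between the order along the line and the sides of an edge. -/
lemma sub_crossing_mul {e e' : (ℤ × ℤ) × (ℤ × ℤ)} (hl : e.1.2 ≤ 1) (hu : 2 ≤ e.2.2)
    (hl' : e'.1.2 ≤ 1) (hu' : 2 ≤ e'.2.2) :
    ((e.2.2 : ℝ) - e.1.2) * (crossing e - crossing e') =
      lowerWeight e' * latticeDet e.1 e.2 e'.1 + (1 - lowerWeight e') * latticeDet e.1 e.2 e'.2 := by
  have h1 := (lowerWeight_pos hl hu).2.2
  have h2 := (lowerWeight_pos hl' hu').2.2
  simp only [crossing, latticeDet]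
  push_cast
  linear_combination ((e.2.1 : ℝ) - e.1.1) * (h1 - h2)

lemma IsStep.crossing_lt (h : IsStep T s) : crossing s.1 < crossing s.2 := by
  have hr := h.rows
  have h0 : (0 : ℝ) < s.1.2.2 - s.1.1.2 := by
    have h1 : (s.1.1.2 : ℝ) ≤ 1 := by exact_mod_cast hr.1
    have h2 : (2 : ℝ) ≤ s.1.2.2 := by exact_mod_cast hr.2.1
    linarith
  have h1 := sub_crossing_mul hr.1 hr.2.1 hr.2.2.1 hr.2.2.2
  have h2 := lowerWeight_pos hr.2.2.1 hr.2.2.2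
  have h3 : ((s.1.2.2 : ℝ) - s.1.1.2) * (crossing s.1 - crossing s.2) < 0 := by
    rw [h1]
    cases h with
    | lower l u l' _ _ _ _ h5 =>
      have : latticeDet l u u = 0 := by simp only [latticeDet]; ring
      simp only [h5, this] at h2 ⊢
      push_cast
      linarith [h2.1]
    | upper l u u' _ _ _ _ h5 =>
      have : latticeDet l u l = 0 := by simp only [latticeDet]; ring
      simp only [h5, this] at h2 ⊢
      push_cast
      linarith [h2.2.1]
  by_contra! h4
  have := mul_nonneg h0.le (sub_nonneg.mpr h4)
  linarith

lemma exists_right_of_crossing_lt {e e' : (ℤ × ℤ) × (ℤ × ℤ)} (hl : e.1.2 ≤ 1) (hu : 2 ≤ e.2.2)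
    (hl' : e'.1.2 ≤ 1) (hu' : 2 ≤ e'.2.2) (h : crossing e < crossing e') :
    latticeDet e.1 e.2 e'.1 < 0 ∨ latticeDet e.1 e.2 e'.2 < 0 := by
  have h0 : (0 : ℝ) < e.2.2 - e.1.2 := by
    have h1 : (e.1.2 : ℝ) ≤ 1 := by exact_mod_cast hl
    have h2 : (2 : ℝ) ≤ e.2.2 := by exact_mod_cast hu
    linarith
  by_contra! hn
  have h1 := sub_crossing_mul hl hu hl' hu'
  have h2 := lowerWeight_pos hl' hu'
  have h3 : (0 : ℝ) ≤ latticeDet e.1 e.2 e'.1 := by exact_mod_cast hn.1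
  have h4 : (0 : ℝ) ≤ latticeDet e.1 e.2 e'.2 := by exact_mod_cast hn.2
  have h5 := mul_nonneg h2.1.le h3
  have h6 := mul_nonneg (sub_pos.mpr h2.2.1).le h4
  have h7 := mul_pos h0 (sub_pos.mpr h)
  linarith

/-- A point of the line between the two crossings is a convex combination of them, hence of the four
ends of the edges; the shared end collects two of the weights. -/
lemma IsStep.exists_weights (h : IsStep T s) {ζ : ℝ} (h1 : crossing s.1 ≤ ζ)
    (h2 : ζ ≤ crossing s.2) : ∃ (p q r : ℤ × ℤ) (a b c : ℝ), stepTriangle s = {p, q, r} ∧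
      {p, q, r} ∈ T ∧ 0 ≤ a ∧ 0 ≤ b ∧ 0 ≤ c ∧ a + b + c = 1 ∧
      a * p.1 + b * q.1 + c * r.1 = ζ ∧ a * p.2 + b * q.2 + c * r.2 = 3 / 2 ∧
      (crossing s.1 < ζ → ζ < crossing s.2 → 0 < a ∧ 0 < b ∧ 0 < c) := by
  have hlt := h.crossing_lt
  have hr := h.rows
  obtain ⟨a1, a2, a3⟩ := lowerWeight_pos hr.1 hr.2.1
  obtain ⟨b1, b2, b3⟩ := lowerWeight_pos hr.2.2.1 hr.2.2.2
  obtain ⟨θ, t0, t1, hθ, hpos⟩ : ∃ θ : ℝ, 0 ≤ θ ∧ 0 ≤ 1 - θ ∧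
      ζ = (1 - θ) * crossing s.1 + θ * crossing s.2 ∧
      (crossing s.1 < ζ → ζ < crossing s.2 → 0 < θ ∧ 0 < 1 - θ) := by
    have h0 : 0 < crossing s.2 - crossing s.1 := by linarith
    have e : 1 - (ζ - crossing s.1) / (crossing s.2 - crossing s.1) =
        (crossing s.2 - ζ) / (crossing s.2 - crossing s.1) := by field_simp; ring
    refine ⟨(ζ - crossing s.1) / (crossing s.2 - crossing s.1),
      div_nonneg (by linarith) h0.le, ?_, ?_, fun h1 h2 => ⟨div_pos (by linarith) h0, ?_⟩⟩
    · rw [e]; exact div_nonneg (by linarith) h0.le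
    · rw [e]; field_simp; ring
    · rw [e]; exact div_pos (by linarith) h0
  have a2' := sub_pos.mpr a2
  have b2' := sub_pos.mpr b2
  cases h with
  | lower l u l' g1 g2 g3 g4 g5 =>
    set α := lowerWeight ((l, u), (l', u)).1
    set α' := lowerWeight ((l, u), (l', u)).2
    refine ⟨l, u, l', (1 - θ) * α, (1 - θ) * (1 - α) + θ * (1 - α'), θ * α',
      stepTriangle_lower _ _ _, g4, by positivity, by positivity, by positivity, by ring, ?_, ?_,
      fun h1 h2 => ?_⟩
    · rw [hθ]; simp only [crossing]; ring
    · linear_combination (1 - θ) * a3 + θ * b3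
    · obtain ⟨h3, h4⟩ := hpos h1 h2
      refine ⟨?_, ?_, ?_⟩ <;> positivity
  | upper l u u' g1 g2 g3 g4 g5 =>
    set α := lowerWeight ((l, u), (l, u')).1
    set α' := lowerWeight ((l, u), (l, u')).2
    refine ⟨l, u, u', (1 - θ) * α + θ * α', (1 - θ) * (1 - α), θ * (1 - α'),
      stepTriangle_upper _ _ _, g4, by positivity, by positivity, by positivity, by ring, ?_, ?_,
      fun h1 h2 => ?_⟩
    · rw [hθ]; simp only [crossing]; ring
    · linear_combination (1 - θ) * a3 + θ * b3
    · obtain ⟨h3, h4⟩ := hpos h1 h2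
      refine ⟨?_, ?_, ?_⟩ <;> positivity

/-- Steps that overlap agree. -/
lemma CombTriangulation.step_eq_of_overlap (hT : CombTriangulation L T) (h : IsStep T s)
    (h' : IsStep T s') (h1 : crossing s.1 < crossing s'.2) (h2 : crossing s'.1 < crossing s.2) :
    s = s' := by
  obtain ⟨ζ, h3, h4⟩ := exists_between (a₁ := max (crossing s.1) (crossing s'.1))
    (a₂ := min (crossing s.2) (crossing s'.2))
    (max_lt (lt_min h.crossing_lt h1) (lt_min h2 h'.crossing_lt))
  rw [max_lt_iff] at h3
  rw [lt_min_iff] at h4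
  obtain ⟨p, q, r, a, b, c, e1, e2, -, -, -, e3, e4, e5, e6⟩ := h.exists_weights h3.1.le h4.1.le
  obtain ⟨p', q', r', a', b', c', g1, g2, g3, g4, g5, g6, g7, g8, -⟩ :=
    h'.exists_weights h3.2.le h4.2.le
  obtain ⟨k1, k2, k3⟩ := e6 h3.1 h4.1
  refine h.ext h' ?_
  rw [e1, g1]
  exact hT.separated p q r p' q' r' a b c a' b' c' e2 g2 k1 k2 k3 g3 g4 g5 (e3.trans g6.symm)
    (e4.trans g7.symm) (e5.trans g8.symm)

/-- The list of consecutive pairs of elements of a list. -/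
def adjacentPairs {α : Type*} (l : List α) : List (α × α) := l.zip l.tail

lemma mem_adjacentPairs {α : Type*} {l : List α} {x y : α} :
    (x, y) ∈ adjacentPairs l ↔ ∃ A C, l = A ++ x :: y :: C := by
  unfold adjacentPairs
  induction l with
  | nil => simp
  | cons a l ih =>
    cases l with
    | nil =>
      simp only [List.tail_cons, List.zip_nil_right, List.not_mem_nil, false_iff]
      rintro ⟨A, C, h⟩
      have := congrArg List.length h
      simp at this
      omega
    | cons b l =>
      simp only [List.tail_cons, List.zip_cons_cons, List.mem_cons, Prod.mk.injEq] at ih ⊢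
      rw [show (x, y) ∈ (b :: l).zip l ↔ _ from ih]
      constructor
      · rintro (⟨rfl, rfl⟩ | ⟨A, C, h⟩)
        · exact ⟨[], l, rfl⟩
        · exact ⟨a :: A, C, by rw [h]; rfl⟩
      · rintro ⟨A, C, h⟩
        cases A with
        | nil =>
          simp only [List.nil_append, List.cons.injEq] at h
          exact Or.inl ⟨h.1.symm, h.2.1.symm⟩
        | cons a' A =>
          simp only [List.cons_append, List.cons.injEq] at h
          exact Or.inr ⟨A, C, h.2⟩

/-- `l` is the list of the steps along the line `y = 3 / 2`, from left to right. -/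
structure IsStepList (T : Finset (Finset (ℤ × ℤ)))
    (l : List (((ℤ × ℤ) × (ℤ × ℤ)) × ((ℤ × ℤ) × (ℤ × ℤ)))) : Prop where
  mem_iff : ∀ s, s ∈ l ↔ IsStep T s
  nodup : l.Nodup
  adjacent_iff : ∀ s s', (s, s') ∈ adjacentPairs l ↔ IsStep T s ∧ IsStep T s' ∧ s.2 = s'.1

lemma exists_sorted_list {α : Type*} [DecidableEq α] (S : Finset α) (f : α → ℝ)
    (hf : Set.InjOn f S) : ∃ l : List α, (∀ x, x ∈ l ↔ x ∈ S) ∧ l.Pairwise fun x y => f x < f y := by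
  induction S using Finset.induction_on_max_value f with
  | empty => exact ⟨[], by simp, by simp⟩
  | insert a S ha hmax ih =>
    obtain ⟨l, h1, h2⟩ := ih (hf.mono (by simp))
    refine ⟨l ++ [a], fun x => by simp [h1, or_comm], ?_⟩
    rw [List.pairwise_append]
    refine ⟨h2, by simp, fun x hx y hy => ?_⟩
    rw [List.mem_singleton] at hy
    subst hy
    have hxS := (h1 x).mp hx
    refine lt_of_le_of_ne (hmax x hxS) fun h => ha ?_
    rwa [← hf (by simp [hxS]) (by simp) h]

/-- The steps are sorted by their left crossings, which are distinct since overlapping steps agree.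
If `s'` follows `s` in this order, then a vertex of `s'` lies to the right of the right edge of `s`,
so some step starts at that edge, and the order leaves no candidate but `s'`. Thus the triangles
along the line have no gaps. -/
lemma CombTriangulation.exists_stepList (hT : CombTriangulation L T) :
    ∃ l, IsStepList T l := by
  classical
  set V := T.biUnion id
  set S := (((V ×ˢ V) ×ˢ (V ×ˢ V)).filter (IsStep T)) with hS
  have hmem : ∀ s, s ∈ S ↔ IsStep T s := by
    intro s
    rw [hS, Finset.mem_filter, and_iff_right_of_imp]
    intro h
    have hV : ∀ x ∈ stepTriangle s, x ∈ V := fun x hx =>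
      Finset.mem_biUnion.mpr ⟨_, h.stepTriangle_mem, hx⟩
    simp only [Finset.mem_product]
    refine ⟨⟨hV _ ?_, hV _ ?_⟩, hV _ ?_, hV _ ?_⟩ <;> simp [stepTriangle]
  obtain ⟨l, h1, h2⟩ := exists_sorted_list S (fun s => crossing s.1) (by
    intro s hs s' hs' h
    have hs := (hmem s).mp hs
    have hs' := (hmem s').mp hs'
    have h : crossing s.1 = crossing s'.1 := h
    exact hT.step_eq_of_overlap hs hs' (h ▸ hs'.crossing_lt) (h ▸ hs.crossing_lt))
  have hadj : ∀ s s', (s, s') ∈ adjacentPairs l → s.2 = s'.1 := by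
    intro s s' h
    obtain ⟨A, C, rfl⟩ := mem_adjacentPairs.mp h
    have hs := (hmem s).mp ((h1 s).mp (by simp))
    have hs' := (hmem s').mp ((h1 s').mp (by simp))
    rw [List.pairwise_append] at h2
    obtain ⟨h3, h4, h5⟩ := h2
    rw [List.pairwise_cons, List.pairwise_cons] at h4
    have h6 : crossing s.1 < crossing s'.1 := h4.1 s' (by simp)
    have h7 : crossing s.2 ≤ crossing s'.1 := by
      by_contra! h7
      have := hT.step_eq_of_overlap hs hs' (h6.trans hs'.crossing_lt) h7
      rw [this] at h6
      exact lt_irrefl _ h6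
    have hr := hs.rows
    have hr' := hs'.rows
    have hnext : ∃ s'', IsStep T s'' ∧ s''.1 = s.2 := by
      have hm : ∀ x ∈ stepTriangle s', x ∈ L := hT.vertex_mem _ hs'.stepTriangle_mem
      rcases exists_right_of_crossing_lt hr.2.2.1 hr.2.2.2 hr'.2.2.1 hr'.2.2.2
        (h7.trans_lt hs'.crossing_lt) with h | h
      · exact hT.exists_next hs (hm _ (by simp [stepTriangle])) h
      · exact hT.exists_next hs (hm _ (by simp [stepTriangle])) h
    obtain ⟨s'', h8, h9⟩ := hnext
    have h10 := (h1 s'').mpr ((hmem s'').mpr h8)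
    have h11 := hs.crossing_lt
    rw [← h9] at h11 h7 ⊢
    simp only [List.mem_append, List.mem_cons] at h10
    rcases h10 with h | rfl | rfl | h
    · exact absurd (h5 s'' h s (by simp)) (not_lt.mpr h11.le)
    · exact absurd h11 (lt_irrefl _)
    · rfl
    · exact absurd (h4.2.1 s'' h) (not_lt.mpr h7)
  refine ⟨l, fun s => (h1 s).trans (hmem s), h2.imp (fun {a b} h => ?_), fun s s' => ⟨fun h => ?_, ?_⟩⟩
  · rintro rfl; exact lt_irrefl _ h
  · have := hadj s s' h
    obtain ⟨A, C, rfl⟩ := mem_adjacentPairs.mp h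
    exact ⟨(hmem s).mp ((h1 s).mp (by simp)), (hmem s').mp ((h1 s').mp (by simp)), this⟩
  · rintro ⟨hs, hs', he⟩
    obtain ⟨A, C, hAC⟩ := List.append_of_mem ((h1 s).mpr ((hmem s).mpr hs))
    have hlt : crossing s.1 < crossing s'.1 := he ▸ hs.crossing_lt
    have hs'l := (h1 s').mpr ((hmem s').mpr hs')
    rw [hAC] at hs'l h2
    rw [List.pairwise_append, List.pairwise_cons] at h2
    obtain ⟨-, ⟨h3, h4⟩, h5⟩ := h2
    simp only [List.mem_append, List.mem_cons] at hs'l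
    rcases hs'l with h | rfl | h
    · exact absurd (h5 s' h s (by simp)) (not_lt.mpr hlt.le)
    · exact absurd hlt (lt_irrefl _)
    · cases C with
      | nil => simp at h
      | cons y C =>
        have hy : (s, y) ∈ adjacentPairs l := mem_adjacentPairs.mpr ⟨A, C, hAC⟩
        rcases List.mem_cons.mp h with rfl | h
        · exact hy
        · have h6 := hadj s y hy
          have h7 := (List.pairwise_cons.mp h4).1 s' h
          rw [← h6, he] at h7
          exact absurd h7 (lt_irrefl _)

end Steps


/-! ### Links between consecutive steps of the lower side -/

lemma adjacentPairs_nodup {α : Type*} {l : List α} (h : l.Nodup) : (adjacentPairs l).Nodup := by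
  refine List.Nodup.of_map Prod.snd ?_
  unfold adjacentPairs
  rw [List.map_snd_zip (by simp)]
  exact h.sublist (List.tail_sublist l)

lemma adjacentPairs_map {α β : Type*} (f : α → β) (l : List α) :
    adjacentPairs (l.map f) = (adjacentPairs l).map (Prod.map f f) := by
  simp [adjacentPairs, ← List.map_tail, List.zip_map]

lemma adjacentPairs_cons_cons {α : Type*} (a b : α) (l : List α) :
    adjacentPairs (a :: b :: l) = (a, b) :: adjacentPairs (b :: l) := rfl

lemma mem_adjacentPairs_filter {α : Type*} {P : α → Prop} [DecidablePred P] {l : List α}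
    {x y : α} : (x, y) ∈ adjacentPairs (l.filter fun a => P a) ↔
      P x ∧ P y ∧ ∃ A B C, l = A ++ x :: (B ++ y :: C) ∧ ∀ b ∈ B, ¬ P b := by
  rw [mem_adjacentPairs]
  constructor
  · rintro ⟨A, C, h⟩
    obtain ⟨A', D, rfl, -, hD⟩ := List.filter_eq_append_iff.mp h
    obtain ⟨E, F, rfl, hE, hx, hF⟩ := List.filter_eq_cons_iff.mp hD
    obtain ⟨B, G, rfl, hB, hy, -⟩ := List.filter_eq_cons_iff.mp hF
    exact ⟨by simpa using hx, by simpa using hy, A' ++ E, B, G, by simp, by simpa using hB⟩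
  · rintro ⟨hx, hy, A, B, C, rfl, hB⟩
    have : B.filter (fun a => P a) = [] := by simpa using hB
    exact ⟨A.filter (fun a => P a), C.filter (fun a => P a), by simp [hx, hy, this]⟩

/-- The step changes the lower end of the edge. -/
def IsLower (s : ((ℤ × ℤ) × (ℤ × ℤ)) × ((ℤ × ℤ) × (ℤ × ℤ))) : Prop := s.1.2 = s.2.2

instance : DecidablePred IsLower := fun s => inferInstanceAs (Decidable (s.1.2 = s.2.2))

section Links

variable {L : Set (ℤ × ℤ)} {T : Finset (Finset (ℤ × ℤ))}
  {s s' : ((ℤ × ℤ) × (ℤ × ℤ)) × ((ℤ × ℤ) × (ℤ × ℤ))}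
  {l : List (((ℤ × ℤ) × (ℤ × ℤ)) × ((ℤ × ℤ) × (ℤ × ℤ)))}

lemma latticeDet_self_right (p q : ℤ × ℤ) : latticeDet p q q = 0 := by
  simp only [latticeDet]; ring

lemma latticeDet_self_left (p q : ℤ × ℤ) : latticeDet p q p = 0 := by
  simp only [latticeDet]; ring

lemma IsStep.fst_eq_of_not_isLower (h : IsStep T s) (hs : ¬ IsLower s) : s.1.1 = s.2.1 := by
  cases h with
  | lower => exact absurd rfl hs
  | upper => rfl

lemma IsStep.exists_of_isLower (h : IsStep T s) (hs : IsLower s) :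
    ∃ l u l', s = ((l, u), (l', u)) ∧ l.2 ≤ 1 ∧ 2 ≤ u.2 ∧ l'.2 ≤ 1 ∧ {l, u, l'} ∈ T ∧
      latticeDet l u l' = -1 := by
  cases h with
  | lower l u l' h1 h2 h3 h4 h5 => exact ⟨l, u, l', rfl, h1, h2, h3, h4, h5⟩
  | upper l u u' h1 h2 h3 h4 h5 =>
    have : u = u' := hs
    rw [this, latticeDet_self_right] at h5
    norm_num at h5

/-- At the vertex `p` that is entered, the triangle meets both the upper half-plane and the left
part of the row of `p`, and `unique_beside` allows only one such triangle. Besides indexing the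
links, this bounds the number of arrivals. -/
lemma CombTriangulation.unique_enter (hT : CombTriangulation L T) (h : IsStep T s)
    (h' : IsStep T s') (hs : IsLower s) (hs' : IsLower s') (he : s.2.1 = s'.2.1)
    (h1 : s.2.1.2 = 1) : s = s' := by
  obtain ⟨l, u, p, rfl, a1, a2, a3, a4, a5⟩ := h.exists_of_isLower hs
  obtain ⟨m, v, q, rfl, b1, b2, b3, b4, b5⟩ := h'.exists_of_isLower hs'
  simp only at he h1
  subst he
  rw [← triple_rotate] at a4 b4
  rw [latticeDet_rotate] at a5 b5
  obtain ⟨rfl, rfl⟩ := hT.unique_beside a4 b4 (a5.trans b5.symm) (by omega) (by omega) (by omega)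
    (by omega)
  rfl

lemma CombTriangulation.unique_leave (hT : CombTriangulation L T) (h : IsStep T s)
    (h' : IsStep T s') (hs : IsLower s) (hs' : IsLower s') (he : s.1.1 = s'.1.1)
    (h1 : s.1.1.2 = 1) : s = s' := by
  obtain ⟨p, u, l, rfl, a1, a2, a3, a4, a5⟩ := h.exists_of_isLower hs
  obtain ⟨q, v, m, rfl, b1, b2, b3, b4, b5⟩ := h'.exists_of_isLower hs'
  simp only at he h1
  subst he
  rw [triple_swap] at a4 b4
  obtain ⟨rfl, rfl⟩ := hT.unique_beside a4 b4
    (by rw [latticeDet_swap p u l, latticeDet_swap p v m, a5, b5]) (by omega) (by omega) (by omega)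
    (by omega)
  rfl

lemma IsStepList.isStep_of_mem_append {x} {A C} (hl : IsStepList T l) (h : l = A ++ x :: C) :
    IsStep T x := (hl.mem_iff x).mp (by rw [h]; simp)

/-- The lower end does not change between consecutive steps of the lower side. -/
lemma IsStepList.lower_eq (hl : IsStepList T l) {x y} {A B C} (h : l = A ++ x :: (B ++ y :: C))
    (hB : ∀ b ∈ B, ¬ IsLower b) : x.2.1 = y.1.1 := by
  induction B generalizing x A with
  | nil =>
    have := ((hl.adjacent_iff x y).mp (mem_adjacentPairs.mpr ⟨A, C, h⟩)).2.2
    rw [this]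
  | cons b B ih =>
    have h1 := ((hl.adjacent_iff x b).mp (mem_adjacentPairs.mpr ⟨A, B ++ y :: C, h⟩)).2.2
    rw [h1, (hl.isStep_of_mem_append (A := A ++ [x]) (C := B ++ y :: C) (x := b)
      (by rw [h]; simp)).fst_eq_of_not_isLower (hB b (by simp))]
    exact ih (A := A ++ [x]) (by rw [h]; simp) fun b' hb' => hB b' (by simp [hb'])

/-- The pairs of consecutive steps of the lower side at a lattice point of the row `y = 1`. -/
def lowerPairs (l : List (((ℤ × ℤ) × (ℤ × ℤ)) × ((ℤ × ℤ) × (ℤ × ℤ)))) :=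
  (adjacentPairs (l.filter fun s => IsLower s)).filter fun q => q.1.2.1.2 = 1

/-- The three-term relation between the determinants of `u`, `v`, `c` at `p`, with their heights
above `p` as coefficients, has incompatible signs if neither `v` nor `c` lies to the right of the
edge from `p` to `u`. -/
lemma CombTriangulation.exists_right_of_leave (hT : CombTriangulation L T) (h' : IsStep T s')
    (hs' : IsLower s') (h1 : s'.1.1.2 = 1) {u : ℤ × ℤ} (hu : 2 ≤ u.2) :
    ∃ w ∈ L, latticeDet s'.1.1 u w < 0 := by
  obtain ⟨p, v, c, rfl, b1, b2, b3, b4, b5⟩ := h'.exists_of_isLower hs'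
  simp only at h1 ⊢
  by_contra! hn
  have e1 := hn v (hT.vertex_mem _ b4 v (by simp))
  have e2 := hn c (hT.vertex_mem _ b4 c (by simp))
  have key : (c.2 - p.2) * latticeDet p u v - (v.2 - p.2) * latticeDet p u c +
      (u.2 - p.2) * latticeDet p v c = 0 := by
    simp only [latticeDet]; ring
  rw [b5] at key
  have k1 : (c.2 - p.2) * latticeDet p u v ≤ 0 := mul_nonpos_of_nonpos_of_nonneg (by omega) e1
  have k2 : 0 ≤ (v.2 - p.2) * latticeDet p u c := mul_nonneg (by omega) e2
  omega

/-- Follow the list from the step `s` that enters p. The lower end stays p until the next step of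
the lower side, which leaves p and so is `s'` by uniqueness. The list cannot end earlier, because
`s'` has a vertex to the right of every edge from p across the line. This makes links local data at
points of the row y = 1, free of the order of the list. -/
lemma CombTriangulation.mem_lowerPairs (hT : CombTriangulation L T) (hl : IsStepList T l) :
    (s, s') ∈ lowerPairs l ↔ IsStep T s ∧ IsStep T s' ∧ IsLower s ∧ IsLower s' ∧
      s.2.1 = s'.1.1 ∧ s.2.1.2 = 1 := by
  rw [lowerPairs, List.mem_filter, mem_adjacentPairs_filter]
  simp only [decide_eq_true_eq]
  constructor
  · rintro ⟨⟨h1, h2, A, B, C, h3, h4⟩, h5⟩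
    exact ⟨hl.isStep_of_mem_append h3,
      hl.isStep_of_mem_append (A := A ++ s :: B) (C := C) (by rw [h3]; simp), h1, h2,
      hl.lower_eq h3 h4, h5⟩
  · rintro ⟨h1, h2, h3, h4, h5, h6⟩
    refine ⟨⟨h3, h4, ?_⟩, h6⟩
    have main : ∀ (C A : List (((ℤ × ℤ) × (ℤ × ℤ)) × ((ℤ × ℤ) × (ℤ × ℤ))))
        (x : ((ℤ × ℤ) × (ℤ × ℤ)) × ((ℤ × ℤ) × (ℤ × ℤ))), l = A ++ x :: C → x.2.1 = s.2.1 →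
        ∃ B D, C = B ++ s' :: D ∧ ∀ b ∈ B, ¬ IsLower b := by
      intro C
      induction C with
      | nil =>
        intro A x hA hx
        exfalso
        have hxs := hl.isStep_of_mem_append hA
        obtain ⟨w, hw, hd⟩ := hT.exists_right_of_leave h2 h4 (h5 ▸ h6) (u := x.2.2) hxs.rows.2.2.2
        rw [← h5, ← hx] at hd
        obtain ⟨y, hy, hyx⟩ := hT.exists_next hxs hw hd
        obtain ⟨A', C', h7⟩ := mem_adjacentPairs.mp ((hl.adjacent_iff x y).mpr ⟨hxs, hy, hyx.symm⟩)
        have hnd := hl.nodup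
        have hx1 : x ∉ A := by
          rw [hA] at hnd
          have := (List.nodup_append.mp hnd).2.2
          exact fun h => this x h x (by simp) rfl
        have hx2 : x ∉ A' := by
          rw [h7] at hnd
          have := (List.nodup_append.mp hnd).2.2
          exact fun h => this x h x (by simp) rfl
        have h8 := hA.symm.trans h7
        have h9 := congrArg (List.idxOf x) h8
        rw [List.idxOf_append_of_notMem hx1, List.idxOf_append_of_notMem hx2,
          List.idxOf_cons_self, List.idxOf_cons_self] at h9
        have h10 := congrArg List.length h8
        simp at h10 h9
        omega
      | cons y C ih =>
        intro A x hA hx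
        have hxy := ((hl.adjacent_iff x y).mp (mem_adjacentPairs.mpr ⟨A, C, hA⟩))
        by_cases hy : IsLower y
        · have : y = s' := hT.unique_leave hxy.2.1 h2 hy h4
            (by rw [← h5, ← hx, hxy.2.2]) (by rw [← hxy.2.2, hx, h6])
          subst this
          exact ⟨[], C, rfl, by simp⟩
        · obtain ⟨B, D, h7, h8⟩ := ih (A ++ [x]) y (by rw [hA]; simp)
            (by rw [← hxy.2.1.fst_eq_of_not_isLower hy, ← hxy.2.2, hx])
          exact ⟨y :: B, D, by rw [h7]; rfl, fun b hb => by
            rcases List.mem_cons.mp hb with rfl | hb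
            exacts [hy, h8 b hb]⟩
    obtain ⟨A, C, hA⟩ := List.append_of_mem ((hl.mem_iff s).mpr h1)
    obtain ⟨B, D, h7, h8⟩ := main C A s hA rfl
    exact ⟨A, B, D, by rw [hA, h7], h8⟩

lemma IsStepList.lowerPairs_nodup (hl : IsStepList T l) : (lowerPairs l).Nodup :=
  (adjacentPairs_nodup (hl.nodup.filter _)).filter _

lemma CombTriangulation.lowerPairs_map_nodup (hT : CombTriangulation L T) (hl : IsStepList T l) :
    ((lowerPairs l).map fun q => q.1.2.1).Nodup := by
  refine List.Nodup.map_on ?_ hl.lowerPairs_nodup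
  rintro ⟨s, s'⟩ hs ⟨t, t'⟩ ht h
  obtain ⟨a1, a2, a3, a4, a5, a6⟩ := (hT.mem_lowerPairs hl).mp hs
  obtain ⟨b1, b2, b3, b4, b5, b6⟩ := (hT.mem_lowerPairs hl).mp ht
  simp only at h
  rw [hT.unique_enter a1 b1 a3 b3 h a6,
    hT.unique_leave a2 b2 a4 b4 (by rw [← a5, ← b5, h]) (by rw [← a5, a6])]

/-! ### Reflections -/

/-- The reflection `(x, y) ↦ (x, c - y)`. -/
def reflect (c : ℤ) : Equiv.Perm (ℤ × ℤ) where
  toFun p := (p.1, c - p.2)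
  invFun p := (p.1, c - p.2)
  left_inv p := by simp
  right_inv p := by simp

lemma reflect_apply (c : ℤ) (p : ℤ × ℤ) : reflect c p = (p.1, c - p.2) := rfl

lemma reflect_reflect (c : ℤ) (p : ℤ × ℤ) : reflect c (reflect c p) = p := by
  simp [reflect_apply]

lemma isLatticeIso_reflect (c : ℤ) : IsLatticeIso (reflect c) (-1) :=
  ⟨⟨1, 0, 0, -1, 0, c, by norm_num, fun p => by
    rw [reflect_apply]; ext <;> simp only <;> ring⟩, Or.inr rfl⟩

lemma map_reflect_reflect (c : ℤ) (t : Finset (ℤ × ℤ)) :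
    (t.map (reflect c).toEmbedding).map (reflect c).toEmbedding = t := by
  ext x
  simp only [Finset.mem_map_equiv]
  rw [show (reflect c).symm = reflect c from rfl, reflect_reflect]

lemma mapTriangulation_reflect_reflect (c : ℤ) (T : Finset (Finset (ℤ × ℤ))) :
    mapTriangulation (reflect c) (mapTriangulation (reflect c) T) = T := by
  ext t
  rw [← map_reflect_reflect c t, mem_mapTriangulation, mem_mapTriangulation,
    map_reflect_reflect]

/-- The step runs along a horizontal edge in the row `y = 1`. -/
def IsFlat (s : ((ℤ × ℤ) × (ℤ × ℤ)) × ((ℤ × ℤ) × (ℤ × ℤ))) : Prop :=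
  s.1.1.2 = 1 ∧ s.2.1.2 = 1

instance : DecidablePred IsFlat := fun s =>
  inferInstanceAs (Decidable (s.1.1.2 = 1 ∧ s.2.1.2 = 1))

open Classical in
/-- The triangle below the lower side of a step: the one across the horizontal edge if there is
such an edge, and the triangle of the step otherwise. -/
noncomputable def belowTriangle (T : Finset (Finset (ℤ × ℤ)))
    (s : ((ℤ × ℤ) × (ℤ × ℤ)) × ((ℤ × ℤ) × (ℤ × ℤ))) : Finset (ℤ × ℤ) :=
  if h : IsFlat s ∧ ∃ t ∈ T, t ≠ stepTriangle s ∧ s.1.1 ∈ t ∧ s.2.1 ∈ t then h.2.choose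
  else stepTriangle s

lemma belowTriangle_of_not_isFlat (h : ¬ IsFlat s) : belowTriangle T s = stepTriangle s :=
  dif_neg fun h' => h h'.1

/-- The determinant of a triangle on `p q` is 1 or -1 and each value fixes the third vertex, so an
edge lies in at most two triangles. -/
lemma CombTriangulation.eq_of_share (hT : CombTriangulation L T) {p q : ℤ × ℤ} (hpq : p ≠ q)
    {t t₁ t₂ : Finset (ℤ × ℤ)} (ht : t ∈ T) (ht₁ : t₁ ∈ T) (ht₂ : t₂ ∈ T) (h₁ : t₁ ≠ t)
    (h₂ : t₂ ≠ t) (hp : p ∈ t) (hq : q ∈ t) (hp₁ : p ∈ t₁) (hq₁ : q ∈ t₁) (hp₂ : p ∈ t₂)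
    (hq₂ : q ∈ t₂) : t₁ = t₂ := by
  obtain ⟨r, rfl⟩ := (hT.unimodular t ht).exists_third hp hq hpq
  obtain ⟨r₁, rfl⟩ := (hT.unimodular t₁ ht₁).exists_third hp₁ hq₁ hpq
  obtain ⟨r₂, rfl⟩ := (hT.unimodular t₂ ht₂).exists_third hp₂ hq₂ hpq
  have n1 : latticeDet p q r₁ ≠ latticeDet p q r := fun h => h₁ (by rw [hT.unique_third ht₁ ht h])
  have n2 : latticeDet p q r₂ ≠ latticeDet p q r := fun h => h₂ (by rw [hT.unique_third ht₂ ht h])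
  have : latticeDet p q r₁ = latticeDet p q r₂ := by
    rcases hT.abs_det ht with h | h <;> rcases hT.abs_det ht₁ with h' | h' <;>
      rcases hT.abs_det ht₂ with h'' | h'' <;> omega
  rw [hT.unique_third ht₁ ht₂ this]

lemma IsStep.fst_ne (h : IsStep T s) (hs : IsLower s) : s.1.1 ≠ s.2.1 := by
  obtain ⟨l, u, l', rfl, -, -, -, -, h5⟩ := h.exists_of_isLower hs
  rintro (rfl : l = l')
  rw [latticeDet_self_left] at h5
  norm_num at h5

lemma CombTriangulation.belowTriangle_eq (hT : CombTriangulation L T) (h : IsStep T s)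
    (hs : IsLower s) (hf : IsFlat s) {t : Finset (ℤ × ℤ)} (ht : t ∈ T) (hne : t ≠ stepTriangle s)
    (h1 : s.1.1 ∈ t) (h2 : s.2.1 ∈ t) : belowTriangle T s = t := by
  have hex : IsFlat s ∧ ∃ t ∈ T, t ≠ stepTriangle s ∧ s.1.1 ∈ t ∧ s.2.1 ∈ t :=
    ⟨hf, t, ht, hne, h1, h2⟩
  rw [belowTriangle, dif_pos hex]
  obtain ⟨a1, a2, a3, a4⟩ := hex.2.choose_spec
  exact hT.eq_of_share (h.fst_ne hs) h.stepTriangle_mem a1 ht a2 hne (by simp [stepTriangle])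
    (by simp [stepTriangle]) a3 a4 h1 h2

/-- Below a flat step there is a triangle on the other side of the horizontal edge. -/
lemma CombTriangulation.exists_below (hT : CombTriangulation L T) (hL : ∃ w ∈ L, w.2 < 1)
    (h : IsStep T s) (hs : IsLower s) (hf : IsFlat s) :
    ∃ x : ℤ × ℤ, x.2 ≤ 0 ∧ {s.1.1, s.2.1, x} ∈ T ∧ latticeDet s.1.1 s.2.1 x = -1 ∧
      belowTriangle T s = {s.1.1, s.2.1, x} := by
  obtain ⟨w, hw, hw1⟩ := hL
  have hne := h.fst_ne hs
  obtain ⟨l, u, l', rfl, a1, a2, a3, a4, a5⟩ := h.exists_of_isLower hs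
  obtain ⟨f1, f2⟩ := hf
  simp only at f1 f2 hne ⊢
  have e : ∀ y : ℤ × ℤ, latticeDet l l' y = (l'.1 - l.1) * (y.2 - 1) := by
    intro y; simp only [latticeDet, f1, f2]; ring
  have hd : latticeDet l l' u = 1 := by rw [latticeDet_swap, a5]; norm_num
  have hpos : 0 < l'.1 - l.1 := by
    rw [e] at hd
    exact pos_of_mul_pos_left (by rw [hd]; norm_num) (by omega)
  have a4' : {l, l', u} ∈ T := by rwa [triple_swap]
  obtain ⟨x, hx, hdx⟩ := hT.neighbour l l' u a4' w hw (by
    rw [hd, e, one_mul]; exact mul_neg_of_pos_of_neg hpos (by omega))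
  rw [hd] at hdx
  have hx2 : x.2 ≤ 0 := by
    by_contra! hlt
    have : 0 ≤ latticeDet l l' x := by rw [e]; exact mul_nonneg hpos.le (by omega)
    omega
  refine ⟨x, hx2, hx, hdx, ?_⟩
  refine hT.belowTriangle_eq h hs ⟨f1, f2⟩ hx ?_ (by simp) (by simp)
  rw [stepTriangle_lower]
  intro heq
  have : x ∈ ({l, u, l'} : Finset (ℤ × ℤ)) := by rw [← heq]; simp
  simp only [Finset.mem_insert, Finset.mem_singleton] at this
  rcases this with rfl | rfl | rfl <;> omega

/-- The reflection y ↦ 2 - y fixes the row y = 1 and carries the line y = 1/2 to y = 3/2, so the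
steps of the reflected triangulation describe T from below. The triangle just left of the entered
point from below is the one across the horizontal edge for a flat step; otherwise the triangle of
the step itself reaches below the row. -/
lemma CombTriangulation.exists_enter_below (hT : CombTriangulation L T) (hL : ∃ w ∈ L, w.2 < 1)
    (h : IsStep T s) (hs : IsLower s) (h1 : s.2.1.2 = 1) :
    ∃ t, IsStep (mapTriangulation (reflect 2) T) t ∧ IsLower t ∧ t.2.1 = s.2.1 ∧
      (stepTriangle t).map (reflect 2).toEmbedding = belowTriangle T s := by
  have fix : ∀ p : ℤ × ℤ, p.2 = 1 → reflect 2 p = p := by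
    intro p hp; rw [reflect_apply]; ext <;> simp [hp]
  by_cases hf : IsFlat s
  · obtain ⟨x, hx0, hx, hd, hb⟩ := hT.exists_below hL h hs hf
    obtain ⟨l, u, p, rfl, a1, a2, a3, a4, a5⟩ := h.exists_of_isLower hs
    obtain ⟨f1, f2⟩ := hf
    simp only at f1 f2 hx hd hb ⊢
    refine ⟨((l, reflect 2 x), (p, reflect 2 x)), .lower _ _ _ a1 (by rw [reflect_apply]; simp only; omega) a3
      ?_ ?_, rfl, rfl, ?_⟩
    · have := (triple_mem_mapTriangulation (φ := reflect 2)).mpr hx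
      rwa [fix l f1, fix p f2, triple_swap] at this
    · have := (isLatticeIso_reflect 2).latticeDet l x p
      rw [fix l f1, fix p f2] at this
      rw [this, latticeDet_swap, hd]; norm_num
    · rw [stepTriangle_lower, map_triple, hb, fix l f1, fix p f2, reflect_reflect, triple_swap]
  · rw [belowTriangle_of_not_isFlat hf]
    obtain ⟨l, u, p, rfl, a1, a2, a3, a4, a5⟩ := h.exists_of_isLower hs
    simp only at h1 ⊢
    have hl : l.2 ≠ 1 := fun h => hf ⟨h, h1⟩
    refine ⟨((reflect 2 u, reflect 2 l), (p, reflect 2 l)), .lower _ _ _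
      (by rw [reflect_apply]; simp only; omega) (by rw [reflect_apply]; simp only; omega) a3 ?_ ?_,
      rfl, rfl, ?_⟩
    · have := (triple_mem_mapTriangulation (φ := reflect 2)).mpr a4
      rwa [fix p h1, triple_swap'] at this
    · have := (isLatticeIso_reflect 2).latticeDet u l p
      rw [fix p h1] at this
      rw [this, latticeDet_swap', a5]; norm_num
    · rw [stepTriangle_lower, stepTriangle_lower, map_triple, reflect_reflect, reflect_reflect,
        fix p h1, triple_swap']

lemma CombTriangulation.exists_leave_below (hT : CombTriangulation L T) (hL : ∃ w ∈ L, w.2 < 1)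
    (h : IsStep T s) (hs : IsLower s) (h1 : s.1.1.2 = 1) :
    ∃ t, IsStep (mapTriangulation (reflect 2) T) t ∧ IsLower t ∧ t.1.1 = s.1.1 ∧
      (stepTriangle t).map (reflect 2).toEmbedding = belowTriangle T s := by
  have fix : ∀ p : ℤ × ℤ, p.2 = 1 → reflect 2 p = p := by
    intro p hp; rw [reflect_apply]; ext <;> simp [hp]
  by_cases hf : IsFlat s
  · obtain ⟨x, hx0, hx, hd, hb⟩ := hT.exists_below hL h hs hf
    obtain ⟨l, u, p, rfl, a1, a2, a3, a4, a5⟩ := h.exists_of_isLower hs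
    obtain ⟨f1, f2⟩ := hf
    simp only at f1 f2 hx hd hb ⊢
    refine ⟨((l, reflect 2 x), (p, reflect 2 x)), .lower _ _ _ a1 (by rw [reflect_apply]; simp only; omega) a3
      ?_ ?_, rfl, rfl, ?_⟩
    · have := (triple_mem_mapTriangulation (φ := reflect 2)).mpr hx
      rwa [fix l f1, fix p f2, triple_swap] at this
    · have := (isLatticeIso_reflect 2).latticeDet l x p
      rw [fix l f1, fix p f2] at this
      rw [this, latticeDet_swap, hd]; norm_num
    · rw [stepTriangle_lower, map_triple, hb, fix l f1, fix p f2, reflect_reflect, triple_swap]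
  · rw [belowTriangle_of_not_isFlat hf]
    obtain ⟨p, u, l, rfl, a1, a2, a3, a4, a5⟩ := h.exists_of_isLower hs
    simp only at h1 ⊢
    have hl : l.2 ≠ 1 := fun h => hf ⟨h1, h⟩
    refine ⟨((p, reflect 2 l), (reflect 2 u, reflect 2 l)), .lower _ _ _ a1
      (by rw [reflect_apply]; simp only; omega) (by rw [reflect_apply]; simp only; omega) ?_ ?_,
      rfl, rfl, ?_⟩
    · have := (triple_mem_mapTriangulation (φ := reflect 2)).mpr a4
      rwa [fix p h1, triple_swap] at this
    · have := (isLatticeIso_reflect 2).latticeDet p l u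
      rw [fix p h1] at this
      rw [this, latticeDet_swap p u l, a5]; norm_num
    · rw [stepTriangle_lower, stepTriangle_lower, map_triple, reflect_reflect, reflect_reflect,
        fix p h1, triple_swap]

/-- The links of the lower side. -/
noncomputable def lowerLinks (T : Finset (Finset (ℤ × ℤ)))
    (l : List (((ℤ × ℤ) × (ℤ × ℤ)) × ((ℤ × ℤ) × (ℤ × ℤ)))) : List (Sym2 (Finset (ℤ × ℤ))) :=
  (lowerPairs l).map fun q => s(belowTriangle T q.1, belowTriangle T q.2)

/-- The links seen from above and those seen from below are both indexed, without repetition, by the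
points of the row y = 1 that are entered and left. `exists_enter_below` and `exists_leave_below`,
applied to T and to its reflection, show that these are the same points with the same links. Only
the order in the lists may differ. -/
lemma CombTriangulation.lowerLinks_perm (hT : CombTriangulation L T) (hL : ∃ w ∈ L, w.2 < 1)
    (hL' : ∃ w ∈ L, 1 < w.2) (hl : IsStepList T l) {l'}
    (hl' : IsStepList (mapTriangulation (reflect 2) T) l') :
    (lowerLinks T l).Perm ((lowerPairs l').map fun q =>
      s((stepTriangle q.1).map (reflect 2).toEmbedding,
        (stepTriangle q.2).map (reflect 2).toEmbedding)) := by
  classical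
  set T' := mapTriangulation (reflect 2) T with hT'def
  have hT' : CombTriangulation (reflect 2 '' L) T' := hT.map (isLatticeIso_reflect 2)
  have hLr : ∃ w ∈ reflect 2 '' L, w.2 < 1 := by
    obtain ⟨w, hw, h⟩ := hL'
    exact ⟨_, ⟨w, hw, rfl⟩, by rw [reflect_apply]; simp only; omega⟩
  -- The link as a function of the point; the default value is not reached at the points that index
  -- the lists.
  set Λ : ℤ × ℤ → Sym2 (Finset (ℤ × ℤ)) := fun p =>
    if h : ∃ q : _ × _, q ∈ lowerPairs l' ∧ q.1.2.1 = p then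
      s((stepTriangle h.choose.1).map (reflect 2).toEmbedding,
        (stepTriangle h.choose.2).map (reflect 2).toEmbedding)
    else s(∅, ∅) with hΛ
  have hinj : ∀ q ∈ lowerPairs l', ∀ q' ∈ lowerPairs l', q.1.2.1 = q'.1.2.1 → q = q' := by
    intro q hq q' hq' h
    exact List.inj_on_of_nodup_map (hT'.lowerPairs_map_nodup hl') hq hq' h
  have hΛ' : ∀ q ∈ lowerPairs l', Λ q.1.2.1 = s((stepTriangle q.1).map (reflect 2).toEmbedding,
      (stepTriangle q.2).map (reflect 2).toEmbedding) := by
    intro q hq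
    have hex : ∃ q' : _ × _, q' ∈ lowerPairs l' ∧ q'.1.2.1 = q.1.2.1 := ⟨q, hq, rfl⟩
    have := hinj _ hex.choose_spec.1 q hq hex.choose_spec.2
    simp only [hΛ]
    rw [dif_pos hex, this]
  have hpair : ∀ q ∈ lowerPairs l, ∃ q' ∈ lowerPairs l', q'.1.2.1 = q.1.2.1 ∧
      s((stepTriangle q'.1).map (reflect 2).toEmbedding,
        (stepTriangle q'.2).map (reflect 2).toEmbedding) =
      s(belowTriangle T q.1, belowTriangle T q.2) := by
    rintro ⟨s, s'⟩ hq
    obtain ⟨a1, a2, a3, a4, a5, a6⟩ := (hT.mem_lowerPairs hl).mp hq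
    obtain ⟨t, b1, b2, b3, b4⟩ := hT.exists_enter_below hL a1 a3 a6
    obtain ⟨t', c1, c2, c3, c4⟩ := hT.exists_leave_below hL a2 a4 (a5 ▸ a6)
    exact ⟨(t, t'), (hT'.mem_lowerPairs hl').mpr ⟨b1, c1, b2, c2, by rw [b3, c3, a5],
      by rw [b3, a6]⟩, b3, by simp only [b4, c4]⟩
  have hpair' : ∀ q ∈ lowerPairs l', ∃ q' ∈ lowerPairs l, q'.1.2.1 = q.1.2.1 := by
    rintro ⟨s, s'⟩ hq
    obtain ⟨a1, a2, a3, a4, a5, a6⟩ := (hT'.mem_lowerPairs hl').mp hq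
    obtain ⟨t, b1, b2, b3, -⟩ := hT'.exists_enter_below hLr a1 a3 a6
    obtain ⟨t', c1, c2, c3, -⟩ := hT'.exists_leave_below hLr a2 a4 (a5 ▸ a6)
    rw [hT'def, mapTriangulation_reflect_reflect] at b1 c1
    exact ⟨(t, t'), (hT.mem_lowerPairs hl).mpr ⟨b1, c1, b2, c2, by rw [b3, c3, a5],
      by rw [b3, a6]⟩, b3⟩
  have hperm : ((lowerPairs l).map fun q => q.1.2.1).Perm ((lowerPairs l').map fun q => q.1.2.1) := by
    rw [List.perm_ext_iff_of_nodup (hT.lowerPairs_map_nodup hl) (hT'.lowerPairs_map_nodup hl')]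
    intro p
    simp only [List.mem_map]
    constructor
    · rintro ⟨q, hq, rfl⟩
      obtain ⟨q', h1, h2, -⟩ := hpair q hq
      exact ⟨q', h1, h2⟩
    · rintro ⟨q, hq, rfl⟩
      exact hpair' q hq
  have h1 : lowerLinks T l = ((lowerPairs l).map fun q => q.1.2.1).map Λ := by
    rw [lowerLinks, List.map_map]
    refine List.map_congr_left fun q hq => ?_
    obtain ⟨q', h1, h2, h3⟩ := hpair q hq
    rw [Function.comp, ← h2, hΛ' q' h1, h3]
  have h2 : ((lowerPairs l').map fun q => s((stepTriangle q.1).map (reflect 2).toEmbedding,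
      (stepTriangle q.2).map (reflect 2).toEmbedding)) =
      ((lowerPairs l').map fun q => q.1.2.1).map Λ := by
    rw [List.map_map]
    exact List.map_congr_left fun q hq => (hΛ' q hq).symm
  rw [h1, h2]
  exact hperm.map Λ

end Links


/-! ### Eliminating the triangles with an edge on the boundary row -/

section Elimination

open Classical in
/-- The edges between consecutive elements `x`, `y` of a list for which `flag x` holds. -/
noncomputable def listLinks {ι α : Type*} (τ : ι → α) (flag : ι → Prop) (l : List ι) :
    Multiset (Sym2 α) :=
  (((adjacentPairs l).filter fun q => flag q.1).map fun q => s(τ q.1, τ q.2) : List (Sym2 α))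

variable {ι α : Type*} {τ : ι → α} {flag : ι → Prop}

lemma listLinks_cons_of_flag {a b : ι} {l : List ι} (h : flag a) :
    listLinks τ flag (a :: b :: l) = {s(τ a, τ b)} + listLinks τ flag (b :: l) := by
  rw [listLinks, adjacentPairs_cons_cons, List.filter_cons_of_pos (by simpa using h),
    List.map_cons, ← Multiset.cons_coe, Multiset.singleton_add]
  rfl

lemma listLinks_cons_of_not_flag {a b : ι} {l : List ι} (h : ¬ flag a) :
    listLinks τ flag (a :: b :: l) = listLinks τ flag (b :: l) := by
  rw [listLinks, adjacentPairs_cons_cons, List.filter_cons_of_neg (by simpa using h)]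
  rfl

lemma listLinks_singleton (a : ι) : listLinks τ flag [a] = 0 := rfl

lemma exists_mem_of_mem_listLinks {l : List ι} {e : Sym2 α} (he : e ∈ listLinks τ flag l) {v : α}
    (hv : v ∈ e) : ∃ x ∈ l, v = τ x := by
  rw [listLinks, Multiset.mem_coe, List.mem_map] at he
  obtain ⟨⟨x, y⟩, hxy, rfl⟩ := he
  obtain ⟨A, C, rfl⟩ := mem_adjacentPairs.mp (List.mem_filter.mp hxy).1
  rcases Sym2.mem_iff.mp hv with h | h
  · exact ⟨x, by simp, h⟩
  · exact ⟨y, by simp, h⟩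

open Classical in
/-- The vertices of the elements of a list that do not satisfy `keep`. -/
noncomputable def droppedVertices (τ : ι → α) (keep : ι → Prop) (l : List ι) : Finset α :=
  ((l.filter fun x => ¬ keep x).map τ).toFinset

open Classical in
-- The head `a` is a vertex that stays. A dropped vertex next to `a` is 2-valent, or a leaf at the
-- end of the list, and its removal links `a` to its successor, just as in the list without it. When
-- the next vertex is kept it becomes the new head, and the edge behind it joins `E`.
lemma eliminate_cons (keep : ι → Prop) (l : List ι) :
    ∀ (a : ι) (V : Finset α) (E : Multiset (Sym2 α)), ((a :: l).map τ).Nodup →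
      (∀ x ∈ l, ¬ keep x → flag x ∧ τ x ∈ V ∧ ∀ e ∈ E, τ x ∉ e) →
      (∀ x y, (x, y) ∈ adjacentPairs (a :: l) → ¬ keep y → flag x) →
      Relation.ReflTransGen MGraph.Step ⟨V, E + listLinks τ flag (a :: l)⟩
        ⟨V \ droppedVertices τ keep l,
          E + listLinks τ flag (a :: l.filter fun x => keep x)⟩ := by
  induction l with
  | nil =>
    intro a V E _ _ _
    simp only [droppedVertices, List.filter_nil, List.map_nil, List.toFinset_nil,
      Finset.sdiff_empty]
    exact .refl
  | cons b l ih =>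
    intro a V E hnd hd hf
    by_cases hb : keep b
    · have hdrop : droppedVertices τ keep (b :: l) = droppedVertices τ keep l := by
        simp [droppedVertices, hb]
      rw [List.filter_cons_of_pos (by simpa using hb), hdrop]
      have hf' : ∀ x y, (x, y) ∈ adjacentPairs (b :: l) → ¬ keep y → flag x := fun x y hxy =>
        hf x y (by rw [adjacentPairs_cons_cons]; exact List.mem_cons_of_mem _ hxy)
      have hnd' : ((b :: l).map τ).Nodup := by
        rw [List.map_cons] at hnd; exact hnd.of_cons
      by_cases ha : flag a
      · rw [listLinks_cons_of_flag ha, listLinks_cons_of_flag ha, ← add_assoc, ← add_assoc]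
        refine ih b V _ hnd' (fun x hx hkx => ?_) hf'
        obtain ⟨h1, h2, h3⟩ := hd x (by simp [hx]) hkx
        refine ⟨h1, h2, fun e he => ?_⟩
        rcases Multiset.mem_add.mp he with he | he
        · exact h3 e he
        · rw [Multiset.mem_singleton.mp he, Sym2.mem_iff]
          simp only [List.map_cons, List.nodup_cons, List.mem_cons, List.mem_map, not_or,
            not_exists, not_and] at hnd
          rintro (h | h)
          · exact hnd.1.2 x hx h
          · exact hnd.2.1 x hx h
      · rw [listLinks_cons_of_not_flag ha, listLinks_cons_of_not_flag ha]
        exact ih b V _ hnd' (fun x hx hkx => hd x (by simp [hx]) hkx) hf'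
    · have hdrop : droppedVertices τ keep (b :: l) = insert (τ b) (droppedVertices τ keep l) := by
        simp [droppedVertices, hb]
      rw [List.filter_cons_of_neg (by simpa using hb), hdrop]
      have ha : flag a := hf a b (by rw [adjacentPairs_cons_cons]; simp) hb
      obtain ⟨hfb, hbV, hbE⟩ := hd b (by simp) hb
      simp only [List.map_cons, List.nodup_cons, List.mem_cons, List.mem_map, not_or,
        not_exists, not_and] at hnd
      obtain ⟨⟨hab, hal⟩, hbl, hl⟩ := hnd
      have key : MGraph.Step ⟨V, E + listLinks τ flag (a :: b :: l)⟩
          ⟨V.erase (τ b), E + listLinks τ flag (a :: l)⟩ := by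
        cases l with
        | nil =>
          refine ⟨τ b, hbV, {s(τ b, τ a)}, 0, E, .leaf _ hab, ?_, hbE, ?_⟩
          · rw [listLinks_cons_of_flag ha, listLinks_singleton, Sym2.eq_swap]; simp [add_comm]
          · rw [listLinks_singleton]; simp
        | cons c l =>
          refine ⟨τ b, hbV, {s(τ b, τ a), s(τ b, τ c)}, {s(τ a, τ c)},
            E + listLinks τ flag (c :: l), .pass _ _ hab (hbl c (by simp)), ?_, ?_, ?_⟩
          · simp only
            rw [listLinks_cons_of_flag ha, listLinks_cons_of_flag hfb, Sym2.eq_swap,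
              Multiset.insert_eq_cons, ← Multiset.singleton_add]
            abel
          · intro e he
            rcases Multiset.mem_add.mp he with he | he
            · exact hbE e he
            · intro hbe
              obtain ⟨x, hx, hxb⟩ := exists_mem_of_mem_listLinks he hbe
              exact hbl x (by simpa using hx) hxb.symm
          · simp only
            rw [listLinks_cons_of_flag ha]
            congr 1
            abel
      refine Relation.ReflTransGen.head key ?_
      have hV : V \ insert (τ b) (droppedVertices τ keep l) =
          V.erase (τ b) \ droppedVertices τ keep l := by
        ext x; simp; tauto
      rw [hV]
      refine ih a _ E ?_ (fun x hx hkx => ?_) (fun x y hxy hky => ?_)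
      · simp only [List.map_cons, List.nodup_cons, List.mem_map, not_exists, not_and]
        exact ⟨hal, hl⟩
      · obtain ⟨h1, h2, h3⟩ := hd x (by simp [hx]) hkx
        exact ⟨h1, Finset.mem_erase.mpr ⟨hbl x hx, h2⟩, h3⟩
      · cases l with
        | nil => simp [adjacentPairs] at hxy
        | cons c l =>
          rw [adjacentPairs_cons_cons] at hxy
          rcases List.mem_cons.mp hxy with h | h
          · obtain ⟨rfl, rfl⟩ := Prod.mk.inj h
            exact ha
          · exact hf x y (by rw [adjacentPairs_cons_cons, adjacentPairs_cons_cons]; simp [h]) hky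

open Classical in
/-- The dropped elements of a list of consecutively linked vertices can be eliminated, provided
that some element is kept. -/
lemma eliminate (keep : ι → Prop) (l : List ι) (hkeep : l = [] ∨ ∃ x ∈ l, keep x) :
    ∀ (V : Finset α) (E : Multiset (Sym2 α)), (l.map τ).Nodup →
      (∀ x ∈ l, ¬ keep x → flag x ∧ τ x ∈ V ∧ ∀ e ∈ E, τ x ∉ e) →
      (∀ x y, (x, y) ∈ adjacentPairs l → ¬ keep y → flag x) →
      Relation.ReflTransGen MGraph.Step ⟨V, E + listLinks τ flag l⟩
        ⟨V \ droppedVertices τ keep l, E + listLinks τ flag (l.filter fun x => keep x)⟩ := by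
  induction l with
  | nil =>
    intro V E _ _ _
    simp only [droppedVertices, List.filter_nil, List.map_nil, List.toFinset_nil,
      Finset.sdiff_empty]
    exact .refl
  | cons b l ih =>
    intro V E hnd hd hf
    by_cases hb : keep b
    · have hdrop : droppedVertices τ keep (b :: l) = droppedVertices τ keep l := by
        simp [droppedVertices, hb]
      rw [List.filter_cons_of_pos (by simpa using hb), hdrop]
      exact eliminate_cons keep l b V E hnd (fun x hx => hd x (by simp [hx])) hf
    · have hdrop : droppedVertices τ keep (b :: l) = insert (τ b) (droppedVertices τ keep l) := by
        simp [droppedVertices, hb]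
      rw [List.filter_cons_of_neg (by simpa using hb), hdrop]
      obtain ⟨hfb, hbV, hbE⟩ := hd b (by simp) hb
      simp only [List.map_cons, List.nodup_cons, List.mem_map, not_exists, not_and] at hnd
      obtain ⟨hbl, hl⟩ := hnd
      cases l with
      | nil => simp [hb] at hkeep
      | cons c l =>
        have hV : V \ insert (τ b) (droppedVertices τ keep (c :: l)) =
            V.erase (τ b) \ droppedVertices τ keep (c :: l) := by
          ext x; simp; tauto
        rw [hV]
        have hk : ∃ x ∈ c :: l, keep x := by simpa [hb] using hkeep
        refine Relation.ReflTransGen.head ?_ (ih (Or.inr hk) _ _ hl (fun x hx hkx => ?_)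
          (fun x y hxy => hf x y (by rw [adjacentPairs_cons_cons]; simp [hxy])))
        -- Dropped vertices before the first kept one are removed as leaves, one after the other.
        · refine ⟨τ b, hbV, {s(τ b, τ c)}, 0, E + listLinks τ flag (c :: l),
            .leaf _ (hbl c (by simp)), ?_, ?_, ?_⟩
          · simp only
            rw [listLinks_cons_of_flag hfb]; abel
          · intro e he
            rcases Multiset.mem_add.mp he with he | he
            · exact hbE e he
            · intro hbe
              obtain ⟨x, hx, hxb⟩ := exists_mem_of_mem_listLinks he hbe
              exact hbl x hx hxb.symm
          · rw [zero_add]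
        · obtain ⟨h1, h2, h3⟩ := hd x (by simp at hx ⊢; tauto) hkx
          exact ⟨h1, Finset.mem_erase.mpr ⟨hbl x hx, h2⟩, h3⟩

end Elimination

/-! ### Removing the triangles based on the row y = 0 -/

section LowerReduction

variable {L : Set (ℤ × ℤ)} {T : Finset (Finset (ℤ × ℤ))}

/-- If the upper side is the single row `y = 2`, then a step of the upper side has its lower end
in the row `y = 1`. -/
lemma IsStep.row_of_not_isLower {s} (h : IsStep T s) (hs : ¬ IsLower s) (h1 : s.1.2.2 = 2)
    (h2 : s.2.2.2 = 2) : s.1.1.2 = 1 ∧ s.2.1.2 = 1 ∧ s.2.2.1 = s.1.2.1 + 1 := by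
  cases h with
  | lower => exact absurd rfl hs
  | upper l u u' g1 g2 g3 g4 g5 =>
    simp only at h1 h2 ⊢
    have e : (2 - l.2) * (u'.1 - u.1) = 1 := by
      simp only [latticeDet, h1, h2] at g5; linarith
    have hl : 2 - l.2 = 1 := by
      rcases Int.isUnit_iff.mp (IsUnit.of_mul_eq_one _ e) with h | h <;> omega
    rw [hl] at e
    omega

/-- `eliminate` needs a vertex to keep, since a path of dropped vertices would end in an isolated
vertex that no step removes. If all steps moved the upper end, those with the same lower end as `z`
would form a fan with apex in the row y = 1. No step continues the fan beyond its first or last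
edge, so the point in the row y = -1 is neither left of the first edge nor right of the last. Below
the apex, however, the lines through these edges have changed order. -/
lemma CombTriangulation.exists_isLower (hT : CombTriangulation L T) (hL : ∀ p ∈ L, p.2 ≤ 2)
    (hw : ∃ w ∈ L, w.2 = -1) {l} (hl : IsStepList T l) : l = [] ∨ ∃ s ∈ l, IsLower s := by
  classical
  by_contra! h
  obtain ⟨hne, hup⟩ := h
  obtain ⟨z, hz⟩ := List.exists_mem_of_ne_nil l hne
  have hS : ∀ s, IsStep T s → s.1.1 = s.2.1 ∧ s.1.1.2 = 1 ∧ s.1.2.2 = 2 ∧ s.2.2.2 = 2 ∧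
      s.2.2.1 = s.1.2.1 + 1 := by
    intro s hs
    have hm : ∀ x ∈ stepTriangle s, x ∈ L := hT.vertex_mem _ hs.stepTriangle_mem
    have h1 := hL s.1.2 (hm _ (by simp [stepTriangle]))
    have h2 := hL s.2.2 (hm _ (by simp [stepTriangle]))
    have hr := hs.rows
    have hlow := hup s ((hl.mem_iff s).mpr hs)
    obtain ⟨h3, h4, h5⟩ := hs.row_of_not_isLower hlow (by omega) (by omega)
    exact ⟨hs.fst_eq_of_not_isLower hlow, h3, by omega, by omega, h5⟩
  have hzs := (hl.mem_iff z).mp hz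
  set S := l.toFinset.filter fun s => s.1.1 = z.1.1 with hSdef
  have hSne : S.Nonempty := ⟨z, by simp [hSdef, hz]⟩
  obtain ⟨a, ha, hamax⟩ := S.exists_max_image (fun s => s.1.2.1) hSne
  obtain ⟨b, hb, hbmin⟩ := S.exists_min_image (fun s => s.1.2.1) hSne
  simp only [hSdef, Finset.mem_filter, List.mem_toFinset] at ha hb hamax hbmin
  obtain ⟨w, hw, hw1⟩ := hw
  have has := (hl.mem_iff a).mp ha.1
  have hbs := (hl.mem_iff b).mp hb.1
  obtain ⟨a1, a2, a3, a4, a5⟩ := hS a has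
  obtain ⟨b1, b2, b3, b4, b5⟩ := hS b hbs
  have e1 : 0 ≤ latticeDet a.2.1 a.2.2 w := by
    by_contra! hneg
    obtain ⟨c, hc, hca⟩ := hT.exists_next has hw hneg
    have := hamax c ⟨(hl.mem_iff c).mpr hc, by rw [hca, ← a1, ha.2]⟩
    rw [hca] at this
    omega
  have e2 : latticeDet b.1.1 b.1.2 w ≤ 0 := by
    by_contra! hpos
    obtain ⟨c, hc, hcb⟩ := hT.exists_prev hbs hw hpos
    obtain ⟨c1, c2, c3, c4, c5⟩ := hS c hc
    have := hbmin c ⟨(hl.mem_iff c).mpr hc, by rw [c1, hcb, hb.2]⟩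
    rw [hcb] at c5
    omega
  have hz2 := (hS z hzs).2.1
  have hab := hamax b hb
  rw [← a1, ha.2] at e1
  rw [hb.2] at e2
  simp only [latticeDet, hw1, hz2, a4, a5, b3] at e1 e2
  linarith

/-- The edges between triangles that share an edge between the rows `y = 0` and `y = 1`, in terms
of the reflected triangulation. -/
noncomputable def bottomLinks (l : List (((ℤ × ℤ) × (ℤ × ℤ)) × ((ℤ × ℤ) × (ℤ × ℤ)))) :
    Multiset (Sym2 (Finset (ℤ × ℤ))) :=
  listLinks (fun s => (stepTriangle s).map (reflect 2).toEmbedding) (fun s => s.2.1.2 = 1) l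

/-- The triangles with two vertices in the row `y = 0`, in terms of the reflected
triangulation. -/
noncomputable def bottomTriangles (l : List (((ℤ × ℤ) × (ℤ × ℤ)) × ((ℤ × ℤ) × (ℤ × ℤ)))) :
    Finset (Finset (ℤ × ℤ)) :=
  droppedVertices (fun s => (stepTriangle s).map (reflect 2).toEmbedding) IsLower l

lemma IsStepList.map_stepTriangle_nodup {l} (hl : IsStepList T l) :
    (l.map fun s => (stepTriangle s).map (reflect 2).toEmbedding).Nodup := by
  refine List.Nodup.map_on (fun s hs s' hs' h => ?_) hl.nodup
  exact ((hl.mem_iff s).mp hs).ext ((hl.mem_iff s').mp hs') (Finset.map_injective _ h)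

open Classical in
-- After reflection the triangles based on y = 0 are the steps of the upper side. Their apex is in
-- the row y = 1, so the edges before and after them carry the flag and `eliminate` applies. The
-- surviving links are those of `lowerLinks_perm`.
lemma CombTriangulation.lower_reduction (hT : CombTriangulation L T) (hL : ∀ p ∈ L, 0 ≤ p.2)
    (hL0 : ∃ w ∈ L, w.2 < 1) (hL3 : ∃ w ∈ L, w.2 = 3) {l b} (hl : IsStepList T l)
    (hb : IsStepList (mapTriangulation (reflect 2) T) b) (V : Finset (Finset (ℤ × ℤ)))
    (E : Multiset (Sym2 (Finset (ℤ × ℤ))))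
    (hE : ∀ t ∈ bottomTriangles b, t ∈ V ∧ ∀ e ∈ E, t ∉ e) :
    Relation.ReflTransGen MGraph.Step ⟨V, E + bottomLinks b⟩
      ⟨V \ bottomTriangles b, E + (lowerLinks T l : Multiset (Sym2 (Finset (ℤ × ℤ))))⟩ := by
  have hT' := hT.map (isLatticeIso_reflect 2)
  have hL' : ∀ p ∈ reflect 2 '' L, p.2 ≤ 2 := by
    rintro _ ⟨p, hp, rfl⟩
    have := hL p hp
    rw [reflect_apply]
    simp only
    omega
  have hrow : ∀ s, IsStep (mapTriangulation (reflect 2) T) s → s.1.2.2 = 2 ∧ s.2.2.2 = 2 := by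
    intro s hs
    have hm : ∀ x ∈ stepTriangle s, x ∈ reflect 2 '' L := hT'.vertex_mem _ hs.stepTriangle_mem
    have h1 := hL' s.1.2 (hm _ (by simp [stepTriangle]))
    have h2 := hL' s.2.2 (hm _ (by simp [stepTriangle]))
    have hr := hs.rows
    omega
  have hw : ∃ w ∈ reflect 2 '' L, w.2 = -1 := by
    obtain ⟨w, hw, h⟩ := hL3
    exact ⟨_, ⟨w, hw, rfl⟩, by rw [reflect_apply]; simp only; omega⟩
  have key := eliminate (τ := fun s => (stepTriangle s).map (reflect 2).toEmbedding)
    (flag := fun s => s.2.1.2 = 1) IsLower b (hT'.exists_isLower hL' hw hb) V E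
    hb.map_stepTriangle_nodup (fun x hx hkx => ?_) (fun x y hxy hky => ?_)
  · have hperm := hT.lowerLinks_perm hL0 (hL3.imp fun w h => ⟨h.1, by omega⟩) hl hb
    have : listLinks (fun s => (stepTriangle s).map (reflect 2).toEmbedding)
        (fun s => s.2.1.2 = 1) (b.filter fun x => IsLower x) =
        (lowerLinks T l : Multiset (Sym2 (Finset (ℤ × ℤ)))) := by
      rw [Multiset.coe_eq_coe.mpr hperm, listLinks, lowerPairs]
      congr!
    unfold bottomLinks bottomTriangles
    rw [← this]
    convert key
  · have hs := (hb.mem_iff x).mp hx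
    refine ⟨(hs.row_of_not_isLower hkx (hrow x hs).1 (hrow x hs).2).2.1, hE _ ?_⟩
    simp only [bottomTriangles, droppedVertices, List.mem_toFinset, List.mem_map, List.mem_filter]
    exact ⟨x, ⟨hx, by simpa using hkx⟩, rfl⟩
  · obtain ⟨-, h2, h3⟩ := (hb.adjacent_iff x y).mp hxy
    rw [h3]
    exact (h2.row_of_not_isLower hky (hrow y h2).1 (hrow y h2).2).1

end LowerReduction


/-! ### The dual graph -/

section DualGraph

variable {L : Set (ℤ × ℤ)} {T : Finset (Finset (ℤ × ℤ))}
  {l b c : List (((ℤ × ℤ) × (ℤ × ℤ)) × ((ℤ × ℤ) × (ℤ × ℤ)))}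
  {s : ((ℤ × ℤ) × (ℤ × ℤ)) × ((ℤ × ℤ) × (ℤ × ℤ))}

open Classical in
/-- The edges of the dual graph. -/
noncomputable def dualEdges (T : Finset (Finset (ℤ × ℤ))) : Finset (Sym2 (Finset (ℤ × ℤ))) :=
  T.sym2.filter fun e => ∃ s t : Finset (ℤ × ℤ), e = s(s, t) ∧ s ≠ t ∧ (s ∩ t).card = 2

open Classical in
lemma mk_mem_dualEdges {s t : Finset (ℤ × ℤ)} :
    s(s, t) ∈ dualEdges T ↔ s ∈ T ∧ t ∈ T ∧ s ≠ t ∧ (s ∩ t).card = 2 := by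
  rw [dualEdges, Finset.mem_filter, Finset.mk_mem_sym2_iff]
  constructor
  · rintro ⟨⟨h1, h2⟩, s', t', he, h3, h4⟩
    rcases Sym2.eq_iff.mp he with ⟨rfl, rfl⟩ | ⟨rfl, rfl⟩
    · exact ⟨h1, h2, h3, h4⟩
    · exact ⟨h1, h2, h3.symm, by rwa [Finset.inter_comm]⟩
  · rintro ⟨h1, h2, h3, h4⟩
    exact ⟨⟨h1, h2⟩, s, t, rfl, h3, h4⟩

lemma models_dualGraph (T : Finset (Finset (ℤ × ℤ))) :
    MGraph.Models (dualGraph T) ⟨T, (dualEdges T).val⟩ := by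
  refine ⟨fun v => Iff.rfl, dualEdges T, id, fun f x y => ?_, by simp⟩
  constructor
  · rintro ⟨h1, h2, h3, h4, rfl⟩
    exact ⟨mk_mem_dualEdges.mpr ⟨h1, h2, h3, h4⟩, rfl⟩
  · rintro ⟨h1, rfl : f = s(x, y)⟩
    obtain ⟨h1, h2, h3, h4⟩ := mk_mem_dualEdges.mp h1
    exact ⟨h1, h2, h3, h4, rfl⟩

/-- The two triangles of `e` have the vertices `p` and `q` in common. -/
def Shares (e : Sym2 (Finset (ℤ × ℤ))) (p q : ℤ × ℤ) : Prop := ∀ t ∈ e, p ∈ t ∧ q ∈ t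

lemma shares_mk {t t' : Finset (ℤ × ℤ)} {p q : ℤ × ℤ} :
    Shares s(t, t') p q ↔ (p ∈ t ∧ q ∈ t) ∧ p ∈ t' ∧ q ∈ t' := by
  simp [Shares]

lemma CombTriangulation.mk_mem_dualEdges_of_share (hT : CombTriangulation L T)
    {t t' : Finset (ℤ × ℤ)} (ht : t ∈ T) (ht' : t' ∈ T) (hne : t ≠ t') {p q : ℤ × ℤ} (hpq : p ≠ q)
    (hs : Shares s(t, t') p q) : s(t, t') ∈ dualEdges T := by
  rw [shares_mk] at hs
  refine mk_mem_dualEdges.mpr ⟨ht, ht', hne, le_antisymm ?_ ?_⟩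
  · by_contra! hlt
    have h1 := (hT.unimodular t ht).card
    have h2 := (hT.unimodular t' ht').card
    have h3 : t ∩ t' = t := Finset.eq_of_subset_of_card_le Finset.inter_subset_left (by omega)
    have h4 : t ∩ t' = t' := Finset.eq_of_subset_of_card_le Finset.inter_subset_right (by omega)
    exact hne (h3.symm.trans h4)
  · rw [← Finset.card_pair hpq]
    refine Finset.card_le_card fun x hx => ?_
    simp only [Finset.mem_insert, Finset.mem_singleton] at hx
    rcases hx with rfl | rfl <;> simp [hs]

/-- The common edge is unique up to the order of its ends, so dual edges can be classified by the
rows of these ends. -/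
lemma exists_shares {e : Sym2 (Finset (ℤ × ℤ))} (he : e ∈ dualEdges T) :
    ∃ p q, p ≠ q ∧ Shares e p q ∧ ∀ p' q', p' ≠ q' → Shares e p' q' →
      (p' = p ∧ q' = q) ∨ (p' = q ∧ q' = p) := by
  induction e with
  | h t t' =>
    obtain ⟨-, -, -, h4⟩ := mk_mem_dualEdges.mp he
    obtain ⟨p, q, hpq, h⟩ := Finset.card_eq_two.mp h4
    have hmem : ∀ x, (x ∈ t ∧ x ∈ t') ↔ x = p ∨ x = q := by
      intro x; rw [← Finset.mem_inter, h]; simp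
    refine ⟨p, q, hpq, shares_mk.mpr ?_, fun p' q' hne hs => ?_⟩
    · have h1 := (hmem p).mpr (Or.inl rfl)
      have h2 := (hmem q).mpr (Or.inr rfl)
      tauto
    · rw [shares_mk] at hs
      have h1 := (hmem p').mp ⟨hs.1.1, hs.2.1⟩
      have h2 := (hmem q').mp ⟨hs.1.2, hs.2.2⟩
      rcases h1 with rfl | rfl <;> rcases h2 with rfl | rfl <;> simp_all

/-- The reflection `(x, y) ↦ (x, 3 - y)` on sets of lattice points. -/
def flipSet : Equiv.Perm (Finset (ℤ × ℤ)) where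
  toFun t := t.map (reflect 3).toEmbedding
  invFun t := t.map (reflect 3).toEmbedding
  left_inv t := map_reflect_reflect 3 t
  right_inv t := map_reflect_reflect 3 t

lemma flipSet_apply (t : Finset (ℤ × ℤ)) : flipSet t = t.map (reflect 3).toEmbedding := rfl

lemma flipSet_flipSet (t : Finset (ℤ × ℤ)) : flipSet (flipSet t) = t := map_reflect_reflect 3 t

lemma mem_flipSet {t : Finset (ℤ × ℤ)} {p : ℤ × ℤ} : p ∈ flipSet t ↔ reflect 3 p ∈ t := by
  rw [flipSet_apply, Finset.mem_map_equiv]; rfl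

lemma map_flipSet_flipSet (e : Sym2 (Finset (ℤ × ℤ))) :
    Sym2.map flipSet (Sym2.map flipSet e) = e := by
  induction e with
  | h t t' => simp [flipSet_flipSet]

/-- The reflected triangulation. -/
def flipTriangulation (T : Finset (Finset (ℤ × ℤ))) : Finset (Finset (ℤ × ℤ)) :=
  mapTriangulation (reflect 3) T

lemma flipSet_mem_flipTriangulation {t : Finset (ℤ × ℤ)} :
    flipSet t ∈ flipTriangulation T ↔ t ∈ T := mem_mapTriangulation

lemma map_mem_dualEdges {e : Sym2 (Finset (ℤ × ℤ))} :
    Sym2.map flipSet e ∈ dualEdges (flipTriangulation T) ↔ e ∈ dualEdges T := by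
  induction e with
  | h t t' =>
    rw [Sym2.map_mk, mk_mem_dualEdges, mk_mem_dualEdges, flipSet_mem_flipTriangulation,
      flipSet_mem_flipTriangulation, flipSet.injective.ne_iff, flipSet_apply, flipSet_apply,
      ← Finset.map_inter, Finset.card_map]

/-- The reflected step. -/
def flipStep (s : ((ℤ × ℤ) × (ℤ × ℤ)) × ((ℤ × ℤ) × (ℤ × ℤ))) :
    ((ℤ × ℤ) × (ℤ × ℤ)) × ((ℤ × ℤ) × (ℤ × ℤ)) :=
  ((reflect 3 s.1.2, reflect 3 s.1.1), (reflect 3 s.2.2, reflect 3 s.2.1))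

lemma flipStep_flipStep (s : ((ℤ × ℤ) × (ℤ × ℤ)) × ((ℤ × ℤ) × (ℤ × ℤ))) :
    flipStep (flipStep s) = s := by
  simp [flipStep, reflect_reflect]

lemma IsStep.flip (h : IsStep T s) : IsStep (flipTriangulation T) (flipStep s) := by
  cases h with
  | lower l u l' h1 h2 h3 h4 h5 =>
    refine .upper _ _ _ ?_ ?_ ?_ ?_ ?_
    · rw [reflect_apply]; simp only; omega
    · rw [reflect_apply]; simp only; omega
    · rw [reflect_apply]; simp only; omega
    · rw [flipTriangulation, triple_mem_mapTriangulation, triple_swap']; exact h4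
    · rw [(isLatticeIso_reflect 3).latticeDet, latticeDet_swap', h5]; norm_num
  | upper l u u' h1 h2 h3 h4 h5 =>
    refine .lower _ _ _ ?_ ?_ ?_ ?_ ?_
    · rw [reflect_apply]; simp only; omega
    · rw [reflect_apply]; simp only; omega
    · rw [reflect_apply]; simp only; omega
    · rw [flipTriangulation, triple_mem_mapTriangulation, triple_swap']; exact h4
    · rw [(isLatticeIso_reflect 3).latticeDet, latticeDet_swap', h5]; norm_num

lemma flipTriangulation_flipTriangulation (T : Finset (Finset (ℤ × ℤ))) :
    flipTriangulation (flipTriangulation T) = T := mapTriangulation_reflect_reflect 3 T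

lemma isStep_flipStep : IsStep (flipTriangulation T) (flipStep s) ↔ IsStep T s := by
  refine ⟨fun h => ?_, IsStep.flip⟩
  have := h.flip
  rwa [flipTriangulation_flipTriangulation, flipStep_flipStep] at this

lemma stepTriangle_flipStep : stepTriangle (flipStep s) = flipSet (stepTriangle s) := by
  ext x
  simp only [stepTriangle, flipStep, mem_flipSet, Finset.mem_insert, Finset.mem_singleton]
  have : ∀ y, x = reflect 3 y ↔ reflect 3 x = y := fun y =>
    ⟨fun h => by rw [h, reflect_reflect], fun h => by rw [← h, reflect_reflect]⟩
  simp only [this]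
  tauto

lemma IsStepList.flip (hl : IsStepList T l) :
    IsStepList (flipTriangulation T) (l.map flipStep) := by
  have hinj : Function.Injective flipStep :=
    Function.LeftInverse.injective (g := flipStep) flipStep_flipStep
  refine ⟨fun s => ?_, hl.nodup.map hinj, fun s s' => ?_⟩
  · rw [← flipStep_flipStep s, List.mem_map_of_injective hinj, hl.mem_iff, isStep_flipStep]
  · rw [adjacentPairs_map, ← flipStep_flipStep s, ← flipStep_flipStep s',
      show (flipStep (flipStep s), flipStep (flipStep s')) =
        Prod.map flipStep flipStep (flipStep s, flipStep s') from rfl,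
      List.mem_map_of_injective (hinj.prodMap hinj), hl.adjacent_iff, isStep_flipStep,
      isStep_flipStep]
    have : (flipStep (flipStep s)).2 = (flipStep (flipStep s')).1 ↔
        (flipStep s).2 = (flipStep s').1 := by
      generalize flipStep s = a
      generalize flipStep s' = b
      simp only [flipStep, Prod.mk.injEq, (reflect 3).injective.eq_iff, Prod.ext_iff (x := a.2)]
      tauto
    rw [this]

lemma IsStep.isLower_flipStep (h : IsStep T s) : IsLower (flipStep s) ↔ ¬ IsLower s := by
  have : IsLower (flipStep s) ↔ s.1.1 = s.2.1 := by
    simp [IsLower, flipStep, (reflect 3).injective.eq_iff]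
  rw [this]
  exact ⟨fun h1 h2 => h.fst_ne h2 h1, fun h1 => h.fst_eq_of_not_isLower h1⟩

/-- The edges of the dual graph between consecutive triangles along the line `y = 3 / 2`. -/
def middleLinks (l : List (((ℤ × ℤ) × (ℤ × ℤ)) × ((ℤ × ℤ) × (ℤ × ℤ)))) :
    Multiset (Sym2 (Finset (ℤ × ℤ))) :=
  ((adjacentPairs l).map fun q => s(stepTriangle q.1, stepTriangle q.2) : List _)

/-- The edges of the dual graph across the horizontal edges in the row `y = 1`. -/
noncomputable def flatLinks (T : Finset (Finset (ℤ × ℤ)))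
    (l : List (((ℤ × ℤ) × (ℤ × ℤ)) × ((ℤ × ℤ) × (ℤ × ℤ)))) :
    Multiset (Sym2 (Finset (ℤ × ℤ))) :=
  ((l.filter fun s => IsLower s ∧ IsFlat s).map fun s =>
    s(stepTriangle s, belowTriangle T s) : List _)

/-- The common edge crosses the line `y = 3 / 2`. -/
def SharesMiddle (e : Sym2 (Finset (ℤ × ℤ))) : Prop :=
  ∃ p q : ℤ × ℤ, p ≠ q ∧ Shares e p q ∧ p.2 ≤ 1 ∧ 2 ≤ q.2

/-- The common edge joins the rows `y = 0` and `y = 1`. -/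
def SharesBottom (e : Sym2 (Finset (ℤ × ℤ))) : Prop :=
  ∃ p q : ℤ × ℤ, p ≠ q ∧ Shares e p q ∧ p.2 ≤ 0 ∧ q.2 = 1

/-- The common edge lies in the row `y = 1`. -/
def SharesFlat (e : Sym2 (Finset (ℤ × ℤ))) : Prop :=
  ∃ p q : ℤ × ℤ, p ≠ q ∧ Shares e p q ∧ p.2 = 1 ∧ q.2 = 1

/-- Two steps cannot be consecutive in both orders, because the crossings increase along the list.
-/
lemma adjacent_stepTriangle_injOn (hl : IsStepList T l) {q q'} (hq : q ∈ adjacentPairs l)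
    (hq' : q' ∈ adjacentPairs l)
    (h : s(stepTriangle q.1, stepTriangle q.2) = s(stepTriangle q'.1, stepTriangle q'.2)) :
    q = q' := by
  obtain ⟨s, s'⟩ := q
  obtain ⟨t, t'⟩ := q'
  obtain ⟨a1, a2, a3⟩ := (hl.adjacent_iff s s').mp hq
  obtain ⟨b1, b2, b3⟩ := (hl.adjacent_iff t t').mp hq'
  rcases Sym2.eq_iff.mp h with ⟨h1, h2⟩ | ⟨h1, h2⟩
  · rw [a1.ext b1 h1, a2.ext b2 h2]
  · obtain rfl := a1.ext b2 h1
    obtain rfl := a2.ext b1 h2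
    have e1 := a1.crossing_lt
    have e2 := a2.crossing_lt
    rw [a3] at e1
    rw [b3] at e2
    exact absurd e1 (not_lt.mpr e2.le)

lemma IsStepList.middleLinks_nodup (hl : IsStepList T l) : (middleLinks l).Nodup := by
  rw [middleLinks, Multiset.coe_nodup]
  exact List.Nodup.map_on (fun q hq q' hq' h => adjacent_stepTriangle_injOn hl hq hq' h)
    (adjacentPairs_nodup hl.nodup)

lemma IsStepList.adjacent_ne (hl : IsStepList T l) {s s'} (h : (s, s') ∈ adjacentPairs l) :
    stepTriangle s ≠ stepTriangle s' := by
  obtain ⟨a1, a2, a3⟩ := (hl.adjacent_iff s s').mp h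
  intro he
  obtain rfl := a1.ext a2 he
  have := a1.crossing_lt
  rw [a3] at this
  exact lt_irrefl _ this

lemma CombTriangulation.mem_middleLinks (hT : CombTriangulation L T) (hl : IsStepList T l)
    {e : Sym2 (Finset (ℤ × ℤ))} : e ∈ middleLinks l ↔ e ∈ dualEdges T ∧ SharesMiddle e := by
  rw [middleLinks, Multiset.mem_coe, List.mem_map]
  constructor
  · rintro ⟨⟨s, s'⟩, hq, rfl⟩
    obtain ⟨a1, a2, a3⟩ := (hl.adjacent_iff s s').mp hq
    have hr := a1.rows
    have hne : s.2.1 ≠ s.2.2 := fun h => by have := congrArg Prod.snd h; omega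
    have hs : Shares s(stepTriangle s, stepTriangle s') s.2.1 s.2.2 := by
      rw [shares_mk]
      simp only [stepTriangle, ← a3]
      simp
    exact ⟨hT.mk_mem_dualEdges_of_share a1.stepTriangle_mem a2.stepTriangle_mem
      (hl.adjacent_ne hq) hne hs, s.2.1, s.2.2, hne, hs, hr.2.2.1, hr.2.2.2⟩
  · rintro ⟨he, p, q, hpq, hs, hp, hq⟩
    induction e with
    | h t t' =>
      obtain ⟨h1, h2, h3, -⟩ := mk_mem_dualEdges.mp he
      rw [shares_mk] at hs
      obtain ⟨s, s', a1, a2, a3, a4, a5⟩ := hT.exists_steps h1 h2 h3 hs.1.1 hs.1.2 hs.2.1 hs.2.2 hp hq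
      exact ⟨(s, s'), (hl.adjacent_iff s s').mpr ⟨a1, a2, a3.trans a4.symm⟩, a5.symm⟩

lemma mem_map_reflect {t : Finset (ℤ × ℤ)} {p : ℤ × ℤ} (k : ℤ) :
    p ∈ t.map (reflect k).toEmbedding ↔ reflect k p ∈ t := by
  rw [Finset.mem_map_equiv]; rfl

lemma IsStepList.bottomLinks_nodup (hb : IsStepList (mapTriangulation (reflect 2) T) b) :
    (bottomLinks b).Nodup := by
  rw [bottomLinks, listLinks, Multiset.coe_nodup]
  refine List.Nodup.map_on (fun q hq q' hq' h => ?_) ((adjacentPairs_nodup hb.nodup).filter _)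
  refine adjacent_stepTriangle_injOn hb (List.mem_filter.mp hq).1 (List.mem_filter.mp hq').1 ?_
  have := congrArg (Sym2.map fun t : Finset (ℤ × ℤ) => t.map (reflect 2).toEmbedding) h
  simpa only [Sym2.map_mk, map_reflect_reflect] using this

lemma CombTriangulation.mem_bottomLinks (hT : CombTriangulation L T)
    (hb : IsStepList (mapTriangulation (reflect 2) T) b)
    {e : Sym2 (Finset (ℤ × ℤ))} : e ∈ bottomLinks b ↔ e ∈ dualEdges T ∧ SharesBottom e := by
  have hT' := hT.map (isLatticeIso_reflect 2)
  have hmem : ∀ t : Finset (ℤ × ℤ), t.map (reflect 2).toEmbedding ∈ T ↔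
      t ∈ mapTriangulation (reflect 2) T := by
    intro t
    rw [← mem_mapTriangulation (φ := reflect 2), map_reflect_reflect]
  rw [bottomLinks, listLinks, Multiset.mem_coe, List.mem_map]
  constructor
  · rintro ⟨⟨s, s'⟩, hq, rfl⟩
    rw [List.mem_filter] at hq
    obtain ⟨hq, hflag⟩ := hq
    have hflag : s.2.1.2 = 1 := by simpa using hflag
    obtain ⟨a1, a2, a3⟩ := (hb.adjacent_iff s s').mp hq
    have hr := a1.rows
    have hne : s.2.2 ≠ s.2.1 := fun h => by have := congrArg Prod.snd h; omega
    have hne' : reflect 2 s.2.2 ≠ reflect 2 s.2.1 := (reflect 2).injective.ne hne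
    have hs : Shares s((stepTriangle s).map (reflect 2).toEmbedding,
        (stepTriangle s').map (reflect 2).toEmbedding) (reflect 2 s.2.2) (reflect 2 s.2.1) := by
      rw [shares_mk]
      simp only [mem_map_reflect, reflect_reflect, stepTriangle, ← a3]
      simp
    refine ⟨hT.mk_mem_dualEdges_of_share ((hmem _).mpr a1.stepTriangle_mem)
      ((hmem _).mpr a2.stepTriangle_mem)
      (fun h => hb.adjacent_ne hq (Finset.map_injective _ h)) hne' hs, _, _, hne', hs, ?_, ?_⟩
    · rw [reflect_apply]; simp only; omega
    · rw [reflect_apply]; simp only; omega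
  · rintro ⟨he, p, q, hpq, hs, hp, hq⟩
    induction e with
    | h t t' =>
      obtain ⟨h1, h2, h3, -⟩ := mk_mem_dualEdges.mp he
      rw [shares_mk] at hs
      have hin : ∀ {x : ℤ × ℤ} {t : Finset (ℤ × ℤ)}, x ∈ t →
          reflect 2 x ∈ t.map (reflect 2).toEmbedding := fun h => by
        rwa [mem_map_reflect, reflect_reflect]
      obtain ⟨s, s', a1, a2, a3, a4, a5⟩ := hT'.exists_steps (mem_mapTriangulation.mpr h1)
        (mem_mapTriangulation.mpr h2) (fun h => h3 (Finset.map_injective _ h)) (hin hs.1.2)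
        (hin hs.1.1) (hin hs.2.2) (hin hs.2.1) (by rw [reflect_apply]; simp only; omega)
        (by rw [reflect_apply]; simp only; omega)
      refine ⟨(s, s'), List.mem_filter.mpr ⟨(hb.adjacent_iff s s').mpr
        ⟨a1, a2, a3.trans a4.symm⟩, ?_⟩, ?_⟩
      · rw [a3, reflect_apply]; simp only [decide_eq_true_eq]; omega
      · have := congrArg (Sym2.map fun t : Finset (ℤ × ℤ) => t.map (reflect 2).toEmbedding) a5
        simpa only [Sym2.map_mk, map_reflect_reflect] using this.symm

lemma CombTriangulation.exists_flat_step (hT : CombTriangulation L T) {p q r : ℤ × ℤ}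
    (h : {p, q, r} ∈ T) (hp : p.2 = 1) (hq : q.2 = 1) (hr : 2 ≤ r.2) :
    ∃ s, IsStep T s ∧ IsLower s ∧ IsFlat s ∧ stepTriangle s = {p, q, r} ∧
      (s.1.1 = p ∨ s.1.1 = q) ∧ (s.2.1 = p ∨ s.2.1 = q) := by
  obtain ⟨s, hs, hst⟩ := hT.exists_step h (l := p) (u := r) (by simp) (by simp) (by omega) hr
  have hm : ∀ x ∈ stepTriangle s, x = p ∨ x = q ∨ x = r := by rw [hst]; simp
  have hrow := hs.rows
  have e1 := hm s.1.1 (by simp [stepTriangle])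
  have e2 := hm s.1.2 (by simp [stepTriangle])
  have e3 := hm s.2.1 (by simp [stepTriangle])
  have e4 := hm s.2.2 (by simp [stepTriangle])
  have f1 : s.1.1 = p ∨ s.1.1 = q := by
    rcases e1 with h | h | h
    exacts [Or.inl h, Or.inr h, by rw [h] at hrow; omega]
  have f3 : s.2.1 = p ∨ s.2.1 = q := by
    rcases e3 with h | h | h
    exacts [Or.inl h, Or.inr h, by rw [h] at hrow; omega]
  have f2 : s.1.2 = r := by
    rcases e2 with h | h | h
    exacts [by rw [h] at hrow; omega, by rw [h] at hrow; omega, h]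
  have f4 : s.2.2 = r := by
    rcases e4 with h | h | h
    exacts [by rw [h] at hrow; omega, by rw [h] at hrow; omega, h]
  refine ⟨s, hs, f2.trans f4.symm, ⟨?_, ?_⟩, hst, f1, f3⟩
  · rcases f1 with h | h <;> rw [h] <;> assumption
  · rcases f3 with h | h <;> rw [h] <;> assumption

lemma latticeDet_flat {p q : ℤ × ℤ} (hp : p.2 = 1) (hq : q.2 = 1) (r : ℤ × ℤ) :
    latticeDet p q r = (q.1 - p.1) * (r.2 - 1) := by
  simp only [latticeDet, hp, hq]; ring

/-- Two triangles on a common edge in the row y = 1 have opposite determinants, so one of them lies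
above the row and is the triangle of a flat step; the other one is then the triangle below it. -/
lemma CombTriangulation.mem_flatLinks (hT : CombTriangulation L T) (hl : IsStepList T l)
    (hL0 : ∃ w ∈ L, w.2 < 1) {e : Sym2 (Finset (ℤ × ℤ))} :
    e ∈ flatLinks T l ↔ e ∈ dualEdges T ∧ SharesFlat e := by
  rw [flatLinks, Multiset.mem_coe, List.mem_map]
  constructor
  · rintro ⟨s, hs, rfl⟩
    rw [List.mem_filter, decide_eq_true_eq] at hs
    obtain ⟨hsl, hlow, hf⟩ := hs
    have hs := (hl.mem_iff s).mp hsl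
    obtain ⟨x, h1, h2, h3, h4⟩ := hT.exists_below hL0 hs hlow hf
    have hsh : Shares s(stepTriangle s, belowTriangle T s) s.1.1 s.2.1 := by
      rw [shares_mk, h4]; simp [stepTriangle]
    refine ⟨hT.mk_mem_dualEdges_of_share hs.stepTriangle_mem (h4 ▸ h2) (fun he => ?_)
      (hs.fst_ne hlow) hsh, s.1.1, s.2.1, hs.fst_ne hlow, hsh, hf.1, hf.2⟩
    have : s.1.2 ∈ belowTriangle T s := by rw [← he]; simp [stepTriangle]
    rw [h4] at this
    simp only [Finset.mem_insert, Finset.mem_singleton] at this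
    have hr := hs.rows
    rcases this with h | h | h <;> rw [h] at hr <;> omega
  · rintro ⟨he, p, q, hpq, hs, hp, hq⟩
    induction e with
    | h t t' =>
      obtain ⟨h1, h2, h3, -⟩ := mk_mem_dualEdges.mp he
      rw [shares_mk] at hs
      obtain ⟨r, rfl⟩ := (hT.unimodular t h1).exists_third hs.1.1 hs.1.2 hpq
      obtain ⟨r', rfl⟩ := (hT.unimodular t' h2).exists_third hs.2.1 hs.2.2 hpq
      have hdd : latticeDet p q r ≠ latticeDet p q r' := fun h => h3 (by
        rw [hT.unique_third h1 h2 h])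
      have main : ∀ r r' : ℤ × ℤ, {p, q, r} ∈ T → {p, q, r'} ∈ T →
          ({p, q, r} : Finset (ℤ × ℤ)) ≠ {p, q, r'} → 2 ≤ r.2 →
          ∃ a ∈ l.filter (fun s => IsLower s ∧ IsFlat s),
            s(stepTriangle a, belowTriangle T a) = s({p, q, r}, {p, q, r'}) := by
        intro r r' h1 h2 h3 hr
        obtain ⟨s, a1, a2, a3, a4, a5, a6⟩ := hT.exists_flat_step h1 hp hq hr
        refine ⟨s, List.mem_filter.mpr ⟨(hl.mem_iff s).mpr a1, by simpa using ⟨a2, a3⟩⟩, ?_⟩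
        rw [hT.belowTriangle_eq a1 a2 a3 h2 (by rw [a4]; exact h3.symm)
          (by rcases a5 with h | h <;> rw [h] <;> simp)
          (by rcases a6 with h | h <;> rw [h] <;> simp), a4]
      have d1 := hT.abs_det h1
      have d2 := hT.abs_det h2
      rw [latticeDet_flat hp hq] at d1 d2
      rw [latticeDet_flat hp hq, latticeDet_flat hp hq] at hdd
      by_cases hr : 2 ≤ r.2
      · exact main r r' h1 h2 h3 hr
      · have hr1 : r.2 ≠ 1 := by rintro h; rw [h] at d1; simp at d1
        have hr' : 2 ≤ r'.2 := by
          by_contra hr'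
          have hr1' : r'.2 ≠ 1 := by rintro h; rw [h] at d2; simp at d2
          have e1 : r.2 - 1 < 0 := by omega
          have e2 : r'.2 - 1 < 0 := by omega
          have := mul_pos_of_neg_of_neg e1 e2
          rcases lt_trichotomy (q.1 - p.1) 0 with h | h | h
          · have g1 := mul_pos_of_neg_of_neg h e1
            have g2 := mul_pos_of_neg_of_neg h e2
            omega
          · rw [h] at d1; simp at d1
          · have g1 := mul_neg_of_pos_of_neg h e1
            have g2 := mul_neg_of_pos_of_neg h e2
            omega
        obtain ⟨a, ha, h⟩ := main r' r h2 h1 h3.symm hr'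
        exact ⟨a, ha, h.trans Sym2.eq_swap⟩

lemma IsStepList.flatLinks_nodup (hT : CombTriangulation L T) (hl : IsStepList T l)
    (hL0 : ∃ w ∈ L, w.2 < 1) : (flatLinks T l).Nodup := by
  rw [flatLinks, Multiset.coe_nodup]
  refine List.Nodup.map_on (fun s hs s' hs' h => ?_) (hl.nodup.filter _)
  rw [List.mem_filter, decide_eq_true_eq] at hs hs'
  have a := (hl.mem_iff s).mp hs.1
  have a' := (hl.mem_iff s').mp hs'.1
  rcases Sym2.eq_iff.mp h with ⟨h1, -⟩ | ⟨h1, -⟩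
  · exact a.ext a' h1
  · exfalso
    obtain ⟨x, g1, -, -, g4⟩ := hT.exists_below hL0 a' hs'.2.1 hs'.2.2
    have : s.1.2 ∈ belowTriangle T s' := by rw [← h1]; simp [stepTriangle]
    rw [g4] at this
    simp only [Finset.mem_insert, Finset.mem_singleton] at this
    have hr := a.rows
    have hr' := a'.rows
    rcases this with h | h | h <;> rw [h] at hr <;> omega

/-- The decomposition of the edges of the dual graph by the position of the dual edge. -/
lemma CombTriangulation.dualEdges_eq (hT : CombTriangulation L T)
    (hL : ∀ p ∈ L, 0 ≤ p.2 ∧ p.2 ≤ 3) (hL0 : ∃ w ∈ L, w.2 = 0) (hL3 : ∃ w ∈ L, w.2 = 3)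
    (hl : IsStepList T l) (hb : IsStepList (mapTriangulation (reflect 2) T) b)
    (hc : IsStepList (mapTriangulation (reflect 2) (flipTriangulation T)) c) :
    (dualEdges T).val = middleLinks l + flatLinks T l +
      (flatLinks (flipTriangulation T) (l.map flipStep)).map (Sym2.map flipSet) +
      bottomLinks b + (bottomLinks c).map (Sym2.map flipSet) := by
  classical
  have hT3 : CombTriangulation (reflect 3 '' L) (flipTriangulation T) :=
    hT.map (isLatticeIso_reflect 3)
  have hL0' : ∃ w ∈ L, w.2 < 1 := hL0.imp fun w h => ⟨h.1, by omega⟩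
  have hL0'' : ∃ w ∈ reflect 3 '' L, w.2 < 1 := by
    obtain ⟨w, hw, h⟩ := hL3
    exact ⟨_, ⟨w, hw, rfl⟩, by rw [reflect_apply]; simp only; omega⟩
  have hinj : Function.Injective (Sym2.map flipSet : Sym2 (Finset (ℤ × ℤ)) → _) :=
    Sym2.map.injective flipSet.injective
  have memflip : ∀ (M : Multiset (Sym2 (Finset (ℤ × ℤ)))) e,
      e ∈ M.map (Sym2.map flipSet) ↔ Sym2.map flipSet e ∈ M := by
    intro M e
    conv_lhs => rw [← map_flipSet_flipSet e]
    exact Multiset.mem_map_of_injective hinj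
  -- rows of the common edge
  have rows : ∀ e ∈ dualEdges T, ∃ p q : ℤ × ℤ,
      (SharesMiddle e ↔ (p.2 ≤ 1 ∧ 2 ≤ q.2) ∨ (q.2 ≤ 1 ∧ 2 ≤ p.2)) ∧
      (SharesBottom e ↔ (p.2 ≤ 0 ∧ q.2 = 1) ∨ (q.2 ≤ 0 ∧ p.2 = 1)) ∧
      (SharesFlat e ↔ (p.2 = 1 ∧ q.2 = 1)) ∧
      (SharesBottom (Sym2.map flipSet e) ↔ (3 ≤ p.2 ∧ q.2 = 2) ∨ (3 ≤ q.2 ∧ p.2 = 2)) ∧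
      (SharesFlat (Sym2.map flipSet e) ↔ (p.2 = 2 ∧ q.2 = 2)) ∧
      0 ≤ p.2 ∧ 0 ≤ q.2 ∧ p.2 ≤ 3 ∧ q.2 ≤ 3 ∧ ¬ (p.2 = 0 ∧ q.2 = 0) ∧ ¬ (p.2 = 3 ∧ q.2 = 3) := by
    intro e he
    obtain ⟨p, q, hpq, hs, huniq⟩ := exists_shares he
    have hs' : Shares e q p := fun t ht => (hs t ht).symm
    have hflip : ∀ p q, Shares (Sym2.map flipSet e) p q ↔ Shares e (reflect 3 p) (reflect 3 q) := by
      intro p q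
      induction e with
      | h t t' => simp only [Sym2.map_mk, shares_mk, mem_flipSet]
    have hr : ∀ x : ℤ × ℤ, (reflect 3 x).2 = 3 - x.2 := fun x => rfl
    have hdet : ∀ t ∈ e, ∃ r ∈ L, {p, q, r} ∈ T ∧ t = {p, q, r} := by
      intro t ht
      have htT : t ∈ T := by
        induction e with
        | h t1 t2 =>
          obtain ⟨h1, h2, -⟩ := mk_mem_dualEdges.mp he
          rcases Sym2.mem_iff.mp ht with rfl | rfl <;> assumption
      obtain ⟨r, rfl⟩ := (hT.unimodular t htT).exists_third (hs t ht).1 (hs t ht).2 hpq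
      exact ⟨r, hT.vertex_mem _ htT r (by simp), htT, rfl⟩
    obtain ⟨r, r', hrL, hrL', hrT, hrT', hrr⟩ : ∃ r r', r ∈ L ∧ r' ∈ L ∧ {p, q, r} ∈ T ∧
        {p, q, r'} ∈ T ∧ latticeDet p q r ≠ latticeDet p q r' := by
      induction e with
      | h t1 t2 =>
        obtain ⟨r, h1, h2, h3⟩ := hdet t1 (by simp)
        obtain ⟨r', h1', h2', h3'⟩ := hdet t2 (by simp)
        refine ⟨r, r', h1, h1', h2, h2', fun h => (mk_mem_dualEdges.mp he).2.2.1 ?_⟩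
        rw [h3, h3', hT.unique_third h2 h2' h]
    have hpL := hL p (hT.vertex_mem _ hrT p (by simp))
    have hqL := hL q (hT.vertex_mem _ hrT q (by simp))
    -- The third vertices lie strictly on opposite sides of the common edge, so this edge cannot lie
    -- in one of the bounding rows 0 and 3.
    have hflat : ∀ k : ℤ, p.2 = k ∧ q.2 = k → (0 ≤ (r.2 - k) * (r'.2 - k)) → False := by
      rintro k ⟨h1, h2⟩ h3
      have e1 : latticeDet p q r = (q.1 - p.1) * (r.2 - k) := by
        simp only [latticeDet, h1, h2]; ring
      have e2 : latticeDet p q r' = (q.1 - p.1) * (r'.2 - k) := by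
        simp only [latticeDet, h1, h2]; ring
      have e3 : latticeDet p q r * latticeDet p q r' = -1 := by
        rcases hT.abs_det hrT with h | h <;> rcases hT.abs_det hrT' with h' | h' <;>
          first | exact absurd (h.trans h'.symm) hrr | (rw [h, h']; norm_num)
      have e4 : latticeDet p q r * latticeDet p q r' =
          ((q.1 - p.1) * (q.1 - p.1)) * ((r.2 - k) * (r'.2 - k)) := by rw [e1, e2]; ring
      have e5 := mul_nonneg (mul_self_nonneg (q.1 - p.1)) h3
      omega
    have hrow := hL r hrL
    have hrow' := hL r' hrL'
    refine ⟨p, q, ⟨?_, ?_⟩, ⟨?_, ?_⟩, ⟨?_, ?_⟩, ⟨?_, ?_⟩, ⟨?_, ?_⟩, hpL.1, hqL.1, hpL.2, hqL.2,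
      fun h => hflat 0 h (mul_nonneg (by omega) (by omega)),
      fun h => hflat 3 h (mul_nonneg_of_nonpos_of_nonpos (by omega) (by omega))⟩
    · rintro ⟨x, y, h1, h2, h3, h4⟩
      rcases huniq x y h1 h2 with ⟨rfl, rfl⟩ | ⟨rfl, rfl⟩ <;> omega
    · rintro (h | h)
      exacts [⟨p, q, hpq, hs, h⟩, ⟨q, p, hpq.symm, hs', h⟩]
    · rintro ⟨x, y, h1, h2, h3, h4⟩
      rcases huniq x y h1 h2 with ⟨rfl, rfl⟩ | ⟨rfl, rfl⟩ <;> omega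
    · rintro (h | h)
      exacts [⟨p, q, hpq, hs, h⟩, ⟨q, p, hpq.symm, hs', h⟩]
    · rintro ⟨x, y, h1, h2, h3, h4⟩
      rcases huniq x y h1 h2 with ⟨rfl, rfl⟩ | ⟨rfl, rfl⟩ <;> omega
    · exact fun h => ⟨p, q, hpq, hs, h⟩
    · rintro ⟨x, y, h1, h2, h3, h4⟩
      have := huniq _ _ ((reflect 3).injective.ne h1) ((hflip x y).mp h2)
      have := hr x
      have := hr y
      rcases ‹(_ ∧ _) ∨ _› with ⟨h5, h6⟩ | ⟨h5, h6⟩ <;> rw [← h5, ← h6] <;> omega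
    · have hf : ∀ x y, Shares e x y → Shares (Sym2.map flipSet e) (reflect 3 x) (reflect 3 y) := by
        intro x y h; rw [hflip, reflect_reflect, reflect_reflect]; exact h
      rintro (h | h)
      · exact ⟨_, _, (reflect 3).injective.ne hpq, hf _ _ hs, by rw [hr]; omega, by rw [hr]; omega⟩
      · exact ⟨_, _, (reflect 3).injective.ne hpq.symm, hf _ _ hs', by rw [hr]; omega,
          by rw [hr]; omega⟩
    · rintro ⟨x, y, h1, h2, h3, h4⟩
      have := huniq _ _ ((reflect 3).injective.ne h1) ((hflip x y).mp h2)
      have := hr x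
      have := hr y
      rcases ‹(_ ∧ _) ∨ _› with ⟨h5, h6⟩ | ⟨h5, h6⟩ <;> rw [← h5, ← h6] <;> omega
    · intro h
      exact ⟨_, _, (reflect 3).injective.ne hpq,
        by rw [hflip, reflect_reflect, reflect_reflect]; exact hs, by rw [hr]; omega,
        by rw [hr]; omega⟩
  have hF := (dualEdges T).nodup
  have n1 := hl.middleLinks_nodup
  have n2 := hl.flatLinks_nodup hT hL0'
  have n3 := (hl.flip.flatLinks_nodup hT3 hL0'').map hinj
  have n4 := hb.bottomLinks_nodup
  have n5 := hc.bottomLinks_nodup.map hinj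
  have m1 : ∀ e, e ∈ middleLinks l ↔ e ∈ dualEdges T ∧ SharesMiddle e := fun e =>
    hT.mem_middleLinks hl
  have m2 : ∀ e, e ∈ flatLinks T l ↔ e ∈ dualEdges T ∧ SharesFlat e := fun e =>
    hT.mem_flatLinks hl hL0'
  have m3 : ∀ e, e ∈ (flatLinks (flipTriangulation T) (l.map flipStep)).map (Sym2.map flipSet) ↔
      e ∈ dualEdges T ∧ SharesFlat (Sym2.map flipSet e) := fun e => by
    rw [memflip, hT3.mem_flatLinks hl.flip hL0'', map_mem_dualEdges]
  have m4 : ∀ e, e ∈ bottomLinks b ↔ e ∈ dualEdges T ∧ SharesBottom e := fun e =>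
    hT.mem_bottomLinks hb
  have m5 : ∀ e, e ∈ (bottomLinks c).map (Sym2.map flipSet) ↔
      e ∈ dualEdges T ∧ SharesBottom (Sym2.map flipSet e) := fun e => by
    rw [memflip, hT3.mem_bottomLinks hc, map_mem_dualEdges]
  -- Both sides are free of repetitions, so it suffices to compare members. The ends of the common
  -- edge lie in the rows 0 to 3, not both in row 0 and not both in row 3, and each remaining pair
  -- of rows belongs to exactly one of the five classes.
  refine (Multiset.Nodup.ext hF ?_).mpr fun e => ?_
  · simp only [Multiset.nodup_add, Multiset.disjoint_left, Multiset.mem_add, m1, m2, m3, m4, m5]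
    refine ⟨⟨⟨⟨n1, n2, ?_⟩, n3, ?_⟩, n4, ?_⟩, n5, ?_⟩
    · rintro e ⟨h, h1⟩ ⟨-, h2⟩
      obtain ⟨p, q, r1, r2, r3, r4, r5, r6⟩ := rows e h
      rw [r1] at h1; rw [r3] at h2; omega
    · rintro e (⟨h, h1⟩ | ⟨h, h1⟩) ⟨-, h2⟩ <;> obtain ⟨p, q, r1, r2, r3, r4, r5, r6⟩ := rows e h
      · rw [r1] at h1; rw [r5] at h2; omega
      · rw [r3] at h1; rw [r5] at h2; omega
    · rintro e ((⟨h, h1⟩ | ⟨h, h1⟩) | ⟨h, h1⟩) ⟨-, h2⟩ <;>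
        obtain ⟨p, q, r1, r2, r3, r4, r5, r6⟩ := rows e h
      · rw [r1] at h1; rw [r2] at h2; omega
      · rw [r3] at h1; rw [r2] at h2; omega
      · rw [r5] at h1; rw [r2] at h2; omega
    · rintro e (((⟨h, h1⟩ | ⟨h, h1⟩) | ⟨h, h1⟩) | ⟨h, h1⟩) ⟨-, h2⟩ <;>
        obtain ⟨p, q, r1, r2, r3, r4, r5, r6⟩ := rows e h
      · rw [r1] at h1; rw [r4] at h2; omega
      · rw [r3] at h1; rw [r4] at h2; omega
      · rw [r5] at h1; rw [r4] at h2; omega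
      · rw [r2] at h1; rw [r4] at h2; omega
  · simp only [Multiset.mem_add, m1, m2, m3, m4, m5, Finset.mem_val]
    constructor
    · intro h
      obtain ⟨p, q, r1, r2, r3, r4, r5, r6⟩ := rows e h
      rw [r1, r2, r3, r4, r5]
      simp only [h, true_and]
      omega
    · tauto

end DualGraph


/-! ### Reduction of the dual graph along the line `y = 3 / 2` -/

section Reduction

variable {L : Set (ℤ × ℤ)} {T : Finset (Finset (ℤ × ℤ))}
  {l b c : List (((ℤ × ℤ) × (ℤ × ℤ)) × ((ℤ × ℤ) × (ℤ × ℤ)))}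
  {s s' : ((ℤ × ℤ) × (ℤ × ℤ)) × ((ℤ × ℤ) × (ℤ × ℤ))}

/-- The triangle `t` lies below the line `y = 1` and has at most one vertex on it. -/
def IsLow (t : Finset (ℤ × ℤ)) : Prop :=
  (∀ x ∈ t, x.2 ≤ 1) ∧ ∀ x ∈ t, ∀ y ∈ t, x.2 = 1 → y.2 = 1 → x = y

lemma not_isLow_of_two_le {t : Finset (ℤ × ℤ)} {x : ℤ × ℤ} (hx : x ∈ t) (h : 2 ≤ x.2) :
    ¬ IsLow t := fun ht => by have := ht.1 x hx; omega

lemma not_isLow_flipSet {t : Finset (ℤ × ℤ)} {x : ℤ × ℤ} (hx : x ∈ t) (h : x.2 ≤ 1) :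
    ¬ IsLow (flipSet t) := by
  refine not_isLow_of_two_le (x := reflect 3 x) ?_ ?_
  · rwa [mem_flipSet, reflect_reflect]
  · rw [reflect_apply]; simp only; omega

lemma IsStep.not_isLow (h : IsStep T s) : ¬ IsLow (stepTriangle s) :=
  not_isLow_of_two_le (x := s.1.2) (by simp [stepTriangle]) h.rows.2.1

lemma IsStep.not_isLow_flipSet (h : IsStep T s) : ¬ IsLow (flipSet (stepTriangle s)) :=
  _root_.not_isLow_flipSet (x := s.1.1) (by simp [stepTriangle]) h.rows.1

lemma CombTriangulation.fst_mem_belowTriangle (hT : CombTriangulation L T)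
    (hL : ∃ w ∈ L, w.2 < 1) (h : IsStep T s) (hs : IsLower s) :
    s.1.1 ∈ belowTriangle T s ∧ s.2.1 ∈ belowTriangle T s ∧ belowTriangle T s ∈ T := by
  by_cases hf : IsFlat s
  · obtain ⟨x, -, h2, -, h4⟩ := hT.exists_below hL h hs hf
    rw [h4]
    exact ⟨by simp, by simp, h2⟩
  · rw [belowTriangle_of_not_isFlat hf]
    exact ⟨by simp [stepTriangle], by simp [stepTriangle], h.stepTriangle_mem⟩

lemma CombTriangulation.not_isLow_belowTriangle (hT : CombTriangulation L T)
    (hL : ∃ w ∈ L, w.2 < 1) (h : IsStep T s) (hs : IsLower s) :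
    ¬ IsLow (belowTriangle T s) := by
  by_cases hf : IsFlat s
  · obtain ⟨h1, h2, -⟩ := hT.fst_mem_belowTriangle hL h hs
    exact fun ht => h.fst_ne hs (ht.2 _ h1 _ h2 hf.1 hf.2)
  · rw [belowTriangle_of_not_isFlat hf]
    exact h.not_isLow

lemma CombTriangulation.not_isLow_flipSet_belowTriangle (hT : CombTriangulation L T)
    (hL : ∃ w ∈ L, w.2 < 1) (h : IsStep T s) (hs : IsLower s) :
    ¬ IsLow (flipSet (belowTriangle T s)) :=
  not_isLow_flipSet (hT.fst_mem_belowTriangle hL h hs).1 h.rows.1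

/-- A unimodular triangle cannot lie in a single row, so a low triangle has exactly one vertex in
the row y = 1 and the others in the row y = 0. Seen in the reflection, such a triangle moves the
upper end. -/
lemma CombTriangulation.mem_bottomTriangles (hT : CombTriangulation L T) (hL : ∀ p ∈ L, 0 ≤ p.2)
    (hb : IsStepList (mapTriangulation (reflect 2) T) b) {t : Finset (ℤ × ℤ)} :
    t ∈ bottomTriangles b ↔ t ∈ T ∧ IsLow t := by
  have hT' := hT.map (isLatticeIso_reflect 2)
  have hmem : t ∈ bottomTriangles b ↔
      ∃ s ∈ b, ¬ IsLower s ∧ (stepTriangle s).map (reflect 2).toEmbedding = t := by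
    simp only [bottomTriangles, droppedVertices, List.mem_toFinset, List.mem_map, List.mem_filter,
      decide_not, Bool.not_eq_true', decide_eq_false_iff_not, and_assoc]
  rw [hmem]
  constructor
  · rintro ⟨s, hs, hlow, rfl⟩
    have h := (hb.mem_iff s).mp hs
    have hm : ∀ x ∈ stepTriangle s, x.2 ≤ 2 := by
      intro x hx
      obtain ⟨y, hy, rfl⟩ := hT'.vertex_mem _ h.stepTriangle_mem x hx
      have := hL y hy
      rw [reflect_apply]; simp only; omega
    have h1 := hm s.1.2 (by simp [stepTriangle])
    have h2 := hm s.2.2 (by simp [stepTriangle])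
    have hr := h.rows
    obtain ⟨h3, h4, -⟩ := h.row_of_not_isLower hlow (by omega) (by omega)
    have h5 := h.fst_eq_of_not_isLower hlow
    have hx : ∀ x ∈ (stepTriangle s).map (reflect 2).toEmbedding,
        reflect 2 x = s.1.1 ∨ (2 - x.2) = 2 := by
      intro x hx
      rw [mem_map_reflect] at hx
      simp only [stepTriangle, Finset.mem_insert, Finset.mem_singleton] at hx
      have e : (reflect 2 x).2 = 2 - x.2 := rfl
      rcases hx with h | h | h | h
      · exact Or.inl h
      · right; rw [← e, h]; omega
      · left; rw [h, h5]
      · right; rw [← e, h]; omega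
    refine ⟨?_, ?_, ?_⟩
    · rw [← mem_mapTriangulation (φ := reflect 2), map_reflect_reflect]
      exact h.stepTriangle_mem
    · intro x hx'
      rcases hx x hx' with h | h
      · have e : (reflect 2 x).2 = 2 - x.2 := rfl
        rw [h] at e; omega
      · omega
    · intro x hx' y hy' hx1 hy1
      rcases hx x hx' with h | h
      · rcases hx y hy' with h' | h'
        · exact (reflect 2).injective (h.trans h'.symm)
        · omega
      · omega
  · rintro ⟨ht, h1, h2⟩
    have hrow : ∀ x ∈ t, 0 ≤ x.2 := fun x hx => hL x (hT.vertex_mem t ht x hx)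
    obtain ⟨l, hl, hl1⟩ : ∃ x ∈ t, x.2 = 1 := by
      by_contra! hno
      obtain ⟨p, q, r, rfl, hd⟩ := hT.unimodular t ht
      have hz : ∀ x ∈ ({p, q, r} : Finset (ℤ × ℤ)), x.2 = 0 := fun x hx => by
        have a1 := h1 x hx
        have a2 := hrow x hx
        have a3 := hno x hx
        omega
      rw [latticeDet, hz p (by simp), hz q (by simp), hz r (by simp)] at hd
      simp at hd
    obtain ⟨u, hu, hu0⟩ : ∃ x ∈ t, x.2 = 0 := by
      by_contra! hno
      obtain ⟨p, q, r, rfl, hd⟩ := hT.unimodular t ht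
      have hz : ∀ x ∈ ({p, q, r} : Finset (ℤ × ℤ)), x.2 = 1 := fun x hx => by
        have a1 := h1 x hx
        have a2 := hrow x hx
        have a3 := hno x hx
        omega
      rw [latticeDet, hz p (by simp), hz q (by simp), hz r (by simp)] at hd
      simp at hd
    obtain ⟨s, hs, hst⟩ := hT'.exists_step (mem_mapTriangulation.mpr ht)
      (l := reflect 2 l) (u := reflect 2 u)
      (by rwa [mem_map_reflect, reflect_reflect]) (by rwa [mem_map_reflect, reflect_reflect])
      (by rw [reflect_apply]; simp only; omega) (by rw [reflect_apply]; simp only; omega)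
    refine ⟨s, (hb.mem_iff s).mpr hs, fun hlow => ?_, by rw [hst, map_reflect_reflect]⟩
    have m1 : reflect 2 s.1.1 ∈ t := by
      rw [← mem_map_reflect, ← hst]; simp [stepTriangle]
    have m2 : reflect 2 s.2.1 ∈ t := by
      rw [← mem_map_reflect, ← hst]; simp [stepTriangle]
    have hr := hs.rows
    have e : ∀ x, (reflect 2 x).2 = 2 - x.2 := fun _ => rfl
    have a1 := h1 _ m1
    have a2 := h1 _ m2
    rw [e] at a1 a2
    exact hs.fst_ne hlow ((reflect 2).injective (h2 _ m1 _ m2 (by rw [e]; omega) (by rw [e]; omega)))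

/-- A triangle below the line `y = 1` with an edge on it lies below a flat step. -/
lemma CombTriangulation.exists_flat_of_not_isLow (hT : CombTriangulation L T)
    (hL : ∃ w ∈ L, 2 ≤ w.2) {t : Finset (ℤ × ℤ)} (ht : t ∈ T) (h1 : ∀ x ∈ t, x.2 ≤ 1)
    (hlow : ¬ IsLow t) : ∃ s, IsStep T s ∧ IsLower s ∧ IsFlat s ∧ t = belowTriangle T s := by
  obtain ⟨p, hp, q, hq, hp1, hq1, hpq⟩ : ∃ p ∈ t, ∃ q ∈ t, p.2 = 1 ∧ q.2 = 1 ∧ p ≠ q := by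
    by_contra! hno
    exact hlow ⟨h1, fun x hx y hy => hno x hx y hy⟩
  obtain ⟨r, rfl⟩ := (hT.unimodular t ht).exists_third hp hq hpq
  obtain ⟨w, hw, hw2⟩ := hL
  have hd := hT.abs_det ht
  have hr := h1 r (by simp)
  have hr1 : r.2 ≠ 1 := by
    rintro h
    rw [latticeDet_flat hp1 hq1, h] at hd
    simp at hd
  have hqp : q.1 - p.1 ≠ 0 := fun h => hpq (Prod.ext (by omega) (by omega))
  have hneg : latticeDet p q r * latticeDet p q w < 0 := by
    rw [latticeDet_flat hp1 hq1, latticeDet_flat hp1 hq1]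
    have e : (q.1 - p.1) * (r.2 - 1) * ((q.1 - p.1) * (w.2 - 1)) =
      ((q.1 - p.1) * (q.1 - p.1)) * ((r.2 - 1) * (w.2 - 1)) := by ring
    rw [e]
    exact mul_neg_of_pos_of_neg (mul_self_pos.mpr hqp)
      (mul_neg_of_neg_of_pos (by omega) (by omega))
  obtain ⟨r', hr', hdr⟩ := hT.neighbour p q r ht w hw hneg
  have hr2 : 2 ≤ r'.2 := by
    by_contra! hlt
    rw [latticeDet_flat hp1 hq1, latticeDet_flat hp1 hq1] at hdr
    have e : (q.1 - p.1) * ((r'.2 - 1) + (r.2 - 1)) = 0 := by linarith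
    rcases mul_eq_zero.mp e with h | h
    · exact hqp h
    · omega
  obtain ⟨s, a1, a2, a3, a4, a5, a6⟩ := hT.exists_flat_step hr' hp1 hq1 hr2
  refine ⟨s, a1, a2, a3, (hT.belowTriangle_eq a1 a2 a3 ht ?_ ?_ ?_).symm⟩
  · rw [a4]
    intro h
    have : r' ∈ ({p, q, r} : Finset (ℤ × ℤ)) := by rw [h]; simp
    have := h1 r' this
    omega
  · rcases a5 with h | h <;> rw [h] <;> simp
  · rcases a6 with h | h <;> rw [h] <;> simp

/-- The triangles that are not removed by the reduction. -/
lemma CombTriangulation.not_isLow_iff (hT : CombTriangulation L T)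
    (hL0 : ∃ w ∈ L, w.2 = 0) (hL3 : ∃ w ∈ L, w.2 = 3) {t : Finset (ℤ × ℤ)} :
    (t ∈ T ∧ ¬ IsLow t ∧ ¬ IsLow (flipSet t)) ↔ (∃ s, IsStep T s ∧ t = stepTriangle s) ∨
      (∃ s, IsStep T s ∧ IsLower s ∧ IsFlat s ∧ t = belowTriangle T s) ∨
      ∃ s, IsStep (flipTriangulation T) s ∧ IsLower s ∧ IsFlat s ∧
        t = flipSet (belowTriangle (flipTriangulation T) s) := by
  have hT3 : CombTriangulation (reflect 3 '' L) (flipTriangulation T) :=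
    hT.map (isLatticeIso_reflect 3)
  have hL0' : ∃ w ∈ L, w.2 < 1 := hL0.imp fun w h => ⟨h.1, by omega⟩
  have hL0'' : ∃ w ∈ reflect 3 '' L, w.2 < 1 := by
    obtain ⟨w, hw, h⟩ := hL3
    exact ⟨_, ⟨w, hw, rfl⟩, by rw [reflect_apply]; simp only; omega⟩
  constructor
  · rintro ⟨ht, h1, h2⟩
    by_cases hu : ∃ u ∈ t, 2 ≤ u.2
    · obtain ⟨u, hu, hu2⟩ := hu
      by_cases hl : ∃ l ∈ t, l.2 ≤ 1
      · obtain ⟨l, hl, hl1⟩ := hl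
        obtain ⟨s, hs, hst⟩ := hT.exists_step ht hl hu hl1 hu2
        exact Or.inl ⟨s, hs, hst.symm⟩
      · push Not at hl
        obtain ⟨s, a1, a2, a3, a4⟩ := hT3.exists_flat_of_not_isLow
          (by
            obtain ⟨w, hw, h⟩ := hL0
            exact ⟨_, ⟨w, hw, rfl⟩, by rw [reflect_apply]; simp only; omega⟩)
          (flipSet_mem_flipTriangulation.mpr ht)
          (fun x hx => by
            have := hl _ (mem_flipSet.mp hx)
            rw [reflect_apply] at this; simp only at this; omega) h2
        exact Or.inr (Or.inr ⟨s, a1, a2, a3, by rw [← a4, flipSet_flipSet]⟩)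
    · push Not at hu
      exact Or.inr (Or.inl (hT.exists_flat_of_not_isLow (hL3.imp fun w h => ⟨h.1, by omega⟩) ht
        (fun x hx => by have := hu x hx; omega) h1))
  · rintro (⟨s, hs, rfl⟩ | ⟨s, h1, h2, h3, rfl⟩ | ⟨s, h1, h2, h3, rfl⟩)
    · exact ⟨hs.stepTriangle_mem, hs.not_isLow, hs.not_isLow_flipSet⟩
    · exact ⟨(hT.fst_mem_belowTriangle hL0' h1 h2).2.2, hT.not_isLow_belowTriangle hL0' h1 h2,
        hT.not_isLow_flipSet_belowTriangle hL0' h1 h2⟩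
    · refine ⟨?_, hT3.not_isLow_flipSet_belowTriangle hL0'' h1 h2, ?_⟩
      · rw [← flipSet_mem_flipTriangulation, flipSet_flipSet]
        exact (hT3.fst_mem_belowTriangle hL0'' h1 h2).2.2
      · rw [flipSet_flipSet]
        exact hT3.not_isLow_belowTriangle hL0'' h1 h2

lemma map_flipSet_map (E : Multiset (Sym2 (Finset (ℤ × ℤ)))) :
    (E.map (Sym2.map flipSet)).map (Sym2.map flipSet) = E := by
  rw [Multiset.map_map]
  conv_rhs => rw [← Multiset.map_id E]
  exact Multiset.map_congr rfl fun e _ => map_flipSet_flipSet e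

lemma IsStepList.exists_of_mem_middleLinks (hl : IsStepList T l) {e : Sym2 (Finset (ℤ × ℤ))}
    (he : e ∈ middleLinks l) : ∀ t ∈ e, ∃ s, IsStep T s ∧ t = stepTriangle s := by
  rw [middleLinks, Multiset.mem_coe, List.mem_map] at he
  obtain ⟨⟨s, s'⟩, hq, rfl⟩ := he
  obtain ⟨h1, h2, -⟩ := (hl.adjacent_iff s s').mp hq
  intro t ht
  rcases Sym2.mem_iff.mp ht with h | h
  exacts [⟨s, h1, h⟩, ⟨s', h2, h⟩]

lemma IsStepList.exists_of_mem_flatLinks (hl : IsStepList T l) {e : Sym2 (Finset (ℤ × ℤ))}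
    (he : e ∈ flatLinks T l) : ∀ t ∈ e, ∃ s, IsStep T s ∧ IsLower s ∧
      (t = stepTriangle s ∨ t = belowTriangle T s) := by
  rw [flatLinks, Multiset.mem_coe, List.mem_map] at he
  obtain ⟨s, hs, rfl⟩ := he
  rw [List.mem_filter, decide_eq_true_eq] at hs
  exact fun t ht => ⟨s, (hl.mem_iff s).mp hs.1, hs.2.1, Sym2.mem_iff.mp ht⟩

lemma CombTriangulation.exists_of_mem_lowerLinks (hT : CombTriangulation L T)
    (hl : IsStepList T l) {e : Sym2 (Finset (ℤ × ℤ))}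
    (he : e ∈ (lowerLinks T l : Multiset (Sym2 (Finset (ℤ × ℤ))))) : ∀ t ∈ e, ∃ s, IsStep T s ∧ IsLower s ∧
      t = belowTriangle T s := by
  rw [lowerLinks, Multiset.mem_coe, List.mem_map] at he
  obtain ⟨⟨s, s'⟩, hs, rfl⟩ := he
  obtain ⟨h1, h2, h3, h4, -⟩ := (hT.mem_lowerPairs hl).mp hs
  intro t ht
  rcases Sym2.mem_iff.mp ht with h | h
  exacts [⟨s, h1, h3, h⟩, ⟨s', h2, h4, h⟩]

lemma IsStepList.exists_of_mem_bottomLinks (hb : IsStepList (mapTriangulation (reflect 2) T) b)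
    {e : Sym2 (Finset (ℤ × ℤ))} (he : e ∈ bottomLinks b) : ∀ t ∈ e, ∃ x ∈ t, x.2 ≤ 0 := by
  intro t ht
  obtain ⟨s, hs, rfl⟩ := exists_mem_of_mem_listLinks he ht
  have hr := ((hb.mem_iff s).mp hs).rows
  refine ⟨reflect 2 s.1.2, ?_, ?_⟩
  · rw [mem_map_reflect, reflect_reflect]; simp [stepTriangle]
  · rw [reflect_apply]; simp only; omega

open Classical in
/-- Elimination of the triangles with an edge on the boundary rows. -/
lemma CombTriangulation.reduction (hT : CombTriangulation L T)
    (hL : ∀ p ∈ L, 0 ≤ p.2 ∧ p.2 ≤ 3) (hL0 : ∃ w ∈ L, w.2 = 0) (hL3 : ∃ w ∈ L, w.2 = 3)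
    (hl : IsStepList T l) :
    Relation.ReflTransGen MGraph.Step ⟨T, (dualEdges T).val⟩
      ⟨T.filter fun t => ¬ IsLow t ∧ ¬ IsLow (flipSet t), middleLinks l + flatLinks T l +
      (flatLinks (flipTriangulation T) (l.map flipStep)).map (Sym2.map flipSet) +
      (lowerLinks T l : Multiset (Sym2 (Finset (ℤ × ℤ)))) +
      (lowerLinks (flipTriangulation T) (l.map flipStep) :
        Multiset (Sym2 (Finset (ℤ × ℤ)))).map (Sym2.map flipSet)⟩ := by
  have hT3 : CombTriangulation (reflect 3 '' L) (flipTriangulation T) :=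
    hT.map (isLatticeIso_reflect 3)
  obtain ⟨b, hb⟩ := (hT.map (isLatticeIso_reflect 2)).exists_stepList
  obtain ⟨c, hc⟩ := (hT3.map (isLatticeIso_reflect 2)).exists_stepList
  have hL0' : ∃ w ∈ L, w.2 < 1 := hL0.imp fun w h => ⟨h.1, by omega⟩
  have hL3' : ∀ p ∈ reflect 3 '' L, 0 ≤ p.2 := by
    rintro _ ⟨p, hp, rfl⟩
    have := hL p hp
    rw [reflect_apply]; simp only; omega
  have hL0'' : ∃ w ∈ reflect 3 '' L, w.2 < 1 := by
    obtain ⟨w, hw, h⟩ := hL3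
    exact ⟨_, ⟨w, hw, rfl⟩, by rw [reflect_apply]; simp only; omega⟩
  have hL3'' : ∃ w ∈ reflect 3 '' L, w.2 = 3 := by
    obtain ⟨w, hw, h⟩ := hL0
    exact ⟨_, ⟨w, hw, rfl⟩, by rw [reflect_apply]; simp only; omega⟩
  have hl3 := hl.flip
  have memflip : ∀ (M : Multiset (Sym2 (Finset (ℤ × ℤ)))) e,
      e ∈ M.map (Sym2.map flipSet) → ∀ t ∈ e, ∃ e' ∈ M, flipSet t ∈ e' := by
    intro M e he t ht
    obtain ⟨e', he', rfl⟩ := Multiset.mem_map.mp he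
    obtain ⟨t', ht', rfl⟩ := Sym2.mem_map.mp ht
    exact ⟨e', he', by rwa [flipSet_flipSet]⟩
  have memb : ∀ t, t ∈ bottomTriangles b ↔ t ∈ T ∧ IsLow t := fun t =>
    hT.mem_bottomTriangles (fun p hp => (hL p hp).1) hb
  have memc : ∀ t, t ∈ bottomTriangles c ↔ t ∈ flipTriangulation T ∧ IsLow t := fun t =>
    hT3.mem_bottomTriangles hL3' hc
  rw [hT.dualEdges_eq hL hL0 hL3 hl hb hc]
  set M := middleLinks l with hM
  set F := flatLinks T l with hF
  set F' := flatLinks (flipTriangulation T) (l.map flipStep) with hF'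
  have step1 := hT.lower_reduction (fun p hp => (hL p hp).1) hL0' hL3 hl hb T
    (M + F + F'.map (Sym2.map flipSet) + (bottomLinks c).map (Sym2.map flipSet)) (by
      intro t ht
      rw [memb] at ht
      refine ⟨ht.1, fun e he hte => ?_⟩
      simp only [Multiset.mem_add] at he
      rcases he with ((he | he) | he) | he
      · obtain ⟨s, hs, rfl⟩ := hl.exists_of_mem_middleLinks he t hte
        exact hs.not_isLow ht.2
      · obtain ⟨s, hs, hs', rfl | rfl⟩ := hl.exists_of_mem_flatLinks he t hte
        · exact hs.not_isLow ht.2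
        · exact hT.not_isLow_belowTriangle hL0' hs hs' ht.2
      · obtain ⟨e', he', hte'⟩ := memflip _ _ he t hte
        obtain ⟨s, hs, hs', h⟩ := hl3.exists_of_mem_flatLinks he' _ hte'
        rw [← flipSet_flipSet t] at ht
        rcases h with h | h <;> rw [h] at ht
        · exact hs.not_isLow_flipSet ht.2
        · exact hT3.not_isLow_flipSet_belowTriangle hL0'' hs hs' ht.2
      · obtain ⟨e', he', hte'⟩ := memflip _ _ he t hte
        obtain ⟨x, hx, hx0⟩ := hc.exists_of_mem_bottomLinks he' _ hte'
        rw [← flipSet_flipSet t] at ht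
        exact not_isLow_flipSet hx (by omega) ht.2)
  have step2 := hT3.lower_reduction hL3' hL0'' hL3'' hl3 hc
    ((T \ bottomTriangles b).map flipSet.toEmbedding)
    ((M + F + F'.map (Sym2.map flipSet) +
      (lowerLinks T l : Multiset (Sym2 (Finset (ℤ × ℤ))))).map (Sym2.map flipSet)) (by
      intro t ht
      rw [memc] at ht
      refine ⟨?_, fun e he hte => ?_⟩
      · rw [Finset.mem_map_equiv, Finset.mem_sdiff, memb]
        rw [show flipSet.symm t = flipSet t from rfl]
        refine ⟨?_, fun h => ?_⟩
        · rw [← flipSet_mem_flipTriangulation, flipSet_flipSet]; exact ht.1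
        · obtain ⟨p, q, r, rfl, -⟩ := hT3.unimodular t ht.1
          refine not_isLow_flipSet (x := p) (by simp) (ht.2.1 p (by simp)) h.2
      · obtain ⟨e', he', hte'⟩ := memflip _ _ he t hte
        rw [← flipSet_flipSet t] at ht
        simp only [Multiset.mem_add] at he'
        rcases he' with ((he | he) | he) | he
        · obtain ⟨s, hs, h⟩ := hl.exists_of_mem_middleLinks he _ hte'
          rw [h] at ht
          exact hs.not_isLow_flipSet ht.2
        · obtain ⟨s, hs, hs', h⟩ := hl.exists_of_mem_flatLinks he _ hte'
          rcases h with h | h <;> rw [h] at ht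
          · exact hs.not_isLow_flipSet ht.2
          · exact hT.not_isLow_flipSet_belowTriangle hL0' hs hs' ht.2
        · obtain ⟨e'', he'', hte''⟩ := memflip _ _ he _ hte'
          obtain ⟨s, hs, hs', h⟩ := hl3.exists_of_mem_flatLinks he'' _ hte''
          rcases h with h | h <;> rw [h] at ht
          · exact hs.not_isLow ht.2
          · exact hT3.not_isLow_belowTriangle hL0'' hs hs' ht.2
        · obtain ⟨s, hs, hs', h⟩ := hT.exists_of_mem_lowerLinks hl he _ hte'
          rw [h] at ht
          exact hT.not_isLow_flipSet_belowTriangle hL0' hs hs' ht.2)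
  -- The upper part has been treated as the lower part of the flipped triangulation; flipping once
  -- more carries that reduction back to `T`.
  have step2' := Relation.ReflTransGen.lift (MGraph.perm flipSet)
    (fun G H (h : MGraph.Step G H) => h.perm flipSet) _ _ step2
  have e1 : (⟨T, M + F + F'.map (Sym2.map flipSet) + bottomLinks b +
      (bottomLinks c).map (Sym2.map flipSet)⟩ : MGraph (Finset (ℤ × ℤ))) =
      ⟨T, M + F + F'.map (Sym2.map flipSet) + (bottomLinks c).map (Sym2.map flipSet) +
        bottomLinks b⟩ := by
    congr 1; abel
  rw [e1]
  refine step1.trans ?_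
  convert step2' using 1
  · ext t
    · simp only [MGraph.perm, Finset.mem_map_equiv]
      rw [show flipSet.symm (flipSet.symm t) = t from flipSet_flipSet t]
    · simp only [MGraph.perm, Multiset.map_add, map_flipSet_map]
      congr 1; abel
  · ext t
    · simp only [MGraph.perm, Finset.mem_map_equiv, Finset.mem_filter, Finset.mem_sdiff, memb, memc]
      rw [show flipSet.symm (flipSet.symm t) = t from flipSet_flipSet t,
        show flipSet.symm t = flipSet t from rfl, flipSet_mem_flipTriangulation]
      tauto
    · simp only [MGraph.perm, Multiset.map_add, map_flipSet_map]

end Reduction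


/-! ### Words and their graphs -/

section Words

/-- The letter of a step: whether it changes the lower end of the edge, and whether the old and the
new value of the end that changes lie on the interior row. -/
abbrev Letter := Bool × Bool × Bool

/-- The step runs along the interior row. -/
def Letter.isFlat (x : Letter) : Bool := x.2.1 && x.2.2

variable {α : Type*}

/-- The vertices of the graph of a list of letters with two vertices each; the second vertex
matters only if the letter is flat. -/
def wordVertices (I : List (Letter × α × α)) : List α :=
  (I.map fun x => x.2.1) ++ (I.filter fun x => x.1.isFlat).map fun x => x.2.2

/-- The edges between the two vertices of the flat letters of one side. -/
def wordRungs (σ : Bool) (I : List (Letter × α × α)) : List (Sym2 α) :=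
  (I.filter fun x => (x.1.1 == σ) && x.1.isFlat).map fun x => s(x.2.1, x.2.2)

/-- The edges between consecutive letters of one side that meet on the interior row. -/
def wordLinks (σ : Bool) (I : List (Letter × α × α)) : List (Sym2 α) :=
  ((adjacentPairs (I.filter fun x => x.1.1 == σ)).filter fun q => q.1.1.2.2).map fun q =>
    s(q.1.2.2, q.2.2.2)

open Classical in
/-- The graph of a list of letters with two vertices each. -/
noncomputable def wordGraph (I : List (Letter × α × α)) : MGraph α where
  verts := (wordVertices I).toFinset
  edges := ((adjacentPairs I).map fun q => s(q.1.2.1, q.2.2.1) : List _) +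
    wordRungs true I + wordRungs false I + wordLinks true I + wordLinks false I

lemma wordVertices_map (σ : α → α) (I : List (Letter × α × α)) :
    wordVertices (I.map (Prod.map id (Prod.map σ σ))) = (wordVertices I).map σ := by
  simp only [wordVertices, List.map_append, List.map_map, List.filter_map]
  rfl

lemma wordGraph_map (σ : Equiv.Perm α) (I : List (Letter × α × α)) :
    wordGraph (I.map (Prod.map id (Prod.map σ σ))) = (wordGraph I).perm σ := by
  ext x
  · simp only [wordGraph, MGraph.perm, wordVertices_map, List.mem_toFinset, List.mem_map,
      Finset.mem_map_equiv]
    constructor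
    · rintro ⟨y, hy, rfl⟩; simpa using hy
    · exact fun h => ⟨_, h, by simp⟩
  · simp only [wordGraph, MGraph.perm, Multiset.map_add, Multiset.map_coe, wordRungs, wordLinks,
      List.map_map, List.filter_map, adjacentPairs_map]
    rfl

lemma exists_perm_map_eq (l l' : List α) (h : l.Nodup) (h' : l'.Nodup)
    (hlen : l.length = l'.length) : ∃ σ : Equiv.Perm α, l.map σ = l' := by
  classical
  induction l generalizing l' with
  | nil =>
    cases l' with
    | nil => exact ⟨1, rfl⟩
    | cons => simp at hlen
  | cons a l ih =>
    cases l' with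
    | nil => simp at hlen
    | cons b l' =>
      rw [List.nodup_cons] at h h'
      obtain ⟨σ, rfl⟩ := ih l' h.2 h'.2 (by simpa using hlen)
      refine ⟨Equiv.swap (σ a) b * σ, ?_⟩
      simp only [List.map_cons, Equiv.Perm.mul_apply, Equiv.swap_apply_left, List.cons.injEq,
        true_and]
      refine List.map_congr_left fun x hx => Equiv.swap_apply_of_ne_of_ne ?_ ?_
      · exact fun he => h.1 (σ.injective he ▸ hx)
      · rintro rfl
        exact h'.1 (List.mem_map_of_mem hx)

/-- `wordVertices` records the second vertex only for flat letters; for the others it is fixed by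
convention to be the first one. -/
lemma items_eq {I J : List (Letter × α × α)} (hw : I.map Prod.fst = J.map Prod.fst)
    (h1 : (I.map fun x => x.2.1) = J.map fun x => x.2.1)
    (h2 : ((I.filter fun x => x.1.isFlat).map fun x => x.2.2) =
      (J.filter fun x => x.1.isFlat).map fun x => x.2.2)
    (hI : ∀ x ∈ I, ¬ x.1.isFlat → x.2.2 = x.2.1) (hJ : ∀ x ∈ J, ¬ x.1.isFlat → x.2.2 = x.2.1) :
    I = J := by
  induction I generalizing J with
  | nil =>
    cases J with
    | nil => rfl
    | cons => simp at hw
  | cons x I ih =>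
    cases J with
    | nil => simp at hw
    | cons y J =>
      obtain ⟨w, a, b⟩ := x
      obtain ⟨w', a', b'⟩ := y
      simp only [List.map_cons, List.cons.injEq] at hw h1
      obtain ⟨rfl, hw⟩ := hw
      obtain ⟨rfl, h1⟩ := h1
      have hI' := fun x hx => hI x (List.mem_cons_of_mem _ hx)
      have hJ' := fun x hx => hJ x (List.mem_cons_of_mem _ hx)
      by_cases hf : w.isFlat
      · simp only [List.filter_cons, hf, if_true, List.map_cons, List.cons.injEq] at h2
        rw [ih hw h1 h2.2 hI' hJ', h2.1]
      · simp only [List.filter_cons, hf] at h2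
        have e1 := hI (w, a, b) (by simp) hf
        have e2 := hJ (w, a, b') (by simp) hf
        simp only at e1 e2
        rw [ih hw h1 h2 hI' hJ', e1, e2]

/-- The graph depends only on the word, up to a permutation of the vertices. -/
lemma exists_wordGraph_perm {I J : List (Letter × α × α)} (hw : I.map Prod.fst = J.map Prod.fst)
    (hI : ∀ x ∈ I, ¬ x.1.isFlat → x.2.2 = x.2.1) (hJ : ∀ x ∈ J, ¬ x.1.isFlat → x.2.2 = x.2.1)
    (hIn : (wordVertices I).Nodup) (hJn : (wordVertices J).Nodup) :
    ∃ σ : Equiv.Perm α, (wordGraph I).perm σ = wordGraph J := by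
  have hlen : I.length = J.length := by simpa using congrArg List.length hw
  have hlen2 : (I.filter fun x => x.1.isFlat).length = (J.filter fun x => x.1.isFlat).length := by
    have e : ∀ K : List (Letter × α × α), (K.filter fun x => x.1.isFlat).length =
        ((K.map Prod.fst).filter Letter.isFlat).length := fun K => by
      rw [List.filter_map, List.length_map]; rfl
    rw [e, e, hw]
  obtain ⟨σ, hσ⟩ := exists_perm_map_eq _ _ hIn hJn (by simp [wordVertices, hlen, hlen2])
  refine ⟨σ, ?_⟩
  rw [← wordGraph_map]
  congr 1
  rw [← wordVertices_map] at hσ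
  obtain ⟨h1, h2⟩ := List.append_inj hσ (by simp [hlen])
  refine items_eq ?_ h1 h2 ?_ hJ
  · rw [← hw, List.map_map]; rfl
  · intro x hx hf
    obtain ⟨y, hy, rfl⟩ := List.mem_map.mp hx
    simp only [Prod.map_fst, Prod.map_snd, id] at hf ⊢
    rw [hI y hy hf]

end Words

/-! ### The word of a triangulation -/

section StepWord

variable {L : Set (ℤ × ℤ)} {T : Finset (Finset (ℤ × ℤ))}
  {l : List (((ℤ × ℤ) × (ℤ × ℤ)) × ((ℤ × ℤ) × (ℤ × ℤ)))}
  {s s' : ((ℤ × ℤ) × (ℤ × ℤ)) × ((ℤ × ℤ) × (ℤ × ℤ))}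

/-- The letter of a step, with its triangle and the triangle beside it. -/
noncomputable def stepItem (T : Finset (Finset (ℤ × ℤ)))
    (s : ((ℤ × ℤ) × (ℤ × ℤ)) × ((ℤ × ℤ) × (ℤ × ℤ))) :
    Letter × Finset (ℤ × ℤ) × Finset (ℤ × ℤ) :=
  if IsLower s then ((true, decide (s.1.1.2 = 1), decide (s.2.1.2 = 1)), stepTriangle s,
    belowTriangle T s)
  else ((false, decide ((flipStep s).1.1.2 = 1), decide ((flipStep s).2.1.2 = 1)), stepTriangle s,
    flipSet (belowTriangle (flipTriangulation T) (flipStep s)))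

lemma stepItem_of_isLower (h : IsLower s) : stepItem T s =
    ((true, decide (s.1.1.2 = 1), decide (s.2.1.2 = 1)), stepTriangle s, belowTriangle T s) :=
  if_pos h

lemma stepItem_of_not_isLower (h : ¬ IsLower s) : stepItem T s =
    ((false, decide ((flipStep s).1.1.2 = 1), decide ((flipStep s).2.1.2 = 1)), stepTriangle s,
      flipSet (belowTriangle (flipTriangulation T) (flipStep s))) :=
  if_neg h

lemma stepItem_snd_fst (s : ((ℤ × ℤ) × (ℤ × ℤ)) × ((ℤ × ℤ) × (ℤ × ℤ))) :
    (stepItem T s).2.1 = stepTriangle s := by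
  unfold stepItem; split_ifs <;> rfl

lemma stepItem_fst_fst (s : ((ℤ × ℤ) × (ℤ × ℤ)) × ((ℤ × ℤ) × (ℤ × ℤ))) :
    (stepItem T s).1.1 = decide (IsLower s) := by
  unfold stepItem; split_ifs with h <;> simp [h]

lemma stepItem_eq (h : ¬ (stepItem T s).1.isFlat) : (stepItem T s).2.2 = (stepItem T s).2.1 := by
  by_cases hs : IsLower s
  · rw [stepItem_of_isLower hs] at h ⊢
    exact belowTriangle_of_not_isFlat fun hf => h (by simpa [Letter.isFlat, IsFlat] using hf)
  · rw [stepItem_of_not_isLower hs] at h ⊢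
    have : ¬ IsFlat (flipStep s) := fun hf => h (by simpa [Letter.isFlat, IsFlat] using hf)
    simp only
    rw [belowTriangle_of_not_isFlat this, stepTriangle_flipStep, flipSet_flipSet]

lemma middleLinks_eq (l : List (((ℤ × ℤ) × (ℤ × ℤ)) × ((ℤ × ℤ) × (ℤ × ℤ)))) :
    middleLinks l = ((adjacentPairs (l.map (stepItem T))).map fun q => s(q.1.2.1, q.2.2.1) :
      List _) := by
  simp only [middleLinks, adjacentPairs_map, List.map_map]
  congr 2
  ext q : 1
  simp [stepItem_snd_fst]

lemma flatLinks_eq (l : List (((ℤ × ℤ) × (ℤ × ℤ)) × ((ℤ × ℤ) × (ℤ × ℤ)))) :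
    flatLinks T l = wordRungs true (l.map (stepItem T)) := by
  simp only [flatLinks, wordRungs, List.filter_map, List.map_map]
  congr 1
  have e : l.filter ((fun x : Letter × Finset (ℤ × ℤ) × Finset (ℤ × ℤ) =>
      (x.1.1 == true) && x.1.isFlat) ∘ stepItem T) = l.filter fun s => IsLower s ∧ IsFlat s := by
    refine List.filter_congr fun s _ => ?_
    simp only [Function.comp]
    by_cases hs : IsLower s
    · rw [stepItem_of_isLower hs]; simp [hs, Letter.isFlat, IsFlat]
    · rw [stepItem_of_not_isLower hs]; simp [hs]
  rw [e]
  refine List.map_congr_left fun s hs => ?_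
  rw [List.mem_filter, decide_eq_true_eq] at hs
  simp [stepItem_of_isLower hs.2.1]

lemma IsStepList.flatLinks_flip_eq (hl : IsStepList T l) :
    (flatLinks (flipTriangulation T) (l.map flipStep)).map (Sym2.map flipSet) =
      wordRungs false (l.map (stepItem T)) := by
  simp only [flatLinks, wordRungs, List.filter_map, List.map_map, Multiset.map_coe]
  congr 1
  have e : l.filter ((fun x : Letter × Finset (ℤ × ℤ) × Finset (ℤ × ℤ) =>
      (x.1.1 == false) && x.1.isFlat) ∘ stepItem T) =
      l.filter ((fun s => decide (IsLower s ∧ IsFlat s)) ∘ flipStep) := by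
    refine List.filter_congr fun s hs => ?_
    have hfl := ((hl.mem_iff s).mp hs).isLower_flipStep
    simp only [Function.comp, hfl]
    by_cases hs : IsLower s
    · rw [stepItem_of_isLower hs]; simp [hs]
    · rw [stepItem_of_not_isLower hs]; simp [hs, Letter.isFlat, IsFlat]
  rw [e]
  refine List.map_congr_left fun s hs => ?_
  rw [List.mem_filter, Function.comp, decide_eq_true_eq] at hs
  rw [((hl.mem_iff s).mp hs.1).isLower_flipStep] at hs
  simp [stepItem_of_not_isLower hs.2.1, stepTriangle_flipStep, flipSet_flipSet]

lemma lowerLinks_eq (l : List (((ℤ × ℤ) × (ℤ × ℤ)) × ((ℤ × ℤ) × (ℤ × ℤ)))) :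
    lowerLinks T l = wordLinks true (l.map (stepItem T)) := by
  have e : l.filter ((fun x : Letter × Finset (ℤ × ℤ) × Finset (ℤ × ℤ) =>
      x.1.1 == true) ∘ stepItem T) = l.filter fun s => IsLower s := by
    refine List.filter_congr fun s _ => ?_
    simp [stepItem_fst_fst]
  simp only [lowerLinks, lowerPairs, wordLinks, List.filter_map, List.map_map, adjacentPairs_map, e]
  have hm : ∀ q ∈ adjacentPairs (l.filter fun s => IsLower s), IsLower q.1 ∧ IsLower q.2 :=
    fun q hq => by
      obtain ⟨h1, h2, -⟩ := (mem_adjacentPairs_filter (x := q.1) (y := q.2)).mp hq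
      exact ⟨h1, h2⟩
  have e2 : (adjacentPairs (l.filter fun s => IsLower s)).filter
      ((fun q : (Letter × Finset (ℤ × ℤ) × Finset (ℤ × ℤ)) × _ => q.1.1.2.2) ∘
        Prod.map (stepItem T) (stepItem T)) =
      (adjacentPairs (l.filter fun s => IsLower s)).filter fun q => q.1.2.1.2 = 1 := by
    refine List.filter_congr fun q hq => ?_
    simp [stepItem_of_isLower (hm q hq).1]
  rw [e2]
  refine List.map_congr_left fun q hq => ?_
  obtain ⟨h1, h2⟩ := hm q (List.mem_filter.mp hq).1
  simp [stepItem_of_isLower h1, stepItem_of_isLower h2]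

lemma IsStepList.lowerLinks_flip_eq (hl : IsStepList T l) :
    (lowerLinks (flipTriangulation T) (l.map flipStep)).map (Sym2.map flipSet) =
      wordLinks false (l.map (stepItem T)) := by
  have e : l.filter ((fun x : Letter × Finset (ℤ × ℤ) × Finset (ℤ × ℤ) =>
      x.1.1 == false) ∘ stepItem T) = l.filter fun s => ¬ IsLower s := by
    refine List.filter_congr fun s _ => ?_
    simp [stepItem_fst_fst]
  have e' : l.filter ((fun s => decide (IsLower s)) ∘ flipStep) =
      l.filter fun s => ¬ IsLower s := by
    refine List.filter_congr fun s hs => ?_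
    simp [((hl.mem_iff s).mp hs).isLower_flipStep]
  simp only [lowerLinks, lowerPairs, wordLinks, List.filter_map, List.map_map, adjacentPairs_map, e,
    e']
  have hm : ∀ q ∈ adjacentPairs (l.filter fun s => ¬ IsLower s), ¬ IsLower q.1 ∧ ¬ IsLower q.2 :=
    fun q hq => by
      obtain ⟨h1, h2, -⟩ := (mem_adjacentPairs_filter (P := fun s => ¬ IsLower s) (x := q.1)
        (y := q.2)).mp hq
      exact ⟨h1, h2⟩
  have e2 : (adjacentPairs (l.filter fun s => ¬ IsLower s)).filter
      ((fun q : (Letter × Finset (ℤ × ℤ) × Finset (ℤ × ℤ)) × _ => q.1.1.2.2) ∘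
        Prod.map (stepItem T) (stepItem T)) =
      (adjacentPairs (l.filter fun s => ¬ IsLower s)).filter
        ((fun q => decide (q.1.2.1.2 = 1)) ∘ Prod.map flipStep flipStep) := by
    refine List.filter_congr fun q hq => ?_
    simp [stepItem_of_not_isLower (hm q hq).1]
  rw [e2]
  refine List.map_congr_left fun q hq => ?_
  obtain ⟨h1, h2⟩ := hm q (List.mem_filter.mp hq).1
  simp [stepItem_of_not_isLower h1, stepItem_of_not_isLower h2]

lemma mem_wordVertices (hl : IsStepList T l) {t : Finset (ℤ × ℤ)} :
    t ∈ wordVertices (l.map (stepItem T)) ↔ (∃ s, IsStep T s ∧ t = stepTriangle s) ∨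
      (∃ s, IsStep T s ∧ IsLower s ∧ IsFlat s ∧ t = belowTriangle T s) ∨
      ∃ s, IsStep (flipTriangulation T) s ∧ IsLower s ∧ IsFlat s ∧
        t = flipSet (belowTriangle (flipTriangulation T) s) := by
  simp only [wordVertices, List.map_map, List.mem_append, List.mem_map, List.filter_map,
    List.mem_filter, Function.comp, stepItem_snd_fst]
  refine or_congr ?_ ⟨?_, ?_⟩
  · simp only [hl.mem_iff, eq_comm]
  · rintro ⟨s, ⟨hs, hf⟩, rfl⟩
    rw [hl.mem_iff] at hs
    by_cases hlow : IsLower s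
    · rw [stepItem_of_isLower hlow] at hf ⊢
      exact Or.inl ⟨s, hs, hlow, by simpa [Letter.isFlat, IsFlat] using hf, rfl⟩
    · rw [stepItem_of_not_isLower hlow] at hf ⊢
      exact Or.inr ⟨_, hs.flip, hs.isLower_flipStep.mpr hlow,
        by simpa [Letter.isFlat, IsFlat] using hf, rfl⟩
  · rintro (⟨s, hs, hlow, hf, rfl⟩ | ⟨s, hs, hlow, hf, rfl⟩)
    · refine ⟨s, ⟨(hl.mem_iff s).mpr hs, ?_⟩, ?_⟩ <;> rw [stepItem_of_isLower hlow]
      simpa [Letter.isFlat, IsFlat] using hf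
    · have hs' : IsStep T (flipStep s) := by
        rw [← isStep_flipStep, flipStep_flipStep]; exact hs
      have hlow' : ¬ IsLower (flipStep s) := by
        rw [← hs'.isLower_flipStep, flipStep_flipStep]; exact hlow
      refine ⟨flipStep s, ⟨(hl.mem_iff _).mpr hs', ?_⟩, ?_⟩ <;>
        rw [stepItem_of_not_isLower hlow', flipStep_flipStep]
      simpa [Letter.isFlat, IsFlat] using hf

/-- The five kinds of edges left by `reduction` are read off from the letters: consecutive steps,
the rungs across flat edges of either side, and the links around the interior-row points of either
side. -/
lemma CombTriangulation.reduction_wordGraph (hT : CombTriangulation L T)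
    (hL : ∀ p ∈ L, 0 ≤ p.2 ∧ p.2 ≤ 3) (hL0 : ∃ w ∈ L, w.2 = 0) (hL3 : ∃ w ∈ L, w.2 = 3)
    (hl : IsStepList T l) :
    Relation.ReflTransGen MGraph.Step ⟨T, (dualEdges T).val⟩
      (wordGraph (l.map (stepItem T))) := by
  classical
  convert hT.reduction hL hL0 hL3 hl using 1
  ext t
  · simp only [wordGraph, List.mem_toFinset, Finset.mem_filter]
    rw [mem_wordVertices hl, hT.not_isLow_iff hL0 hL3]
  · rw [middleLinks_eq (T := T), flatLinks_eq, hl.flatLinks_flip_eq, lowerLinks_eq,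
      Multiset.map_coe, hl.lowerLinks_flip_eq]
    rfl

/-- The triangles below distinct flat steps are distinct. -/
lemma CombTriangulation.belowTriangle_inj (hT : CombTriangulation L T) (hL : ∃ w ∈ L, w.2 < 1)
    (h : IsStep T s) (h' : IsStep T s') (hs : IsLower s) (hs' : IsLower s') (hf : IsFlat s)
    (hf' : IsFlat s') (he : belowTriangle T s = belowTriangle T s') : s = s' := by
  obtain ⟨x, h1, h2, -, h4⟩ := hT.exists_below hL h hs hf
  obtain ⟨x', h1', h2', -, h4'⟩ := hT.exists_below hL h' hs' hf'
  have hne : ∀ {s}, IsStep T s → IsLower s → IsFlat s → stepTriangle s ≠ belowTriangle T s := by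
    intro s h hs hf he
    obtain ⟨x, h1, -, -, h4⟩ := hT.exists_below hL h hs hf
    have : s.1.2 ∈ belowTriangle T s := by rw [← he]; simp [stepTriangle]
    rw [h4] at this
    simp only [Finset.mem_insert, Finset.mem_singleton] at this
    have hr := h.rows
    rcases this with h | h | h <;> rw [h] at hr <;> omega
  have key : ∀ y : ℤ × ℤ, y.2 = 1 → y ∈ belowTriangle T s → y ∈ stepTriangle s := by
    intro y hy hm
    rw [h4] at hm
    simp only [Finset.mem_insert, Finset.mem_singleton] at hm
    rcases hm with rfl | rfl | rfl
    · simp [stepTriangle]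
    · simp [stepTriangle]
    · omega
  have m1 : s'.1.1 ∈ belowTriangle T s' := by rw [h4']; simp
  have m2 : s'.2.1 ∈ belowTriangle T s' := by rw [h4']; simp
  exact h.ext h' (hT.eq_of_share (h'.fst_ne hs') (h4' ▸ h2') h.stepTriangle_mem
    h'.stepTriangle_mem (he ▸ hne h hs hf) (hne h' hs' hf') m1 m2 (key _ hf'.1 (he ▸ m1))
    (key _ hf'.2 (he ▸ m2)) (by simp [stepTriangle]) (by simp [stepTriangle]))

/-- The triangles of steps cross the line y = 3/2, whereas the second triangles of flat steps lie in
y ≤ 1 or in y ≥ 2, according to the side of the step. -/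
lemma CombTriangulation.wordVertices_nodup (hT : CombTriangulation L T)
    (hL0 : ∃ w ∈ L, w.2 = 0) (hL3 : ∃ w ∈ L, w.2 = 3) (hl : IsStepList T l) :
    (wordVertices (l.map (stepItem T))).Nodup := by
  have hT3 : CombTriangulation (reflect 3 '' L) (flipTriangulation T) :=
    hT.map (isLatticeIso_reflect 3)
  have hL0' : ∃ w ∈ L, w.2 < 1 := hL0.imp fun w h => ⟨h.1, by omega⟩
  have hL0'' : ∃ w ∈ reflect 3 '' L, w.2 < 1 := by
    obtain ⟨w, hw, h⟩ := hL3
    exact ⟨_, ⟨w, hw, rfl⟩, by rw [reflect_apply]; simp only; omega⟩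
  have hlow : ∀ {s}, IsStep T s → IsLower s → IsFlat s → ∀ x ∈ belowTriangle T s, x.2 ≤ 1 := by
    intro s h hs hf x hx
    obtain ⟨y, h1, -, -, h4⟩ := hT.exists_below hL0' h hs hf
    rw [h4] at hx
    simp only [Finset.mem_insert, Finset.mem_singleton] at hx
    have h2 := hf.1
    have h3 := hf.2
    rcases hx with rfl | rfl | rfl <;> omega
  have hup : ∀ {s}, IsStep T s → ¬ IsLower s → IsFlat (flipStep s) →
      ∀ x ∈ flipSet (belowTriangle (flipTriangulation T) (flipStep s)), 2 ≤ x.2 := by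
    intro s h hs hf x hx
    obtain ⟨y, h1, -, -, h4⟩ := hT3.exists_below hL0'' h.flip (h.isLower_flipStep.mpr hs) hf
    have e : (reflect 3 x).2 = 3 - x.2 := rfl
    rw [mem_flipSet, h4] at hx
    simp only [Finset.mem_insert, Finset.mem_singleton] at hx
    have h2 := hf.1
    have h3 := hf.2
    rcases hx with h | h | h <;> rw [h] at e <;> omega
  -- the second triangle of a flat step lies on one side
  have hside : ∀ s, IsStep T s → (stepItem T s).1.isFlat →
      (IsLower s ∧ IsFlat s ∧ (stepItem T s).2.2 = belowTriangle T s) ∨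
      (¬ IsLower s ∧ IsFlat (flipStep s) ∧ (stepItem T s).2.2 =
        flipSet (belowTriangle (flipTriangulation T) (flipStep s))) := by
    intro s hs hf
    by_cases h : IsLower s
    · rw [stepItem_of_isLower h] at hf ⊢
      exact Or.inl ⟨h, by simpa [Letter.isFlat, IsFlat] using hf, rfl⟩
    · rw [stepItem_of_not_isLower h] at hf ⊢
      exact Or.inr ⟨h, by simpa [Letter.isFlat, IsFlat] using hf, rfl⟩
  simp only [wordVertices, List.map_map, List.filter_map]
  rw [List.nodup_append]
  refine ⟨?_, ?_, ?_⟩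
  · refine List.Nodup.map_on (fun s hs s' hs' h => ?_) hl.nodup
    simp only [Function.comp, stepItem_snd_fst] at h
    exact ((hl.mem_iff s).mp hs).ext ((hl.mem_iff s').mp hs') h
  · refine List.Nodup.map_on (fun s hs s' hs' h => ?_) (hl.nodup.filter _)
    rw [List.mem_filter, hl.mem_iff] at hs hs'
    simp only [Function.comp] at h hs hs'
    rcases hside s hs.1 hs.2 with ⟨a1, a2, a3⟩ | ⟨a1, a2, a3⟩ <;>
      rcases hside s' hs'.1 hs'.2 with ⟨b1, b2, b3⟩ | ⟨b1, b2, b3⟩ <;> rw [a3, b3] at h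
    · exact hT.belowTriangle_inj hL0' hs.1 hs'.1 a1 b1 a2 b2 h
    · exfalso
      have m := (hT.fst_mem_belowTriangle hL0' hs.1 a1).1
      have e1 := hlow hs.1 a1 a2 _ m
      have e2 := hup hs'.1 b1 b2 _ (h ▸ m)
      omega
    · exfalso
      have m := (hT.fst_mem_belowTriangle hL0' hs'.1 b1).1
      have e1 := hlow hs'.1 b1 b2 _ m
      have e2 := hup hs.1 a1 a2 _ (h ▸ m)
      omega
    · have := hT3.belowTriangle_inj hL0'' hs.1.flip hs'.1.flip (hs.1.isLower_flipStep.mpr a1)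
        (hs'.1.isLower_flipStep.mpr b1) a2 b2 (flipSet.injective h)
      rw [← flipStep_flipStep s, this, flipStep_flipStep]
  · intro t ht t' ht'
    rw [List.mem_map] at ht ht'
    obtain ⟨s, hs, rfl⟩ := ht
    obtain ⟨s', hs', rfl⟩ := ht'
    rw [List.mem_filter, hl.mem_iff] at hs'
    rw [hl.mem_iff] at hs
    simp only [Function.comp, stepItem_snd_fst] at hs' ⊢
    intro h
    have hr := hs.rows
    rcases hside s' hs'.1 hs'.2 with ⟨b1, b2, b3⟩ | ⟨b1, b2, b3⟩ <;> rw [b3] at h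
    · have := hlow hs'.1 b1 b2 s.1.2 (by rw [← h]; simp [stepTriangle])
      omega
    · have := hup hs'.1 b1 b2 s.1.1 (by rw [← h]; simp [stepTriangle])
      omega

end StepWord


/-! ### Counting words -/

section Counting

/-- Words that describe the steps along the line `y = 3 / 2`. The states are whether the lower and
the upper end of the current edge lie on the interior rows. -/
def IsWord : Bool → Bool → List Letter → Prop
  | _, _, [] => True
  | x, y, (true, a, c) :: w => a = x ∧ (a || c) = true ∧ IsWord c y w
  | x, y, (false, a, c) :: w => a = y ∧ (a || c) = true ∧ IsWord x c w

/-- The number of letters that end on an interior row. -/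
def arrivals (w : List Letter) : ℕ := w.countP fun x => x.2.2

lemma arrivals_cons (x : Letter) (w : List Letter) :
    arrivals (x :: w) = arrivals w + if x.2.2 then 1 else 0 := by
  simp [arrivals, List.countP_cons]

/-- The leading coefficient of the bound for the number of words. -/
def wordBound : Bool → Bool → ℕ
  | true, true => 41
  | false, false => 5
  | _, _ => 14

lemma card_image_cons_le (x : Letter) (S : Finset (List Letter)) :
    (S.image (x :: ·)).card ≤ S.card := Finset.card_image_le

lemma card_union_le_add {α : Type*} [DecidableEq α] {S S' : Finset α} {a b : ℕ} (h : S.card ≤ a)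
    (h' : S'.card ≤ b) : (S ∪ S').card ≤ a + b :=
  (Finset.card_union_le _ _).trans (Nat.add_le_add h h')

/-- Let A, X, Y, D count the words with fewer than n arrivals from the states (true, true), (true,
false), (false, true), (false, false), and let primes denote n + 1. Splitting off the first letter
gives D' = 1 + X + Y, X' = 1 + X + A + D', Y' = 1 + Y + A + D' and A' = 1 + 2A + X' + Y'. A letter
that moves off an interior row is no arrival and stays at level n + 1, but it lowers the state;
hence the order D, X, Y, A of the construction.

With X = Y the linear part is (X, A) ↦ (3X + A, 6X + 4A), with eigenvalues 1 and 6. The base 7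
leaves room for the constant terms: in units of 7 ^ n / 7 the three bounds need 7 + 14 + 14 = 35, 7
+ 14 + 41 + 35 ≤ 98 and 7 + 41 + 41 + 98 + 98 ≤ 287, that is, 7 times 5, 14 and 41. -/
lemma exists_finset_words (n : ℕ) : ∀ x y, ∃ S : Finset (List Letter),
    7 * S.card ≤ wordBound x y * 7 ^ n ∧ ∀ w, IsWord x y w → arrivals w < n → w ∈ S := by
  induction n with
  | zero => exact fun x y => ⟨∅, by simp, fun w _ h => absurd h (by omega)⟩
  | succ n ih =>
    choose S hc hS using ih
    have hpow : 1 ≤ 7 ^ n := Nat.one_le_pow _ _ (by norm_num)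
    have ctt := hc true true
    have ctf := hc true false
    have cft := hc false true
    simp only [wordBound] at ctt ctf cft
    obtain ⟨D, hD, hD'⟩ : ∃ S : Finset (List Letter), 7 * S.card ≤ 35 * 7 ^ n ∧
        ∀ w, IsWord false false w → arrivals w < n + 1 → w ∈ S := by
      refine ⟨{[]} ∪ (S true false).image ((true, false, true) :: ·) ∪
        (S false true).image ((false, false, true) :: ·), ?_, ?_⟩
      · have h1 := card_image_cons_le (true, false, true) (S true false)
        have h2 := card_image_cons_le (false, false, true) (S false true)
        refine (Nat.mul_le_mul_left 7
          (card_union_le_add (card_union_le_add (Finset.card_singleton _).le h1) h2)).trans ?_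
        omega
      · intro w hw ha
        rcases w with _ | ⟨⟨_ | _, _ | _, _ | _⟩, w⟩ <;> simp [IsWord] at hw <;>
          simp [arrivals_cons] at ha <;> simp [hS, hw, ha]
    obtain ⟨X, hX, hX'⟩ : ∃ S : Finset (List Letter), 7 * S.card ≤ 98 * 7 ^ n ∧
        ∀ w, IsWord true false w → arrivals w < n + 1 → w ∈ S := by
      refine ⟨{[]} ∪ (S true false).image ((true, true, true) :: ·) ∪
        (S true true).image ((false, false, true) :: ·) ∪ D.image ((true, true, false) :: ·), ?_, ?_⟩
      · have h1 := card_image_cons_le (true, true, true) (S true false)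
        have h2 := card_image_cons_le (false, false, true) (S true true)
        have h3 := card_image_cons_le (true, true, false) D
        refine (Nat.mul_le_mul_left 7
          (card_union_le_add (card_union_le_add (card_union_le_add (Finset.card_singleton _).le h1) h2) h3)).trans ?_
        omega
      · intro w hw ha
        rcases w with _ | ⟨⟨_ | _, _ | _, _ | _⟩, w⟩ <;> simp [IsWord] at hw <;>
          simp [arrivals_cons] at ha <;> simp [hS, hD', hw, ha]
    obtain ⟨Y, hY, hY'⟩ : ∃ S : Finset (List Letter), 7 * S.card ≤ 98 * 7 ^ n ∧
        ∀ w, IsWord false true w → arrivals w < n + 1 → w ∈ S := by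
      refine ⟨{[]} ∪ (S false true).image ((false, true, true) :: ·) ∪
        (S true true).image ((true, false, true) :: ·) ∪ D.image ((false, true, false) :: ·), ?_, ?_⟩
      · have h1 := card_image_cons_le (false, true, true) (S false true)
        have h2 := card_image_cons_le (true, false, true) (S true true)
        have h3 := card_image_cons_le (false, true, false) D
        refine (Nat.mul_le_mul_left 7
          (card_union_le_add (card_union_le_add (card_union_le_add (Finset.card_singleton _).le h1) h2) h3)).trans ?_
        omega
      · intro w hw ha
        rcases w with _ | ⟨⟨_ | _, _ | _, _ | _⟩, w⟩ <;> simp [IsWord] at hw <;>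
          simp [arrivals_cons] at ha <;> simp [hS, hD', hw, ha]
    obtain ⟨A, hA, hA'⟩ : ∃ S : Finset (List Letter), 7 * S.card ≤ 287 * 7 ^ n ∧
        ∀ w, IsWord true true w → arrivals w < n + 1 → w ∈ S := by
      refine ⟨{[]} ∪ (S true true).image ((true, true, true) :: ·) ∪
        (S true true).image ((false, true, true) :: ·) ∪ Y.image ((true, true, false) :: ·) ∪
        X.image ((false, true, false) :: ·), ?_, ?_⟩
      · have h1 := card_image_cons_le (true, true, true) (S true true)
        have h2 := card_image_cons_le (false, true, true) (S true true)
        have h3 := card_image_cons_le (true, true, false) Y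
        have h4 := card_image_cons_le (false, true, false) X
        refine (Nat.mul_le_mul_left 7
          (card_union_le_add (card_union_le_add (card_union_le_add (card_union_le_add (Finset.card_singleton _).le h1) h2) h3) h4)).trans ?_
        omega
      · intro w hw ha
        rcases w with _ | ⟨⟨_ | _, _ | _, _ | _⟩, w⟩ <;> simp [IsWord] at hw <;>
          simp [arrivals_cons] at ha <;> simp [hS, hX', hY', hw, ha]
    rintro (_ | _) (_ | _)
    · exact ⟨D, by rw [pow_succ, wordBound]; omega, hD'⟩
    · exact ⟨Y, by rw [pow_succ]; simp only [wordBound]; omega, hY'⟩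
    · exact ⟨X, by rw [pow_succ]; simp only [wordBound]; omega, hX'⟩
    · exact ⟨A, by rw [pow_succ, wordBound]; omega, hA'⟩

end Counting

/-! ### Admissibility of the word and the number of arrivals -/

section StepWord

variable {L : Set (ℤ × ℤ)} {T : Finset (Finset (ℤ × ℤ))}
  {l : List (((ℤ × ℤ) × (ℤ × ℤ)) × ((ℤ × ℤ) × (ℤ × ℤ)))}
  {s s' : ((ℤ × ℤ) × (ℤ × ℤ)) × ((ℤ × ℤ) × (ℤ × ℤ))}

/-- With both lower ends in the row y = 0, the determinant would be divisible by the height of the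
upper end, which is at least 2. -/
lemma IsStep.row_eq_one (h : IsStep T s) (hs : IsLower s) (h1 : 0 ≤ s.1.1.2) (h2 : 0 ≤ s.2.1.2) :
    s.1.1.2 = 1 ∨ s.2.1.2 = 1 := by
  obtain ⟨l, u, l', rfl, a1, a2, a3, -, a5⟩ := h.exists_of_isLower hs
  simp only at h1 h2 ⊢
  by_contra! hne
  have e1 : l.2 = 0 := by omega
  have e2 : l'.2 = 0 := by omega
  have : u.2 * (l'.1 - l.1) = 1 := by
    simp only [latticeDet, e1, e2] at a5; linarith
  rcases Int.isUnit_iff.mp (IsUnit.of_mul_eq_one _ this) with h | h <;> omega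

/-- The edge `e` carries the state. A step moves one end only, so the other half of the state
persists, and consecutive steps share the edge between them. For the upper end, the reflection y ↦ 3
- y exchanges the rows y = 1 and y = 2. -/
lemma CombTriangulation.isWord (hT : CombTriangulation L T)
    (hL : ∀ p ∈ L, 0 ≤ p.2 ∧ p.2 ≤ 3) (l : List (((ℤ × ℤ) × (ℤ × ℤ)) × ((ℤ × ℤ) × (ℤ × ℤ)))) :
    ∀ e : (ℤ × ℤ) × (ℤ × ℤ), (∀ s ∈ l, IsStep T s) →
      (∀ s s', (s, s') ∈ adjacentPairs l → s.2 = s'.1) → (∀ s, l.head? = some s → s.1 = e) →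
      IsWord (decide (e.1.2 = 1)) (decide (e.2.2 = 2)) (l.map fun s => (stepItem T s).1) := by
  induction l with
  | nil => intros; trivial
  | cons s l ih =>
    intro e hs hadj he
    obtain rfl := he s rfl
    have h := hs s (by simp)
    have key := ih s.2 (fun s hs' => hs s (by simp [hs'])) (fun a b hab => hadj a b (by
      cases l with
      | nil => simp [adjacentPairs] at hab
      | cons c l => rw [adjacentPairs_cons_cons]; exact List.mem_cons_of_mem _ hab))
      (fun b hb => by
        cases l with
        | nil => simp at hb
        | cons c l =>
          simp only [List.head?_cons, Option.some.injEq] at hb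
          subst hb
          exact (hadj s c (by rw [adjacentPairs_cons_cons]; simp)).symm)
    have hm : ∀ x ∈ stepTriangle s, 0 ≤ x.2 ∧ x.2 ≤ 3 := fun x hx =>
      hL x (hT.vertex_mem _ h.stepTriangle_mem x hx)
    rw [List.map_cons]
    by_cases hlow : IsLower s
    · rw [stepItem_of_isLower hlow]
      refine ⟨rfl, ?_, ?_⟩
      · have := h.row_eq_one hlow (hm _ (by simp [stepTriangle])).1 (hm _ (by simp [stepTriangle])).1
        simpa using this
      · rw [show s.1.2 = s.2.2 from hlow]; exact key
    · rw [stepItem_of_not_isLower hlow]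
      have e : ∀ x : ℤ × ℤ, decide ((reflect 3 x).2 = 1) = decide (x.2 = 2) := by
        intro x
        rw [reflect_apply]
        simp only [decide_eq_decide]
        omega
      refine ⟨?_, ?_, ?_⟩
      · exact e _
      · have := h.flip.row_eq_one (h.isLower_flipStep.mpr hlow)
          (by
            have := hm s.1.2 (by simp [stepTriangle])
            simp only [flipStep, reflect_apply]; omega)
          (by
            have := hm s.2.2 (by simp [stepTriangle])
            simp only [flipStep, reflect_apply]; omega)
        simpa using this
      · rw [h.fst_eq_of_not_isLower hlow]
        change IsWord _ (decide ((reflect 3 s.2.2).2 = 1)) _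
        rw [e]
        exact key

/-- Distinct arrivals of the same end are at distinct points by `unique_enter`, applied to the
flipped triangulation for the upper end. -/
lemma CombTriangulation.arrivals_le (hT : CombTriangulation L T) (hl : IsStepList T l) :
    ∃ S S' : Finset (ℤ × ℤ), (∀ p ∈ S, p ∈ L ∧ p.2 = 1) ∧ (∀ p ∈ S', p ∈ L ∧ p.2 = 2) ∧
      arrivals (l.map fun s => (stepItem T s).1) ≤ S.card + S'.card := by
  classical
  have hT3 : CombTriangulation (reflect 3 '' L) (flipTriangulation T) :=
    hT.map (isLatticeIso_reflect 3)
  set F := (l.filter fun s => (stepItem T s).1.2.2).toFinset with hF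
  have hmem : ∀ s, s ∈ F ↔ IsStep T s ∧ (stepItem T s).1.2.2 = true := by
    intro s; rw [hF, List.mem_toFinset, List.mem_filter, hl.mem_iff]
  have h1 : ∀ s ∈ F.filter fun s => IsLower s, IsStep T s ∧ IsLower s ∧ s.2.1.2 = 1 := by
    intro s hs
    rw [Finset.mem_filter, hmem] at hs
    obtain ⟨⟨a1, a2⟩, a3⟩ := hs
    rw [stepItem_of_isLower a3] at a2
    exact ⟨a1, a3, by simpa using a2⟩
  have h2 : ∀ s ∈ F.filter fun s => ¬ IsLower s,
      IsStep T s ∧ ¬ IsLower s ∧ (flipStep s).2.1.2 = 1 := by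
    intro s hs
    rw [Finset.mem_filter, hmem] at hs
    obtain ⟨⟨a1, a2⟩, a3⟩ := hs
    rw [stepItem_of_not_isLower a3] at a2
    exact ⟨a1, a3, by simpa using a2⟩
  refine ⟨(F.filter fun s => IsLower s).image fun s => s.2.1,
    (F.filter fun s => ¬ IsLower s).image fun s => s.2.2, ?_, ?_, ?_⟩
  · intro p hp
    obtain ⟨s, hs, rfl⟩ := Finset.mem_image.mp hp
    obtain ⟨a1, a2, a3⟩ := h1 s hs
    exact ⟨hT.vertex_mem _ a1.stepTriangle_mem _ (by simp [stepTriangle]), a3⟩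
  · intro p hp
    obtain ⟨s, hs, rfl⟩ := Finset.mem_image.mp hp
    obtain ⟨a1, a2, a3⟩ := h2 s hs
    refine ⟨hT.vertex_mem _ a1.stepTriangle_mem _ (by simp [stepTriangle]), ?_⟩
    simp only [flipStep, reflect_apply] at a3
    omega
  · rw [Finset.card_image_of_injOn, Finset.card_image_of_injOn,
      Finset.card_filter_add_card_filter_not, hF, List.toFinset_card_of_nodup (hl.nodup.filter _),
      arrivals, List.countP_map, List.countP_eq_length_filter]
    · exact le_rfl
    · intro s hs s' hs' he
      obtain ⟨a1, a2, a3⟩ := h2 s hs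
      obtain ⟨b1, b2, b3⟩ := h2 s' hs'
      have := hT3.unique_enter a1.flip b1.flip (a1.isLower_flipStep.mpr a2)
        (b1.isLower_flipStep.mpr b2) (congrArg (reflect 3) he) a3
      rw [← flipStep_flipStep s, this, flipStep_flipStep]
    · intro s hs s' hs' he
      obtain ⟨a1, a2, a3⟩ := h1 s hs
      obtain ⟨b1, b2, b3⟩ := h1 s' hs'
      exact hT.unique_enter a1 b1 a2 b2 he a3

end StepWord


/-! ### Lattice points of polygons -/

section Polygon

/-- At a point that is not interior there is a supporting functional. In the coordinates given by
the two forms, the points `q`, `q'` on both sides in the row of `p` kill its horizontal part, and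
then `w`, `w'` below and above kill the vertical part; but it is not zero. -/
lemma Convex.mem_interior_of_between {P : Set (ℝ × ℝ)} (hP : Convex ℝ P)
    (hint : (interior P).Nonempty) {a b c d : ℝ} (hdet : a * d - b * c = 1) {p q q' w w' : ℝ × ℝ}
    (hq : q ∈ P) (hq' : q' ∈ P) (hw : w ∈ P) (hw' : w' ∈ P)
    (h1 : c * q.1 + d * q.2 = c * p.1 + d * p.2) (h1' : c * q'.1 + d * q'.2 = c * p.1 + d * p.2)
    (h2 : a * q.1 + b * q.2 < a * p.1 + b * p.2) (h2' : a * p.1 + b * p.2 < a * q'.1 + b * q'.2)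
    (h3 : c * w.1 + d * w.2 < c * p.1 + d * p.2) (h3' : c * p.1 + d * p.2 < c * w'.1 + d * w'.2) :
    p ∈ interior P := by
  by_contra hp
  obtain ⟨f, hf⟩ := geometric_hahn_banach_open_point hP.interior isOpen_interior hp
  have hle : ∀ x ∈ P, f x ≤ f p := by
    intro x hx
    have h : closure (interior P) ⊆ {x | f x ≤ f p} :=
      closure_minimal (fun y hy => (hf y hy).le) (isClosed_le f.continuous continuous_const)
    rw [hP.closure_interior_eq_closure_of_nonempty_interior hint] at h
    exact h (subset_closure hx)
  set α := f (1, 0)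
  set β := f (0, 1)
  have hfx : ∀ x : ℝ × ℝ, f x = (α * d - β * c) * (a * x.1 + b * x.2) +
      (β * a - α * b) * (c * x.1 + d * x.2) := by
    intro x
    have e : x = x.1 • ((1, 0) : ℝ × ℝ) + x.2 • ((0, 1) : ℝ × ℝ) := by ext <;> simp
    have : f x = x.1 * α + x.2 * β := by
      conv_lhs => rw [e]
      rw [map_add, map_smul, map_smul, smul_eq_mul, smul_eq_mul]
    rw [this]
    linear_combination -(x.1 * α + x.2 * β) * hdet
  obtain ⟨y, hy⟩ := hint
  have e1 := hle q hq
  have e2 := hle q' hq'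
  have e3 := hle w hw
  have e4 := hle w' hw'
  have e5 := hf y hy
  rw [hfx, hfx p] at e1 e2 e3 e4 e5
  set μ := α * d - β * c
  set ν := β * a - α * b
  have hμ : μ = 0 := by
    refine le_antisymm ?_ ?_
    · by_contra! h
      have := mul_lt_mul_of_pos_left h2' h
      rw [h1'] at e2
      linarith
    · by_contra! h
      have := mul_lt_mul_of_neg_left h2 h
      rw [h1] at e1
      linarith
  have hν : ν = 0 := by
    rw [hμ] at e3 e4
    refine le_antisymm ?_ ?_
    · by_contra! h
      have := mul_lt_mul_of_pos_left h3' h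
      linarith
    · by_contra! h
      have := mul_lt_mul_of_neg_left h3 h
      linarith
  rw [hμ, hν] at e5
  linarith

/-- Only the elements with the smallest and the largest value of `k` can fail to lie between two
others. -/
lemma card_le_card_filter_add_two {α : Type*} [DecidableEq α] (S : Finset α) (k : α → ℤ)
    (hk : Set.InjOn k S) (I : α → Prop) [DecidablePred I]
    (hI : ∀ p ∈ S, ∀ q ∈ S, ∀ q' ∈ S, k q < k p → k p < k q' → I p) :
    S.card ≤ (S.filter I).card + 2 := by
  rcases S.eq_empty_or_nonempty with rfl | hS
  · simp
  obtain ⟨u, hu, hmin⟩ := S.exists_min_image k hS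
  obtain ⟨v, hv, hmax⟩ := S.exists_max_image k hS
  have hsub : S ⊆ S.filter I ∪ {u, v} := by
    intro p hp
    simp only [Finset.mem_union, Finset.mem_filter, Finset.mem_insert, Finset.mem_singleton]
    rcases (hmin p hp).lt_or_eq with h1 | h1
    · rcases (hmax p hp).lt_or_eq with h2 | h2
      · exact Or.inl ⟨hp, hI p hp u hu v hv h1 h2⟩
      · exact Or.inr (Or.inr (hk hp hv h2))
    · exact Or.inr (Or.inl (hk hp hu h1.symm))
  exact (Finset.card_le_card hsub).trans ((Finset.card_union_le _ _).trans
    (Nat.add_le_add_left Finset.card_le_two _))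

variable {P : Set (ℝ × ℝ)}

lemma convex_latticeHull (S : Set (ℤ × ℤ)) : Convex ℝ (latticeHull S) := convex_convexHull ℝ _

lemma IsLatticePolygon.convex (hP : IsLatticePolygon P) : Convex ℝ P := by
  obtain ⟨⟨S, rfl⟩, -⟩ := hP
  exact convex_latticeHull _

lemma IsLatticePolygon.finite_latticePoints (hP : IsLatticePolygon P) :
    (latticePoints P).Finite := by
  obtain ⟨⟨S, rfl⟩, -⟩ := hP
  have hb : Bornology.IsBounded (latticeHull (S : Set (ℤ × ℤ))) :=
    ((S.finite_toSet.image toPlane).isCompact_convexHull ℝ).isBounded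
  obtain ⟨R, hR⟩ := hb.subset_closedBall 0
  refine ((Set.finite_Icc (-⌈R⌉) ⌈R⌉).prod (Set.finite_Icc (-⌈R⌉) ⌈R⌉)).subset fun p hp => ?_
  have h := hR hp
  rw [mem_closedBall_zero_iff] at h
  have hc := Int.le_ceil R
  have h1 : |(p.1 : ℝ)| ≤ ⌈R⌉ := ((norm_fst_le (toPlane p)).trans h).trans hc
  have h2 : |(p.2 : ℝ)| ≤ ⌈R⌉ := ((norm_snd_le (toPlane p)).trans h).trans hc
  rw [abs_le] at h1 h2
  refine ⟨⟨?_, ?_⟩, ⟨?_, ?_⟩⟩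
  · exact_mod_cast h1.1
  · exact_mod_cast h1.2
  · exact_mod_cast h2.1
  · exact_mod_cast h2.2

lemma interiorLatticePoints_subset : interiorLatticePoints P ⊆ latticePoints P :=
  fun p hp => show toPlane p ∈ P from interior_subset hp

/-- The interior polygon of a polygon of genus 0 is empty. Positivity of the genus is needed for
dividing by its square root. -/
lemma IsLatticePolygon.one_le_latticeGenus (hP : IsLatticePolygon P) (h : IsNonhyperelliptic P) :
    1 ≤ latticeGenus P := by
  rw [Nat.one_le_iff_ne_zero, ← Nat.pos_iff_ne_zero, latticeGenus,
    Set.ncard_pos (hP.finite_latticePoints.subset interiorLatticePoints_subset)]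
  by_contra hne
  rw [Set.not_nonempty_iff_eq_empty] at hne
  have := h
  rw [IsNonhyperelliptic, interiorPolygon, hne, latticeHull] at this
  simp at this

/-- The affine map `(x, y) ↦ (a x + b y, c x + d y - m)` of the lattice. -/
def latticeMap (a b c d m : ℤ) (h : a * d - b * c = 1) : Equiv.Perm (ℤ × ℤ) where
  toFun p := (a * p.1 + b * p.2, c * p.1 + d * p.2 - m)
  invFun q := (d * q.1 - b * (q.2 + m), a * (q.2 + m) - c * q.1)
  left_inv p := by
    ext
    · simp only; linear_combination p.1 * h
    · simp only; linear_combination p.2 * h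
  right_inv q := by
    ext
    · simp only; linear_combination q.1 * h
    · simp only; linear_combination (q.2 + m) * h

lemma latticeMap_apply {a b c d m : ℤ} (h : a * d - b * c = 1) (p : ℤ × ℤ) :
    latticeMap a b c d m h p = (a * p.1 + b * p.2, c * p.1 + d * p.2 - m) := rfl

lemma isLatticeIso_latticeMap {a b c d m : ℤ} (h : a * d - b * c = 1) :
    IsLatticeIso (latticeMap a b c d m h) 1 :=
  ⟨⟨a, b, c, d, 0, -m, h, fun p => by rw [latticeMap_apply]; ext <;> simp only <;> ring⟩,
    Or.inl rfl⟩

/-- A lattice polygon of lattice width `3` can be moved to the strip `0 ≤ y ≤ 3`. -/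
lemma IsLatticePolygon.exists_latticeMap (hP : IsLatticePolygon P) (hw : HasLatticeWidth P 3) :
    ∃ (a b c d m : ℤ) (h : a * d - b * c = 1),
      (∀ p ∈ latticeMap a b c d m h '' latticePoints P, 0 ≤ p.2 ∧ p.2 ≤ 3) ∧
      (∃ p ∈ latticeMap a b c d m h '' latticePoints P, p.2 = 0) ∧
      ∃ p ∈ latticeMap a b c d m h '' latticePoints P, p.2 = 3 := by
  obtain ⟨⟨S, rfl⟩, hint⟩ := hP
  obtain ⟨⟨A, k, hA⟩, hleast⟩ := hw
  have hdet : A.1 0 0 * A.1 1 1 - A.1 0 1 * A.1 1 0 = 1 := by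
    rw [← Matrix.det_fin_two]; exact A.2
  have hS : S.Nonempty := by
    rw [Finset.nonempty_iff_ne_empty]
    rintro rfl
    simp [latticeHull] at hint
  set c := A.1 1 0 with hc
  set d := A.1 1 1 with hd
  obtain ⟨u, hu, hmin⟩ := S.exists_min_image (fun p => c * p.1 + d * p.2) hS
  obtain ⟨v, hv, hmax⟩ := S.exists_max_image (fun p => c * p.1 + d * p.2) hS
  have hSP : ∀ p ∈ S, toPlane p ∈ latticeHull (S : Set (ℤ × ℤ)) := fun p hp =>
    subset_convexHull ℝ _ ⟨p, hp, rfl⟩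
  set m := c * u.1 + d * u.2 with hm
  set M := c * v.1 + d * v.2 with hM
  have hstrip : ∀ x ∈ latticeHull (S : Set (ℤ × ℤ)),
      (m : ℝ) ≤ c * x.1 + d * x.2 ∧ (c : ℝ) * x.1 + d * x.2 ≤ M := by
    have hconv : Convex ℝ {x : ℝ × ℝ | (m : ℝ) ≤ c * x.1 + d * x.2 ∧ (c : ℝ) * x.1 + d * x.2 ≤ M} := by
      rintro x ⟨hx1, hx2⟩ y ⟨hy1, hy2⟩ s t hs ht hst
      obtain rfl : t = 1 - s := by linarith
      simp only [Set.mem_ofPred_eq, Prod.fst_add, Prod.snd_add, Prod.smul_fst, Prod.smul_snd,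
        smul_eq_mul]
      have a1 := mul_le_mul_of_nonneg_left hx1 hs
      have a2 := mul_le_mul_of_nonneg_left hy1 ht
      have a3 := mul_le_mul_of_nonneg_left hx2 hs
      have a4 := mul_le_mul_of_nonneg_left hy2 ht
      constructor <;> linarith
    refine fun x hx => convexHull_min ?_ hconv hx
    rintro _ ⟨p, hp, rfl⟩
    have a1 := hmin p hp
    have a2 := hmax p hp
    simp only [toPlane, Set.mem_ofPred_eq]
    exact ⟨by exact_mod_cast a1, by exact_mod_cast a2⟩
  -- The tight strip between the extreme rows `m` and `M` is at least 3 wide by minimality, and at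
  -- most 3 wide since a strip of width 3 contains the polygon. Hence both boundary rows contain
  -- lattice points.
  have h1 : (3 : ℝ) ≤ (M - m : ℤ) := hleast ⟨A, m, fun x hx => by
    have := hstrip x hx
    simp only [matrixAct, ← hc, ← hd]
    push_cast
    exact ⟨this.1, by linarith [this.2]⟩⟩
  have h2 : ((M - m : ℤ) : ℝ) ≤ 3 := by
    have a1 := (hA _ (hSP u hu)).1
    have a2 := (hA _ (hSP v hv)).2
    simp only [matrixAct, ← hc, ← hd, toPlane] at a1 a2
    rw [hM, hm]
    push_cast
    linarith
  have h1' : (3 : ℤ) ≤ M - m := by exact_mod_cast h1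
  have h2' : M - m ≤ 3 := by exact_mod_cast h2
  refine ⟨A.1 0 0, A.1 0 1, c, d, m, hdet, ?_, ⟨_, ⟨u, hSP u hu, rfl⟩, ?_⟩,
    ⟨_, ⟨v, hSP v hv, rfl⟩, ?_⟩⟩
  · rintro _ ⟨p, hp, rfl⟩
    obtain ⟨a1, a2⟩ := hstrip _ hp
    simp only [toPlane] at a1 a2
    have a1' : m ≤ c * p.1 + d * p.2 := by exact_mod_cast a1
    have a2' : c * p.1 + d * p.2 ≤ M := by exact_mod_cast a2
    rw [latticeMap_apply]
    simp only
    omega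
  · rw [latticeMap_apply]; simp only; omega
  · rw [latticeMap_apply]; simp only; omega

/-- The lattice points of two inner rows. -/
lemma IsLatticePolygon.card_rows_le (hP : IsLatticePolygon P) {a b c d m : ℤ}
    (h : a * d - b * c = 1) (hw : ∃ p ∈ latticeMap a b c d m h '' latticePoints P, p.2 = 0)
    (hw' : ∃ p ∈ latticeMap a b c d m h '' latticePoints P, p.2 = 3) {S S' : Finset (ℤ × ℤ)}
    (hS : ∀ p ∈ S, p ∈ latticeMap a b c d m h '' latticePoints P ∧ p.2 = 1)
    (hS' : ∀ p ∈ S', p ∈ latticeMap a b c d m h '' latticePoints P ∧ p.2 = 2) :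
    S.card + S'.card ≤ latticeGenus P + 4 := by
  classical
  set φ := latticeMap a b c d m h
  obtain ⟨_, ⟨w, hwP, rfl⟩, hw0⟩ := hw
  obtain ⟨_, ⟨w', hwP', rfl⟩, hw3⟩ := hw'
  set I : ℤ × ℤ → Prop := fun p => p ∈ φ '' interiorLatticePoints P
  -- The points in the rows 0 and 3 lie strictly below and above, so a point between two others of
  -- its row is interior. The losses of 2 in each row add up to 4.
  have hrow : ∀ (k : ℤ) (S : Finset (ℤ × ℤ)), 0 < k → k < 3 →
      (∀ p ∈ S, p ∈ φ '' latticePoints P ∧ p.2 = k) → S.card ≤ (S.filter I).card + 2 := by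
    intro k S hk hk3 hS
    refine card_le_card_filter_add_two S Prod.fst (fun p hp q hq he => ?_) I ?_
    · exact Prod.ext he ((hS p hp).2.trans (hS q hq).2.symm)
    · intro p hp q hq q' hq' h1 h2
      obtain ⟨⟨p, hpP, rfl⟩, hpk⟩ := hS p hp
      obtain ⟨⟨q, hqP, rfl⟩, hqk⟩ := hS q hq
      obtain ⟨⟨q', hqP', rfl⟩, hqk'⟩ := hS q' hq'
      refine ⟨p, ?_, rfl⟩
      simp only [φ, latticeMap_apply] at h1 h2 hpk hqk hqk' hw0 hw3
      have h' : (a : ℝ) * d - b * c = 1 := by exact_mod_cast h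
      refine hP.convex.mem_interior_of_between hP.2 h' hqP hqP' hwP hwP' ?_ ?_ ?_ ?_ ?_ ?_ <;>
        simp only [toPlane]
      · exact_mod_cast (by omega : c * q.1 + d * q.2 = c * p.1 + d * p.2)
      · exact_mod_cast (by omega : c * q'.1 + d * q'.2 = c * p.1 + d * p.2)
      · exact_mod_cast h1
      · exact_mod_cast h2
      · exact_mod_cast (by omega : c * w.1 + d * w.2 < c * p.1 + d * p.2)
      · exact_mod_cast (by omega : c * p.1 + d * p.2 < c * w'.1 + d * w'.2)
  have h1 := hrow 1 S (by norm_num) (by norm_num) hS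
  have h2 := hrow 2 S' (by norm_num) (by norm_num) hS'
  have hdisj : Disjoint (S.filter I) (S'.filter I) := by
    rw [Finset.disjoint_left]
    intro p hp hp'
    have e1 := (hS p (Finset.mem_filter.mp hp).1).2
    have e2 := (hS' p (Finset.mem_filter.mp hp').1).2
    omega
  have h3 : (S.filter I).card + (S'.filter I).card ≤ latticeGenus P := by
    rw [← Finset.card_union_of_disjoint hdisj, latticeGenus,
      ← Set.ncard_image_of_injective _ φ.injective, ← Set.ncard_coe_finset]
    refine Set.ncard_le_ncard (fun p hp => ?_)
      ((hP.finite_latticePoints.subset interiorLatticePoints_subset).image φ)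
    rw [Finset.mem_coe, Finset.mem_union, Finset.mem_filter, Finset.mem_filter] at hp
    rcases hp with h | h <;> exact h.2
  omega

end Polygon

/-! ### From triangulations to words, and the bound -/

section Main

variable {P : Set (ℝ × ℝ)} {T : Finset (Finset (ℤ × ℤ))}

lemma map_finsetCongr_mem_dualEdges {φ : Equiv.Perm (ℤ × ℤ)} {e : Sym2 (Finset (ℤ × ℤ))} :
    Sym2.map φ.finsetCongr e ∈ dualEdges (mapTriangulation φ T) ↔ e ∈ dualEdges T := by
  induction e with
  | h t t' =>
    rw [Sym2.map_mk, mk_mem_dualEdges, mk_mem_dualEdges, φ.finsetCongr.injective.ne_iff,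
      Equiv.finsetCongr_apply, Equiv.finsetCongr_apply, mem_mapTriangulation, mem_mapTriangulation,
      ← Finset.map_inter, Finset.card_map]

lemma perm_dualEdges (φ : Equiv.Perm (ℤ × ℤ)) :
    MGraph.perm φ.finsetCongr ⟨T, (dualEdges T).val⟩ =
      ⟨mapTriangulation φ T, (dualEdges (mapTriangulation φ T)).val⟩ := by
  have hinj : Function.Injective (Sym2.map φ.finsetCongr : Sym2 (Finset (ℤ × ℤ)) → _) :=
    Sym2.map.injective φ.finsetCongr.injective
  have : (dualEdges T).val.map (Sym2.map φ.finsetCongr) =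
      (dualEdges (mapTriangulation φ T)).val := by
    refine (Multiset.Nodup.ext ((dualEdges T).nodup.map hinj)
      (dualEdges (mapTriangulation φ T)).nodup).mpr fun e => ?_
    obtain ⟨e, rfl⟩ : ∃ e', Sym2.map φ.finsetCongr e' = e := by
      refine ⟨Sym2.map φ.finsetCongr.symm e, ?_⟩
      induction e with
      | h t t' => rw [Sym2.map_mk, Sym2.map_mk, Equiv.apply_symm_apply, Equiv.apply_symm_apply]
    rw [Multiset.mem_map_of_injective hinj, Finset.mem_val, Finset.mem_val,
      map_finsetCongr_mem_dualEdges]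
  rw [MGraph.perm, this]
  rfl

/-- The dual graph of a triangulation can be reduced to the graph of a word. -/
lemma IsLatticePolygon.exists_word (hP : IsLatticePolygon P) (hw : HasLatticeWidth P 3)
    (hT : IsUnimodularTriangulation P T) :
    ∃ (x y : Bool) (I : List (Letter × Finset (ℤ × ℤ) × Finset (ℤ × ℤ)))
      (σ : Equiv.Perm (Finset (ℤ × ℤ))), IsWord x y (I.map Prod.fst) ∧
      arrivals (I.map Prod.fst) < latticeGenus P + 5 ∧
      (∀ x ∈ I, ¬ x.1.isFlat → x.2.2 = x.2.1) ∧ (wordVertices I).Nodup ∧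
      Relation.ReflTransGen MGraph.Step ⟨T, (dualEdges T).val⟩ ((wordGraph I).perm σ) := by
  obtain ⟨a, b, c, d, m, h, hL, hL0, hL3⟩ := hP.exists_latticeMap hw
  set φ := latticeMap a b c d m h
  have hC := (hT.combTriangulation hP.convex).map (isLatticeIso_latticeMap (m := m) h)
  obtain ⟨l, hl⟩ := hC.exists_stepList
  obtain ⟨S, S', hS, hS', harr⟩ := hC.arrivals_le hl
  have hcard := hP.card_rows_le h hL0 hL3 hS hS'
  have hfst : ((l.map (stepItem (mapTriangulation φ T))).map Prod.fst) =
      l.map fun s => (stepItem (mapTriangulation φ T) s).1 := by rw [List.map_map]; rfl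
  -- The initial state comes from the first edge; for the empty word any edge will do.
  obtain ⟨e, he⟩ : ∃ e, ∀ s, l.head? = some s → s.1 = e := by
    cases l with
    | nil => exact ⟨((0, 0), (0, 0)), by simp⟩
    | cons s l => exact ⟨s.1, by simp⟩
  refine ⟨decide (e.1.2 = 1), decide (e.2.2 = 2), l.map (stepItem (mapTriangulation φ T)), φ.finsetCongr⁻¹, ?_, ?_, ?_,
    hC.wordVertices_nodup hL0 hL3 hl, ?_⟩
  · rw [hfst]
    exact hC.isWord hL l e (fun s hs => (hl.mem_iff s).mp hs)
      (fun s s' hs => ((hl.adjacent_iff s s').mp hs).2.2) he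
  · rw [hfst]; exact Nat.lt_succ_of_le (harr.trans hcard)
  · intro x hx hf
    obtain ⟨s, -, rfl⟩ := List.mem_map.mp hx
    exact stepItem_eq hf
  -- The reduction takes place in the moved triangulation and is carried back to the original one,
  -- which accounts for the permutation in the result.
  · have key := Relation.ReflTransGen.lift (MGraph.perm φ.finsetCongr⁻¹)
      (fun G H (h : MGraph.Step G H) => h.perm _) _ _ (hC.reduction_wordGraph hL hL0 hL3 hl)
    rw [← perm_dualEdges, Function.onFun, MGraph.perm_perm, inv_mul_cancel, MGraph.perm_one] at key
    exact key

/-- By Bernoulli's inequality the ratio (8 / 7) ^ g grows at least like g / 7, which dominates √g up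
to the factor 2. -/
lemma seven_pow_mul_sqrt_le (g : ℕ) : (7 : ℝ) ^ g * Real.sqrt g ≤ 2 * 8 ^ g := by
  have h1 : 1 + (g : ℝ) * (1 / 7) ≤ (1 + 1 / 7) ^ g :=
    one_add_mul_le_pow (by norm_num) g
  have hg : (0 : ℝ) ≤ g := Nat.cast_nonneg g
  have h2 : Real.sqrt g ≤ 2 * (1 + 1 / 7) ^ g := by
    refine Real.sqrt_le_iff.mpr ⟨by positivity, ?_⟩
    calc (g : ℝ) ≤ (2 * (1 + (g : ℝ) * (1 / 7))) ^ 2 := by nlinarith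
      _ ≤ _ := by gcongr
  calc (7 : ℝ) ^ g * Real.sqrt g ≤ 7 ^ g * (2 * (1 + 1 / 7) ^ g) := by gcongr
    _ = 2 * (7 * (1 + 1 / 7)) ^ g := by rw [mul_pow]; ring
    _ = 2 * 8 ^ g := by norm_num

/-- Choose a triangulation and its word for every class. Equal words give word graphs that agree up
to a permutation, hence isomorphic skeletons, so the class is determined by the word. The factor 164
is 4 * 41: four initial states, each with at most 41 * 7 ^ (g + 4) words. -/
lemma IsLatticePolygon.troplanarClasses_bound (hP : IsLatticePolygon P)
    (hw : HasLatticeWidth P 3) : (troplanarClasses P).Finite ∧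
      (troplanarClasses P).ncard ≤ 164 * 7 ^ (latticeGenus P + 4) := by
  classical
  -- The count is of words with strictly fewer arrivals than the parameter, and there are at most g
  -- + 4 arrivals.
  choose S hS hS' using exists_finset_words (latticeGenus P + 5)
  set W := Finset.univ.biUnion fun z : Bool × Bool => S z.1 z.2 with hW
  have hWcard : W.card ≤ 164 * 7 ^ (latticeGenus P + 4) := by
    have h1 : ∀ z ∈ (Finset.univ : Finset (Bool × Bool)),
        (S z.1 z.2).card ≤ 41 * 7 ^ (latticeGenus P + 4) := by
      rintro ⟨x, y⟩ -
      have h2 := hS x y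
      have h3 : wordBound x y ≤ 41 := by cases x <;> cases y <;> simp [wordBound]
      have h4 := Nat.mul_le_mul_right (7 ^ (latticeGenus P + 5)) h3
      rw [pow_succ] at h2 h4
      simp only
      omega
    refine (Finset.card_biUnion_le_card_mul _ _ _ h1).trans ?_
    rw [show (Finset.univ : Finset (Bool × Bool)).card = 4 from rfl]
    omega
  have hex : ∀ k ∈ troplanarClasses P, ∃ K T I σ, k = Quotient.mk _ K ∧
      IsSkeleton (dualGraph T) K ∧ (I.map Prod.fst) ∈ W ∧
      (∀ x ∈ I, ¬ x.1.isFlat → x.2.2 = x.2.1) ∧ (wordVertices I).Nodup ∧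
      Relation.ReflTransGen MGraph.Step ⟨T, (dualEdges T).val⟩ ((wordGraph I).perm σ) := by
    rintro _ ⟨K, ⟨T, hT, hK⟩, rfl⟩
    obtain ⟨x, y, I, σ, h1, h2, h3, h4, h5⟩ := hP.exists_word hw hT.1
    exact ⟨K, T, I, σ, rfl, hK, Finset.mem_biUnion.mpr ⟨(x, y), Finset.mem_univ _,
      hS' x y _ h1 h2⟩, h3, h4, h5⟩
  choose! K T I σ h1 h2 h3 h4 h5 h6 using hex
  have hmaps : Set.MapsTo (fun k => (I k).map Prod.fst) (troplanarClasses P)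
      (W : Set (List Letter)) := fun k hk => h3 k hk
  have hinj : Set.InjOn (fun k => (I k).map Prod.fst) (troplanarClasses P) := by
    intro k hk k' hk' he
    rw [h1 k hk, h1 k' hk']
    refine Quotient.sound ?_
    obtain ⟨τ, hτ⟩ := exists_wordGraph_perm he (h4 k hk) (h4 k' hk') (h5 k hk) (h5 k' hk')
    refine MGraph.IsSkeleton.graphIsomorphic (h2 k hk) (h2 k' hk') (models_dualGraph _)
      (models_dualGraph _) (h6 k hk) (h6 k' hk') ⟨σ k' * τ * (σ k)⁻¹, ?_⟩
    rw [← hτ, MGraph.perm_perm, MGraph.perm_perm, inv_mul_cancel_right]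
  refine ⟨Set.Finite.of_injOn hmaps hinj W.finite_toSet, ?_⟩
  have := Set.ncard_le_ncard_of_injOn _ hmaps hinj W.finite_toSet
  rw [Set.ncard_coe_finset] at this
  exact this.trans hWcard

end Main

theorem proposition4p6 :
    ∃ C : ℝ, 0 < C ∧ ∀ P : Set (ℝ × ℝ),
      IsLatticePolygon P → IsNonhyperelliptic P → HasLatticeWidth P 3 →
        (troplanarClasses P).Finite ∧
        ((troplanarClasses P).ncard : ℝ) ≤
          C * ((8 : ℝ) ^ latticeGenus P / Real.sqrt (latticeGenus P : ℝ)) := by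
  -- The factor 164 * 7 ^ 4 comes from the number of words, the factor 2 from
  -- `seven_pow_mul_sqrt_le`.
  refine ⟨164 * 7 ^ 4 * 2, by norm_num, fun P hP hn hw => ?_⟩
  obtain ⟨hfin, hcard⟩ := hP.troplanarClasses_bound hw
  refine ⟨hfin, ?_⟩
  have hg := hP.one_le_latticeGenus hn
  have hpos : 0 < Real.sqrt (latticeGenus P : ℝ) := Real.sqrt_pos.mpr (by exact_mod_cast hg)
  have h1 : ((troplanarClasses P).ncard : ℝ) ≤ 164 * 7 ^ (latticeGenus P + 4) := by
    exact_mod_cast hcard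
  have h2 := seven_pow_mul_sqrt_le (latticeGenus P)
  rw [← mul_div_assoc, le_div_iff₀ hpos]
  calc ((troplanarClasses P).ncard : ℝ) * Real.sqrt (latticeGenus P : ℝ)
      ≤ 164 * 7 ^ (latticeGenus P + 4) * Real.sqrt (latticeGenus P : ℝ) := by gcongr
    _ = 164 * 7 ^ 4 * (7 ^ latticeGenus P * Real.sqrt (latticeGenus P : ℝ)) := by ring
    _ ≤ 164 * 7 ^ 4 * (2 * 8 ^ latticeGenus P) := by gcongr
    _ = _ := by ring
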